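/- Let $\pi\colon E\to\mathbb R$ be a smooth bundle with $\dim E=n+1$, let $\eta=dt$, let $k\ge 1$, and let $\mathcal L=L\,dt$ with $L\in C^\infty(J^k\pi)$ be a $k$th order Lagrangian density. Let $\bar\pi^{m}\colon J^{m}\pi\to\mathbb R$ denote the jet bundles with natural coordinates $(t,q_0,\dots,q_m)$, $\pi^m_r\colon J^m\pi\to J^r\pi$ the projections, $d_T$ the total time derivative, $\Theta_{k-1}$ the tautological $1$-form of $T^*(J^{k-1}\pi)$, with fibre coordinates $(p,p^0,\dots,p^{k-1})$, and $\Omega_{k-1}=-d\Theta_{k-1}$. Let $\mathcal W=J^{2k-1}\pi\times_{J^{k-1}\pi}T^*(J^{k-1}\pi)$ with projections $\rho_1$, $\rho_2$ to the two factors and $\rho_{\mathbb R}$ to $\mathbb R$. Let $\hat C(j^{2k-1}_t\phi,\alpha)=\langle\alpha,(j^{k-1}\phi)_*\partial_t\rangle$, let $\hat L=L\circ\pi^{2k-1}_k\circ\rho_1$, let $\mathcal W_o=\{\hat C=\hat L\}\subset\mathcal W$, let $\Omega_o$ be the restriction to $\mathcal W_o$ of $\rho_2^*\Omega_{k-1}$,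 and let $\rho_1^o,\rho^o_{\mathbb R}$ be the restrictions of $\rho_1,\rho_{\mathbb R}$. The extended Legendre-Ostrogradsky map $\widetilde{\mathcal{FL}}\colon J^{2k-1}\pi\to T^*(J^{k-1}\pi)$ is the map over $J^{k-1}\pi$ given in natural coordinates by $p^{r-1}=\hat p^{r-1}:=\sum_{i=0}^{k-r}(-1)^i d_T^i(\partial L/\partial q_{r+i})$ for $1\le r\le k$ and $p=L-\sum_{r=1}^k \hat p^{r-1}q_r$. Its graph is the submanifold $\mathcal W_1\subset\mathcal W_o$, and $\rho_1^1=\rho_1|_{\mathcal W_1}$ is a bijection onto $J^{2k-1}\pi$. Put $\Omega_{\mathcal L}=\widetilde{\mathcal{FL}}^*\Omega_{k-1}$. The density $\mathcal L$ is regular if the composition $\mathcal{FL}$ of $\widetilde{\mathcal{FL}}$ with the quotient map $T^*(J^{k-1}\pi)\to T^*(J^{k-1}\pi)/(\bar\pi^{k-1})^*T^*\mathbb R$ is a local diffeomorphism. A vector field $X$ on $J^m\pi$ is a semispray of type $r$ ($1\le r\le m$) if every integral section $\psi$ of $X$ (over an open interval) is holonomic of type $r$: $j^{m-r+1}\phi=\pi^m_{m-r+1}\circ\psi$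 with $\phi=\pi^m_0\circ\psi$. It is a semispray of type $r$ at the points of a set $S$ if at these points $X=f(\partial_t+\sum_{i=0}^{m-r}q_{i+1}\partial_{q_i})+\sum_{i>m-r}X_i\partial_{q_i}$ (for $X$ with $i(X)dt=1$ and $S=J^m\pi$ the two notions agree). Let $\mathfrak X_{\mathcal W_1}(\mathcal W_o)$ be the set of smooth sections over $\mathcal W_1$ of $T\mathcal W_o$. Such an $X_o$ is a semispray of type $r$ if $\rho_1^o\circ\psi$ is holonomic of type $r$ for every integral section $\psi$ of $X_o$ in $\mathcal W_1$, and it is so at the points of a set if $T\rho^o_1\circ X_o$ has the above coordinate expression there. Consider the equations $$(1)\quad i(X_o)\Omega_o=0,\quad i(X_o)(\rho_{\mathbb R}^o)^*\eta=1;\qquad (2)\quad i(X_{\mathcal L})\Omega_{\mathcal L}=0,\quad i(X_{\mathcal L})(\bar\pi^{2k-1})^*\eta=1 .$$ **(a)** Let $X_o\in\mathfrak X_{\mathcal W_1}(\mathcal W_o)$ satisfy (1) and be tangent to $\mathcal W_1$ at all points of $\mathcal W_1$ (respectively: at the points of a subset $\mathcal W_f\subset\mathcal W_1$, e.g. a submanifold).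 Then there is a unique smooth vector field $X_{\mathcal L}$ on $J^{2k-1}\pi$ with $X_{\mathcal L}\circ\rho^o_1=T\rho_1^o\circ X_o$ on $\mathcal W_1$; it is a semispray of type $k$ and satisfies (2) (respectively: at the points of $S_f=\rho_1^o(\mathcal W_f)$). If $\mathcal L$ is regular, then $X_{\mathcal L}$ is a semispray of type $1$ (respectively: at the points of $S_f$). **(b)** Conversely, let $1\le r\le k$ (in particular $r=k$ or $r=1$) and let $X_{\mathcal L}$ be a smooth vector field on $J^{2k-1}\pi$ which is a semispray of type $r$ and satisfies (2) everywhere (respectively: at the points of a subset $S_f\subset J^{2k-1}\pi$, e.g. a submanifold). Then there is $X_o\in\mathfrak X_{\mathcal W_1}(\mathcal W_o)$, tangent to $\mathcal W_1$ and with $X_{\mathcal L}\circ\rho_1^o=T\rho_1^o\circ X_o$ on $\mathcal W_1$, which satisfies (1) and is a semispray of type $r$ on $\mathcal W_1$ (respectively: at the points of $\mathcal W_f=(\rho_1^1)^{-1}(S_f)$). It is unique: every $X_o'\in\mathfrak X_{\mathcal W_1}(\mathcal W_o)$ which satisfies (1) and $X_{\mathcal L}\circ\rho_1^o=T\rho_1^o\circ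 X'_o$ on $\mathcal W_1$ (respectively: at the points of $\mathcal W_f$) coincides with $X_o$ there. -/

import Mathlib

open scoped Manifold ContDiff Topology

namespace JetMech

noncomputable section

variable {V : Type*} [NormedAddCommGroup V] [NormedSpace ℝ V]
  {E : Type*} [TopologicalSpace E] [ChartedSpace (ℝ × V) E]

/-! ### Fibred manifolds over the real line and jets of their sections -/

variable (V) in
/-- A chart `(t, q)` of `E` adapted to `π : E → ℝ`: its first component is `π`. -/
structure AdaptedChart (π : E → ℝ) where
  chart : OpenPartialHomeomorph E (ℝ × V)
  mem_maximalAtlas : chart ∈ IsManifold.maximalAtlas 𝓘(ℝ, ℝ × V) ∞ E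
  fst_eq : ∀ x ∈ chart.source, (chart x).1 = π x

variable (V) in
/-- `π : E → ℝ` is fibred over the real line: there are adapted charts around each point of `E`
(that is, `π` is a smooth submersion; every smooth bundle over `ℝ` has this property). -/
class IsFibred (π : E → ℝ) : Prop where
  exists_adaptedChart : ∀ e : E, ∃ c : AdaptedChart V π, e ∈ c.chart.source

variable (V) in
/-- `φ` is, near the time `t`, a smooth section of `π`. -/
def IsSectionAt (π : E → ℝ) (φ : ℝ → E) (t : ℝ) : Prop :=
  ∀ᶠ s in 𝓝 t, ContMDiffAt 𝓘(ℝ, ℝ) 𝓘(ℝ, ℝ × V) ∞ φ s ∧ π (φ s) = s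

variable (V) in
/-- A time together with a local smooth section of `π` defined around this time. -/
structure PreJet (π : E → ℝ) where
  time : ℝ
  sec : ℝ → E
  isSectionAt : IsSectionAt V π sec time

namespace PreJet
variable {π : E → ℝ}

/-- The point of `E` over which a local section passes. -/
def base (p : PreJet V π) : E := p.sec p.time

/-- The `i`-th derivative, in an adapted chart, of the local section. -/
def deriv (p : PreJet V π) (c : AdaptedChart V π) (i : ℕ) : V :=
  iteratedDeriv i (fun s => (c.chart (p.sec s)).2) p.time

/-- Contact of order `m`: same time, same point, and in each adapted chart around this point the
same derivatives up to order `m`. -/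
def SameJet (m : ℕ) (p p' : PreJet V π) : Prop :=
  p.time = p'.time ∧ p.base = p'.base ∧
    ∀ c : AdaptedChart V π, p.base ∈ c.chart.source → ∀ i ≤ m, p.deriv c i = p'.deriv c i

variable (V π) in
/-- Contact of order `m` as an equivalence relation. -/
def setoid (m : ℕ) : Setoid (PreJet V π) where
  r := SameJet m
  iseqv :=
    { refl := fun _ => ⟨rfl, rfl, fun _ _ _ _ => rfl⟩
      symm := fun {p p'} (h : SameJet m p p') => ⟨h.1.symm, h.2.1.symm,
        fun c hc i hi => (h.2.2 c (by rw [h.2.1]; exact hc) i hi).symm⟩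
      trans := fun {p p' p''} (h : SameJet m p p') (h' : SameJet m p' p'') => ⟨h.1.trans h'.1, h.2.1.trans h'.2.1,
        fun c hc i hi => (h.2.2 c hc i hi).trans (h'.2.2 c (by rw [← h.2.1]; exact hc) i hi)⟩ }

theorem contMDiffAt (p : PreJet V π) : ContMDiffAt 𝓘(ℝ, ℝ) 𝓘(ℝ, ℝ × V) ∞ p.sec p.time :=
  p.isSectionAt.self_of_nhds.1

theorem proj_base (p : PreJet V π) : π p.base = p.time :=
  p.isSectionAt.self_of_nhds.2

end PreJet

variable (V) in
/-- The `m`-th order jet bundle `J^m π`: the set of `m`-jets of (local) sections of `π`. -/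
def Jet (π : E → ℝ) (m : ℕ) : Type _ := Quotient (PreJet.setoid V π m)

variable (V) in
/-- The model space `(t, q_0, …, q_m)` of the jet bundle `J^m π`. -/
abbrev JetModel (m : ℕ) : Type _ := ℝ × (Fin (m + 1) → V)

namespace Jet
variable {π : E → ℝ} {m : ℕ}

/-- The `m`-jet of a local section. -/
def mk (m : ℕ) (p : PreJet V π) : Jet V π m := Quotient.mk _ p

/-- A local section which represents the jet. -/
def rep (y : Jet V π m) : PreJet V π := Quotient.out y

theorem mk_rep (y : Jet V π m) : mk m y.rep = y := Quotient.out_eq y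

/-- The time of a jet, i.e. the projection `J^m π → ℝ`. -/
def time (y : Jet V π m) : ℝ := Quotient.lift PreJet.time (fun _ _ h => And.left h) y

/-- The projection `J^m π → E`. -/
def base (y : Jet V π m) : E := Quotient.lift PreJet.base (fun _ _ h => And.left (And.right h)) y

/-- The natural projection `J^m π → J^r π` for `r ≤ m`. -/
def proj {r m : ℕ} (h : r ≤ m) (y : Jet V π m) : Jet V π r :=
  Quotient.map' (s₁ := PreJet.setoid V π m) (s₂ := PreJet.setoid V π r) id
    (fun _ _ h' => ⟨h'.1, h'.2.1, fun c hc i hi => h'.2.2 c hc i (hi.trans h)⟩) y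

open Classical in
/-- The natural coordinates `(t, q_0, …, q_m)` on `J^m π` induced by an adapted chart of `E`
(with the junk value `0` off the domain). -/
def coord (c : AdaptedChart V π) (y : Jet V π m) : JetModel V m :=
  Quotient.lift (fun p : PreJet V π =>
    if p.base ∈ c.chart.source then (p.time, fun i : Fin (m + 1) => p.deriv c i) else 0)
    (fun p p' h => by
      by_cases hp : p.base ∈ c.chart.source
      · have hp' : p'.base ∈ c.chart.source := h.2.1 ▸ hp
        simp only [hp, hp', if_true]
        exact Prod.ext h.1 (funext fun i => h.2.2 c hp i (Nat.le_of_lt_succ i.2))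
      · have hp' : p'.base ∉ c.chart.source := h.2.1 ▸ hp
        simp only [hp, hp', if_false]) y

theorem time_mk (p : PreJet V π) : (mk m p).time = p.time := rfl
theorem base_mk (p : PreJet V π) : (mk m p).base = p.base := rfl
theorem proj_mk {r : ℕ} (h : r ≤ m) (p : PreJet V π) : (mk m p).proj h = mk r p := rfl

theorem base_proj {r : ℕ} (h : r ≤ m) (y : Jet V π m) : (y.proj h).base = y.base := by
  rw [← mk_rep y, proj_mk, base_mk, base_mk]

theorem coord_mk (c : AdaptedChart V π) (p : PreJet V π) (h : p.base ∈ c.chart.source) :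
    (mk m p).coord c = (p.time, fun i : Fin (m + 1) => p.deriv c i) := by
  exact if_pos h

end Jet

/-! ### The smooth structure of the jet bundles -/

/-- The polynomial curve with prescribed derivatives `q_0, …, q_m` at `t`. -/
def taylorCurve {m : ℕ} (x : JetModel V m) (s : ℝ) : V :=
  ∑ j : Fin (m + 1), (((j : ℕ).factorial : ℝ)⁻¹ * (s - x.1) ^ (j : ℕ)) • x.2 j

theorem contDiff_taylorCurve {m : ℕ} :
    ContDiff ℝ ∞ (fun z : JetModel V m × ℝ => taylorCurve z.1 z.2) := by
  unfold taylorCurve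
  fun_prop

theorem iteratedDeriv_taylorCurve {m : ℕ} (x : JetModel V m) (i : Fin (m + 1)) :
    iteratedDeriv i (taylorCurve x) x.1 = x.2 i := by
  have hterm : ∀ j : Fin (m + 1), iteratedDeriv i
      (fun s : ℝ => (((j : ℕ).factorial : ℝ)⁻¹ * (s - x.1) ^ (j : ℕ)) • x.2 j) x.1 =
        if i = j then x.2 j else 0 := by
    intro j
    rw [iteratedDeriv_smul_const (by fun_prop), iteratedDeriv_const_mul_field,
      iteratedDeriv_comp_sub_const (f := fun s : ℝ => s ^ (j : ℕ))]
    simp only [sub_self, iteratedDeriv_fun_pow_zero, Fin.val_inj]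
    split_ifs with h
    · rw [inv_mul_cancel₀ (by positivity), one_smul]
    · simp
  unfold taylorCurve
  rw [iteratedDeriv_fun_sum fun j _ => by fun_prop]
  simp [hterm]

theorem taylorCurve_self {m : ℕ} (x : JetModel V m) : taylorCurve x x.1 = x.2 0 := by
  simpa using iteratedDeriv_taylorCurve x 0

/-- Iterated derivatives in one variable depend smoothly on parameters. -/
theorem contDiffOn_iteratedDeriv {X G : Type*} [NormedAddCommGroup X] [NormedSpace ℝ X]
    [NormedAddCommGroup G] [NormedSpace ℝ G] {O : Set (X × ℝ)} (hO : IsOpen O)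
    {F : X × ℝ → G} (hF : ContDiffOn ℝ ∞ F O) (i : ℕ) :
    ContDiffOn ℝ ∞ (fun z : X × ℝ => iteratedDeriv i (fun s => F (z.1, s)) z.2) O := by
  induction i with
  | zero => simpa using hF
  | succ i ih =>
    have h1 : ContDiffOn ℝ ∞ (fun z => fderiv ℝ
        (fun z : X × ℝ => iteratedDeriv i (fun s => F (z.1, s)) z.2) z ((0 : X), (1 : ℝ))) O :=
      (ih.fderiv_of_isOpen hO (by simp)).clm_apply contDiffOn_const
    refine h1.congr fun z hz => ?_
    rw [iteratedDeriv_succ]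
    have hd := ((ih.contDiffAt (hO.mem_nhds hz)).differentiableAt (by simp)).hasFDerivAt
    have hc : HasDerivAt (fun s : ℝ => (z.1, s)) ((0 : X), (1 : ℝ)) z.2 :=
      (hasDerivAt_const _ _).prodMk (hasDerivAt_id _)
    exact (hd.comp_hasDerivAt z.2 hc).deriv


namespace AdaptedChart
variable {π : E → ℝ} (c c' : AdaptedChart V π)

/-- The change of adapted coordinates. -/
theorem contDiffOn_trans :
    ContDiffOn ℝ ∞ (c'.chart ∘ c.chart.symm) (c.chart.symm.trans c'.chart).source := by
  have h1 := contMDiffOn_of_mem_maximalAtlas c'.mem_maximalAtlas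
  have h2 := contMDiffOn_symm_of_mem_maximalAtlas c.mem_maximalAtlas
  rw [← contMDiffOn_iff_contDiffOn]
  exact h1.comp (h2.mono fun x hx => hx.1) fun x hx => hx.2

theorem fst_symm {x : ℝ × V} (hx : x ∈ c.chart.target) : π (c.chart.symm x) = x.1 := by
  rw [← c.fst_eq _ (c.chart.map_target hx), c.chart.right_inv hx]

end AdaptedChart

namespace PreJet
variable {π : E → ℝ}

theorem eventually_mem_source (p : PreJet V π) (c : AdaptedChart V π)
    (h : p.base ∈ c.chart.source) : ∀ᶠ s in 𝓝 p.time, p.sec s ∈ c.chart.source :=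
  p.contMDiffAt.continuousAt.eventually (c.chart.open_source.mem_nhds h)

theorem contDiffAt_chart (p : PreJet V π) (c : AdaptedChart V π) (h : p.base ∈ c.chart.source) :
    ContDiffAt ℝ ∞ (fun s => c.chart (p.sec s)) p.time := by
  rw [← contMDiffAt_iff_contDiffAt]
  exact ((contMDiffOn_of_mem_maximalAtlas c.mem_maximalAtlas).contMDiffAt
    (c.chart.open_source.mem_nhds h)).comp p.time p.contMDiffAt

theorem chart_base (p : PreJet V π) (c : AdaptedChart V π) (h : p.base ∈ c.chart.source) :
    c.chart p.base = (p.time, p.deriv c 0) :=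
  Prod.ext ((c.fst_eq _ h).trans p.proj_base) (by simp [deriv, base])

theorem deriv_congr_chart {p p' : PreJet V π} {c c' : AdaptedChart V π} {m : ℕ}
    (ht : p.time = p'.time) (hb : p.base = p'.base) (hc : p.base ∈ c.chart.source)
    (hc' : p.base ∈ c'.chart.source) (h : ∀ i ≤ m, p.deriv c i = p'.deriv c i) :
    ∀ i ≤ m, p.deriv c' i = p'.deriv c' i := by
  intro i hi
  set Ψ : ℝ × V → V := fun x => (c'.chart (c.chart.symm x)).2
  -- the iterated derivatives of the curve in the first chart
  have key : ∀ q : PreJet V π, q.base ∈ c.chart.source → q.base ∈ c'.chart.source →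
      q.deriv c' i = ∑ d : OrderedFinpartition i,
        iteratedFDeriv ℝ d.length Ψ (c.chart q.base) fun j =>
          (iteratedDeriv (d.partSize j) (fun s => s) q.time, q.deriv c (d.partSize j)) := by
    intro q hq hq'
    have hu := q.contDiffAt_chart c hq
    have hΨ : ContDiffAt ℝ ∞ Ψ (c.chart q.base) := by
      have := (c.contDiffOn_trans c').contDiffAt (x := c.chart q.base)
        ((c.chart.symm.trans c'.chart).open_source.mem_nhds
          ⟨c.chart.map_source hq, by simpa [c.chart.left_inv hq] using hq'⟩)
      exact this.snd
    have h1 : (fun s => (c'.chart (q.sec s)).2) =ᶠ[𝓝 q.time]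
        Ψ ∘ (fun s => c.chart (q.sec s)) := by
      filter_upwards [q.eventually_mem_source c hq] with s hs
      simp [Ψ, c.chart.left_inv hs]
    rw [deriv, h1.iteratedDeriv_eq, iteratedDeriv_vcomp_eq_sum_orderedFinpartition (n := ∞)
      (f := fun s => c.chart (q.sec s)) hΨ hu (by exact_mod_cast le_top)]
    refine Finset.sum_congr rfl fun d _ => ?_
    refine congrArg _ (funext fun j => ?_)
    have h2 : (fun s => (c.chart (q.sec s)).1) =ᶠ[𝓝 q.time] fun s => s := by
      filter_upwards [q.eventually_mem_source c hq, q.isSectionAt] with s hs hs'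
      rw [c.fst_eq _ hs, hs'.2]
    have hu' : ContDiffAt ℝ (d.partSize j : ℕ) (fun s => c.chart (q.sec s)) q.time :=
      hu.of_le (by exact_mod_cast le_top)
    refine Prod.ext ?_ ?_
    · rw [← h2.iteratedDeriv_eq]
      have := (ContinuousLinearMap.fst ℝ ℝ V).iteratedFDeriv_comp_left hu' le_rfl
      exact (congrArg (fun M => M fun _ => (1 : ℝ)) this).symm
    · have := (ContinuousLinearMap.snd ℝ ℝ V).iteratedFDeriv_comp_left hu' le_rfl
      exact (congrArg (fun M => M fun _ => (1 : ℝ)) this).symm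
  rw [key p hc hc', key p' (hb ▸ hc) (hb ▸ hc')]
  refine Finset.sum_congr rfl fun d _ => ?_
  rw [hb, ht]
  refine congrArg _ (funext fun j => ?_)
  rw [h _ ((d.partSize_le j).trans hi)]

end PreJet

namespace Jet
variable {π : E → ℝ} {m : ℕ}

theorem mk_eq_mk {p p' : PreJet V π} (c : AdaptedChart V π) (hc : p.base ∈ c.chart.source)
    (ht : p.time = p'.time) (hb : p.base = p'.base)
    (h : ∀ i ≤ m, p.deriv c i = p'.deriv c i) : mk m p = mk m p' :=
  Quotient.sound ⟨ht, hb, fun _ hc' => PreJet.deriv_congr_chart ht hb hc hc' h⟩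

/-- The local section of `π` which is polynomial in the adapted chart `c`. -/
def polySection (c : AdaptedChart V π) (x : JetModel V m)
    (hx : (x.1, x.2 0) ∈ c.chart.target) : PreJet V π where
  time := x.1
  sec s := c.chart.symm (s, taylorCurve x s)
  isSectionAt := by
    have hcont : Continuous fun s => (s, taylorCurve x s) := by
      unfold taylorCurve; fun_prop
    have h1 : ∀ᶠ s in 𝓝 x.1, (s, taylorCurve x s) ∈ c.chart.target :=
      hcont.continuousAt.eventually (c.chart.open_target.mem_nhds (by
        change (x.1, taylorCurve x x.1) ∈ _
        rwa [taylorCurve_self]))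
    filter_upwards [h1] with s hs
    refine ⟨?_, c.fst_symm hs⟩
    refine ((contMDiffOn_symm_of_mem_maximalAtlas c.mem_maximalAtlas).contMDiffAt
      (c.chart.open_target.mem_nhds hs)).comp s (ContDiff.contMDiff ?_ s)
    unfold taylorCurve
    fun_prop

theorem polySection_base (c : AdaptedChart V π) (x : JetModel V m)
    (hx : (x.1, x.2 0) ∈ c.chart.target) :
    (polySection c x hx).base = c.chart.symm (x.1, x.2 0) := by
  simp [PreJet.base, polySection, taylorCurve_self]

theorem polySection_deriv (c : AdaptedChart V π) (x : JetModel V m)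
    (hx : (x.1, x.2 0) ∈ c.chart.target) (i : Fin (m + 1)) :
    (polySection c x hx).deriv c i = x.2 i := by
  have hcont : Continuous fun s => (s, taylorCurve x s) := by
    unfold taylorCurve; fun_prop
  have h1 : ∀ᶠ s in 𝓝 x.1, (s, taylorCurve x s) ∈ c.chart.target :=
    hcont.continuousAt.eventually (c.chart.open_target.mem_nhds (by
      change (x.1, taylorCurve x x.1) ∈ _
      rwa [taylorCurve_self]))
  have h2 : (fun s => (c.chart ((polySection c x hx).sec s)).2) =ᶠ[𝓝 x.1] taylorCurve x := by
    filter_upwards [h1] with s hs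
    simp [polySection, c.chart.right_inv hs]
  rw [← iteratedDeriv_taylorCurve, ← h2.iteratedDeriv_eq]
  rfl

theorem nonempty_of_chart [IsFibred V π] (c : AdaptedChart V π) : Nonempty (Jet V π m) := by
  obtain ⟨c', hc'⟩ := IsFibred.exists_adaptedChart (V := V) (π := π) (c.chart.symm 0)
  refine ⟨mk m (polySection c' (m := 0) ((c'.chart (c.chart.symm 0)).1,
    fun _ => (c'.chart (c.chart.symm 0)).2) (c'.chart.map_source hc'))⟩

open Classical in
/-- The jet with given natural coordinates (with a junk value off the target of the chart). -/
def ofCoord [IsFibred V π] (c : AdaptedChart V π) (x : JetModel V m) : Jet V π m :=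
  if hx : (x.1, x.2 0) ∈ c.chart.target then mk m (polySection c x hx)
    else (nonempty_of_chart c).some

theorem ofCoord_eq [IsFibred V π] (c : AdaptedChart V π) (x : JetModel V m)
    (hx : (x.1, x.2 0) ∈ c.chart.target) : ofCoord c x = mk m (polySection c x hx) :=
  dif_pos hx

/-- The natural chart `(t, q_0, …, q_m)` of `J^m π` induced by an adapted chart of `E`. -/
def natChart [IsFibred V π] (m : ℕ) (c : AdaptedChart V π) :
    PartialEquiv (Jet V π m) (JetModel V m) where
  toFun := coord c
  invFun := ofCoord c
  source := {y | y.base ∈ c.chart.source}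
  target := {x | (x.1, x.2 0) ∈ c.chart.target}
  map_source' := by
    intro y hy
    obtain ⟨p, rfl⟩ : ∃ p, mk m p = y := ⟨_, y.mk_rep⟩
    have hp : p.base ∈ c.chart.source := hy
    have h := c.chart.map_source hp
    rw [p.chart_base c hp] at h
    simpa [coord_mk c p hp] using h
  map_target' := by
    intro x hx
    have hx' : (x.1, x.2 0) ∈ c.chart.target := hx
    rw [ofCoord_eq c x hx', Set.mem_ofPred_eq, base_mk, polySection_base]
    exact c.chart.map_target hx'
  left_inv' := by
    intro y hy
    obtain ⟨p, rfl⟩ : ∃ p, mk m p = y := ⟨_, y.mk_rep⟩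
    have hp : p.base ∈ c.chart.source := hy
    have h := c.chart.map_source hp
    have hcb := p.chart_base c hp
    rw [hcb] at h
    rw [coord_mk c p hp, ofCoord_eq c _ (by simpa using h)]
    refine mk_eq_mk c ?_ rfl ?_ fun i hi => ?_
    · rw [polySection_base]
      exact c.chart.map_target (by simpa using h)
    · rw [polySection_base]
      simp [← hcb, c.chart.left_inv hp]
    · exact polySection_deriv c _ _ ⟨i, Nat.lt_succ_of_le hi⟩
  right_inv' := by
    intro x hx
    have hx' : (x.1, x.2 0) ∈ c.chart.target := hx
    rw [ofCoord_eq c x hx', coord_mk]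
    · exact Prod.ext rfl (funext fun i => polySection_deriv c x hx' i)
    · rw [polySection_base]
      exact c.chart.map_target hx'

section
variable [IsFibred V π]

theorem natChart_trans_source (c c' : AdaptedChart V π) :
    ((natChart m c).symm.trans (natChart m c')).source =
      (fun x : JetModel V m => (x.1, x.2 0)) ⁻¹' (c.chart.symm.trans c'.chart).source := by
  ext x
  simp only [PartialEquiv.trans_source, PartialEquiv.symm_source, Set.mem_inter_iff,
    Set.mem_preimage, OpenPartialHomeomorph.trans_source, OpenPartialHomeomorph.symm_source]
  refine and_congr_right fun hx => ?_
  have hx' : (x.1, x.2 0) ∈ c.chart.target := hx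
  change (ofCoord c x : Jet V π m).base ∈ c'.chart.source ↔
    c.chart.symm (x.1, x.2 0) ∈ c'.chart.source
  rw [ofCoord_eq c x hx', base_mk, polySection_base]

theorem isOpen_natChart_trans_source (c c' : AdaptedChart V π) :
    IsOpen ((natChart m c).symm.trans (natChart m c')).source := by
  rw [natChart_trans_source]
  exact (c.chart.symm.trans c'.chart).open_source.preimage (by fun_prop)

theorem contDiffOn_natChart_trans (c c' : AdaptedChart V π) :
    ContDiffOn ℝ ∞ ((natChart m c).symm.trans (natChart m c'))
      ((natChart m c).symm.trans (natChart m c')).source := by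
  rw [natChart_trans_source]
  set S := (c.chart.symm.trans c'.chart).source
  have hS : IsOpen S := (c.chart.symm.trans c'.chart).open_source
  set g : JetModel V m × ℝ → ℝ × V := fun z => (z.2, taylorCurve z.1 z.2)
  have hg : ContDiff ℝ ∞ g := contDiff_snd.prodMk contDiff_taylorCurve
  have hO : IsOpen (g ⁻¹' S) := hS.preimage hg.continuous
  have hF : ContDiffOn ℝ ∞ (fun z => (c'.chart (c.chart.symm (g z))).2) (g ⁻¹' S) :=
    ((c.contDiffOn_trans c').comp hg.contDiffOn fun _ h => h).snd
  have hmap : Set.MapsTo (fun x : JetModel V m => (x, x.1))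
      ((fun x : JetModel V m => (x.1, x.2 0)) ⁻¹' S) (g ⁻¹' S) := by
    intro x hx
    simpa [g, taylorCurve_self] using hx
  have hmain : ContDiffOn ℝ ∞ (fun x : JetModel V m => (x.1, fun i : Fin (m + 1) =>
      iteratedDeriv i (fun s => (c'.chart (c.chart.symm (g (x, s)))).2) x.1))
      ((fun x : JetModel V m => (x.1, x.2 0)) ⁻¹' S) := by
    refine contDiffOn_fst.prodMk (contDiffOn_pi.2 fun i => ?_)
    exact (contDiffOn_iteratedDeriv hO hF i).comp
      (f := fun x : JetModel V m => (x, x.1)) (contDiff_id.prodMk contDiff_fst).contDiffOn hmap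
  refine hmain.congr fun x hx => ?_
  have hx' : (x.1, x.2 0) ∈ c.chart.target := hx.1
  change coord c' (ofCoord c x : Jet V π m) = _
  rw [ofCoord_eq c x hx', coord_mk]
  · rfl
  · rw [polySection_base]
    exact hx.2

/-- An adapted chart around a given point of `E`. -/
def someChart (V : Type*) [NormedAddCommGroup V] [NormedSpace ℝ V] [ChartedSpace (ℝ × V) E]
    (π : E → ℝ) [IsFibred V π] (e : E) : AdaptedChart V π :=
  (IsFibred.exists_adaptedChart (V := V) (π := π) e).choose

theorem mem_someChart_source (e : E) : e ∈ (someChart V π e).chart.source :=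
  (IsFibred.exists_adaptedChart (V := V) (π := π) e).choose_spec

variable (V π m) in
/-- The atlas of natural charts. -/
def chartedSpaceCore : ChartedSpaceCore (JetModel V m) (Jet V π m) where
  atlas := Set.range (natChart m)
  chartAt y := natChart m (someChart V π y.base)
  mem_chart_source y := mem_someChart_source y.base
  chart_mem_atlas _ := ⟨_, rfl⟩
  open_source := by
    rintro _ _ ⟨c, rfl⟩ ⟨c', rfl⟩
    exact isOpen_natChart_trans_source c c'
  continuousOn_toFun := by
    rintro _ _ ⟨c, rfl⟩ ⟨c', rfl⟩
    exact (contDiffOn_natChart_trans c c').continuousOn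

instance : TopologicalSpace (Jet V π m) := (chartedSpaceCore V π m).toTopologicalSpace

instance : ChartedSpace (JetModel V m) (Jet V π m) := (chartedSpaceCore V π m).toChartedSpace

instance : IsManifold 𝓘(ℝ, JetModel V m) ∞ (Jet V π m) := by
  refine isManifold_of_contDiffOn _ _ _ fun e e' he he' => ?_
  obtain ⟨_, h⟩ := Set.mem_iUnion.1 he
  obtain ⟨⟨c, rfl⟩, rfl⟩ := Set.mem_iUnion.1 h
  obtain ⟨_, h'⟩ := Set.mem_iUnion.1 he'
  obtain ⟨⟨c', rfl⟩, rfl⟩ := Set.mem_iUnion.1 h'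
  simp only [modelWithCornersSelf_coe, modelWithCornersSelf_coe_symm, Function.id_comp,
    Function.comp_id, Set.preimage_id, Set.range_id, Set.inter_univ]
  exact contDiffOn_natChart_trans c c'

/-- The natural chart as a chart of the manifold `J^m π`. -/
def natHomeo (m : ℕ) (c : AdaptedChart V π) :
    OpenPartialHomeomorph (Jet V π m) (JetModel V m) :=
  (chartedSpaceCore V π m).openPartialHomeomorph (natChart m c) ⟨c, rfl⟩

theorem natHomeo_mem_atlas (m : ℕ) (c : AdaptedChart V π) :
    natHomeo m c ∈ atlas (JetModel V m) (Jet V π m) :=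
  Set.mem_iUnion.2 ⟨_, Set.mem_iUnion.2 ⟨⟨c, rfl⟩, rfl⟩⟩

theorem contMDiffOn_natHomeo (m : ℕ) (c : AdaptedChart V π) :
    ContMDiffOn 𝓘(ℝ, JetModel V m) 𝓘(ℝ, JetModel V m) ∞ (natHomeo m c) (natHomeo m c).source :=
  contMDiffOn_of_mem_maximalAtlas
    (IsManifold.subset_maximalAtlas (natHomeo_mem_atlas m c))

theorem contMDiffOn_natHomeo_symm (m : ℕ) (c : AdaptedChart V π) :
    ContMDiffOn 𝓘(ℝ, JetModel V m) 𝓘(ℝ, JetModel V m) ∞ (natHomeo m c).symm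
      (natHomeo m c).target :=
  contMDiffOn_symm_of_mem_maximalAtlas
    (IsManifold.subset_maximalAtlas (natHomeo_mem_atlas m c))

theorem contMDiff_proj {r : ℕ} (h : r ≤ m) :
    ContMDiff 𝓘(ℝ, JetModel V m) 𝓘(ℝ, JetModel V r) ∞ (proj (V := V) (π := π) h) := by
  intro y
  set c := someChart V π y.base
  have hy : y ∈ (natHomeo m c).source := mem_someChart_source y.base
  set T : JetModel V m → JetModel V r :=
    fun x => (x.1, fun i => x.2 (Fin.castLE (Nat.succ_le_succ h) i))
  have hT : ContDiff ℝ ∞ T := by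
    refine contDiff_fst.prodMk (contDiff_pi.2 fun i => ?_)
    fun_prop
  have hpt : ∀ z ∈ (natHomeo m c).source, T (natHomeo m c z) ∈ (natHomeo r c).target ∧
      (natHomeo r c).symm (T (natHomeo m c z)) = z.proj h := by
    intro z hz
    have hz' : z.proj h ∈ (natHomeo r c).source := by
      change (z.proj h).base ∈ c.chart.source
      rw [base_proj]
      exact hz
    have hco : natHomeo r c (z.proj h) = T (natHomeo m c z) := by
      obtain ⟨p, rfl⟩ : ∃ p, mk m p = z := ⟨_, z.mk_rep⟩
      have hp : p.base ∈ c.chart.source := hz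
      change coord c (mk r p) = T (coord c (mk m p))
      rw [coord_mk c p hp, coord_mk c p hp]
      rfl
    rw [← hco]
    exact ⟨(natHomeo r c).map_source hz', (natHomeo r c).left_inv hz'⟩
  have h1 : ContMDiffOn 𝓘(ℝ, JetModel V m) 𝓘(ℝ, JetModel V r) ∞
      (fun z => (natHomeo r c).symm (T (natHomeo m c z))) (natHomeo m c).source :=
    (contMDiffOn_natHomeo_symm r c).comp
      (hT.contMDiff.comp_contMDiffOn (contMDiffOn_natHomeo m c)) fun z hz => (hpt z hz).1
  exact (h1.congr fun z hz => (hpt z hz).2.symm).contMDiffAt ((natHomeo m c).open_source.mem_nhds hy)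

end

open Classical in
/-- The canonical lifting `s ↦ j^r_s φ` of a local section `φ` (with a junk value at the times `s`
near which `φ` is not a smooth section). -/
def lift (r : ℕ) (p : PreJet V π) (s : ℝ) : Jet V π r :=
  if h : IsSectionAt V π p.sec s then mk r ⟨s, p.sec, h⟩ else mk r p

end Jet

/-! ### Forms, pull-backs and the exterior derivative of one-forms -/

section Forms

variable {F H M : Type*} [NormedAddCommGroup F] [NormedSpace ℝ F] [TopologicalSpace H]
  (I : ModelWithCorners ℝ F H) [TopologicalSpace M] [ChartedSpace H M]
  {F' H' N : Type*} [NormedAddCommGroup F'] [NormedSpace ℝ F'] [TopologicalSpace H']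
  (I' : ModelWithCorners ℝ F' H') [TopologicalSpace N] [ChartedSpace H' N]

variable (M) in
/-- A one-form on `M`. -/
abbrev OneForm : Type _ := ∀ x : M, TangentSpace I x →L[ℝ] ℝ

variable (M) in
/-- A two-form on `M`, as a function of two tangent vectors. -/
abbrev TwoForm : Type _ := ∀ x : M, TangentSpace I x → TangentSpace I x → ℝ

/-- The pull-back of a one-form. -/
def OneForm.pullback (f : M → N) (θ : OneForm N I') : OneForm M I :=
  fun x => (θ (f x)).comp (mfderiv I I' f x)

/-- The pull-back of a two-form. -/
def TwoForm.pullback (f : M → N) (σ : TwoForm N I') : TwoForm M I :=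
  fun x u v => σ (f x) (mfderiv I I' f x u) (mfderiv I I' f x v)

/-- The expression of a one-form in the chart around `x`. -/
def OneForm.inChart (θ : OneForm M I) (x : M) : F → F →L[ℝ] ℝ :=
  OneForm.pullback 𝓘(ℝ, F) I (extChartAt I x).symm θ

/-- The exterior derivative of a one-form on a manifold without boundary: in a chart,
`dθ(u, v) = (D_u θ)(v) - (D_v θ)(u)`. -/
def OneForm.d (θ : OneForm M I) : TwoForm M I := fun x u v =>
  let D := fderiv ℝ (θ.inChart I x) (extChartAt I x x)
  let u' : F := mfderiv I 𝓘(ℝ, F) (extChartAt I x) x u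
  let v' : F := mfderiv I 𝓘(ℝ, F) (extChartAt I x) x v
  D u' v' - D v' u'

end Forms

section Mechanics

variable {π : E → ℝ} [IsFibred V π]

/-! ### Total derivative, holonomy and semisprays -/

variable (V) in
/-- The model with corners of `J^m π`. -/
abbrev jetModel (m : ℕ) : ModelWithCorners ℝ (JetModel V m) (JetModel V m) :=
  𝓘(ℝ, JetModel V m)

variable (V π) in
/-- The one-form `dt` on `J^m π`, i.e. the pull-back of the volume form `η` of the real line. -/
def dTime (m : ℕ) : OneForm (Jet V π m) (jetModel V m) :=
  fun y => mfderiv (jetModel V m) 𝓘(ℝ, ℝ) Jet.time y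

/-- For `y = j^m_t φ` and `r < m`, the vector `(j^r φ)_* (∂/∂t)` at the point `j^r_t φ`: the
holonomic lift of `∂/∂t`. -/
def holonomicLift {r m : ℕ} (h : r ≤ m) (y : Jet V π m) :
    TangentSpace (jetModel V r) (y.proj h) :=
  (mfderiv 𝓘(ℝ, ℝ) (jetModel V r) (Jet.lift r y.rep) y.rep.time : ℝ →L[ℝ] JetModel V r) 1

/-- The total time derivative of a function on `J^m π`:
`(d_T f)(j^{m+1}_t φ) = d/ds f(j^m_s φ)` at `s = t`. -/
def totalDeriv {G : Type*} [NormedAddCommGroup G] [NormedSpace ℝ G] {m : ℕ}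
    (f : Jet V π m → G) (y : Jet V π (m + 1)) : G :=
  deriv (fun s => f (Jet.lift m y.rep s)) y.rep.time

/-- The iterated total time derivative `d_T^i f`. -/
def iterTotalDeriv {G : Type*} [NormedAddCommGroup G] [NormedSpace ℝ G] {m : ℕ}
    (f : Jet V π m → G) : (i : ℕ) → Jet V π (m + i) → G
  | 0 => f
  | i + 1 => totalDeriv (iterTotalDeriv f i)

/-- The curve `ψ` in `J^m π` is holonomic of type `r` on `S`: with `φ` the projection of `ψ`
to `E`, one has `j^{m-r+1} φ = π^m_{m-r+1} ∘ ψ` on `S`. -/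
def IsHolonomicOn {m : ℕ} (r : ℕ) (hr : 1 ≤ r ∧ r ≤ m) (ψ : ℝ → Jet V π m) (S : Set ℝ) : Prop :=
  ∀ s ∈ S, ∃ h : IsSectionAt V π (fun s' => (ψ s').base) s,
    Jet.mk (m - r + 1) ⟨s, _, h⟩ = (ψ s).proj (by omega)

/-- A (not necessarily continuous) vector field on `J^m π`. -/
abbrev JetField (V : Type*) [NormedAddCommGroup V] [NormedSpace ℝ V] [ChartedSpace (ℝ × V) E]
    (π : E → ℝ) [IsFibred V π] (m : ℕ) : Type _ :=
  ∀ y : Jet V π m, TangentSpace (jetModel V m) y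

/-- The vector field `X` on `J^m π` is smooth. -/
def JetField.IsSmooth {m : ℕ} (X : JetField V π m) : Prop :=
  ContMDiff (jetModel V m) (jetModel V m).tangent ∞
    (fun y => (⟨y, X y⟩ : TangentBundle (jetModel V m) (Jet V π m)))

/-- The vector field `X` on `J^m π` is a semispray of type `r`: every integral section of `X`
(over an open interval) is holonomic of type `r`. -/
def JetField.IsSemispray {m : ℕ} (r : ℕ) (hr : 1 ≤ r ∧ r ≤ m) (X : JetField V π m) : Prop :=
  ∀ (ψ : ℝ → Jet V π m) (a b : ℝ), ContMDiffOn 𝓘(ℝ, ℝ) (jetModel V m) ∞ ψ (Set.Ioo a b) →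
    (∀ s ∈ Set.Ioo a b, (ψ s).time = s) → IsMIntegralCurveOn ψ X (Set.Ioo a b) →
    IsHolonomicOn r hr ψ (Set.Ioo a b)

/-- A tangent vector of `J^m π` at `y` of the form
`f (∂/∂t + ∑_{i ≤ m - r} q_{i+1} ∂/∂q_i) + ∑_{i > m - r} X_i ∂/∂q_i`: its projection to
`J^{m-r} π` is a multiple of the holonomic lift of `∂/∂t`. -/
def IsSemisprayVector {m : ℕ} (r : ℕ) (y : Jet V π m) (u : TangentSpace (jetModel V m) y) :
    Prop :=
  mfderiv (jetModel V m) (jetModel V (m - r)) (Jet.proj (V := V) (π := π) (Nat.sub_le m r)) y u =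
    dTime V π m y u • holonomicLift (Nat.sub_le m r) y

/-- The vector field `X` is a semispray of type `r` at the points of `S`, in terms of the
coordinate expression of semisprays. -/
def JetField.IsSemisprayOn {m : ℕ} (r : ℕ) (X : JetField V π m) (S : Set (Jet V π m)) : Prop :=
  ∀ y ∈ S, IsSemisprayVector r y (X y)

/-! ### The unified phase space -/

/-- The fibre of the cotangent bundle of `J^r π`. -/
abbrev CotFibre (V : Type*) [NormedAddCommGroup V] [NormedSpace ℝ V] [ChartedSpace (ℝ × V) E]
    (π : E → ℝ) [IsFibred V π] (r : ℕ) (q : Jet V π r) : Type _ :=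
  TangentSpace 𝓘(ℝ, JetModel V r) q →L[ℝ] Bundle.Trivial (Jet V π r) ℝ q

/-- The cotangent bundle `T^*(J^r π)`. -/
abbrev Cot (V : Type*) [NormedAddCommGroup V] [NormedSpace ℝ V] [ChartedSpace (ℝ × V) E]
    (π : E → ℝ) [IsFibred V π] (r : ℕ) : Type _ :=
  Bundle.TotalSpace (JetModel V r →L[ℝ] ℝ) (CotFibre V π r)

variable (V) in
/-- The model with corners of `T^*(J^r π)`. -/
abbrev cotModel (r : ℕ) := (jetModel V r).prod 𝓘(ℝ, JetModel V r →L[ℝ] ℝ)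

variable (V π) in
/-- The tautological one-form of `T^*(J^r π)`. -/
def tautForm (r : ℕ) : OneForm (Cot V π r) (cotModel V r) := fun α =>
  ContinuousLinearMap.comp α.2 (mfderiv (cotModel V r) (jetModel V r) Bundle.TotalSpace.proj α)

variable (V π) in
/-- The canonical symplectic form `-dΘ` of `T^*(J^r π)`. -/
def canonicalForm (r : ℕ) : TwoForm (Cot V π r) (cotModel V r) :=
  fun α u v => -(tautForm V π r).d (cotModel V r) α u v

/-- The smooth projection `J^{2l+1} π → J^l π`. -/
abbrev projMap (V : Type*) [NormedAddCommGroup V] [NormedSpace ℝ V] [ChartedSpace (ℝ × V) E]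
    (π : E → ℝ) [IsFibred V π] (l : ℕ) :
    C^∞⟮jetModel V (2 * l + 1), Jet V π (2 * l + 1); jetModel V l, Jet V π l⟯ :=
  ⟨Jet.proj (by omega), Jet.contMDiff_proj _⟩

/-- The extended jet-momentum bundle `W = J^{2k-1} π ×_{J^{k-1} π} T^*(J^{k-1} π)` for the order
`k = l + 1`, as the pull-back of the bundle `T^*(J^l π) → J^l π` to `J^{2l+1} π`. Its points are
the pairs `w = ⟨y, α⟩` with `y` in `J^{2l+1} π` and `α` a covector at the projection of `y`. -/
abbrev Unified (V : Type*) [NormedAddCommGroup V] [NormedSpace ℝ V] [ChartedSpace (ℝ × V) E]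
    (π : E → ℝ) [IsFibred V π] (l : ℕ) : Type _ :=
  Bundle.TotalSpace (JetModel V l →L[ℝ] ℝ) (Bundle.Pullback (projMap V π l) (CotFibre V π l))

variable (V) in
/-- The model with corners of `W`. -/
abbrev uniModel (l : ℕ) := (jetModel V (2 * l + 1)).prod 𝓘(ℝ, JetModel V l →L[ℝ] ℝ)

namespace Unified
variable {l : ℕ}

/-- The projection `ρ_1 : W → J^{2l+1} π`. -/
def rho1 (w : Unified V π l) : Jet V π (2 * l + 1) := w.proj

/-- The projection `ρ_2 : W → T^*(J^l π)`. -/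
def rho2 (w : Unified V π l) : Cot V π l := ⟨projMap V π l w.proj, w.2⟩

/-- The projection `ρ_ℝ : W → ℝ`. -/
def rhoR (w : Unified V π l) : ℝ := w.proj.time

variable (V π l) in
/-- The unified canonical two-form `Ω = ρ_2^* Ω_l` on `W`. -/
def form : TwoForm (Unified V π l) (uniModel V l) :=
  (canonicalForm V π l).pullback (uniModel V l) (cotModel V l) rho2

/-- The coupling function `Ĉ`, with `Ĉ dt` the coupling one-form: `Ĉ(y, α) = ⟨α, (j^l φ)_* ∂/∂t⟩`
for `y = j^{2l+1}_t φ`, in coordinates `p + ∑ p^i q_{i+1}`. -/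
def coupling (w : Unified V π l) : ℝ :=
  let α : CotFibre V π l (projMap V π l w.proj) := w.2
  α (holonomicLift (by omega) w.proj)

/-- The constraint function `Ĉ - L̂`, where `L̂` is the pull-back to `W` of the Lagrangian function
`L` on `J^{l+1} π`. -/
def constraint (L : Jet V π (l + 1) → ℝ) (w : Unified V π l) : ℝ :=
  w.coupling - L (w.proj.proj (by omega))

/-- The Hamiltonian submanifold `W_o = {Ĉ = L̂}` of `W`. -/
def hamSubmanifold (L : Jet V π (l + 1) → ℝ) : Set (Unified V π l) := {w | constraint L w = 0}

/-- Tangency of a vector of `W`, at a point of `W_o`, to the hypersurface `W_o`. -/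
def IsTangentWo (L : Jet V π (l + 1) → ℝ) (w : Unified V π l)
    (v : TangentSpace (uniModel V l) w) : Prop :=
  (mfderiv (uniModel V l) 𝓘(ℝ, ℝ) (constraint L) w v : ℝ) = 0

end Unified

/-! ### The Legendre-Ostrogradsky maps and the Poincaré-Cartan forms -/

section Legendre

variable {l : ℕ}

/-- The partial derivative `∂L/∂q_j` in the natural chart of `J^{l+1} π` induced by `c`. -/
def lagPartial (c : AdaptedChart V π) (L : Jet V π (l + 1) → ℝ) (j : Fin (l + 1 + 1))
    (z : Jet V π (l + 1)) : V →L[ℝ] ℝ :=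
  (fderiv ℝ (fun x => L ((Jet.natHomeo (l + 1) c).symm x)) (Jet.natHomeo (l + 1) c z)).comp
    ((ContinuousLinearMap.inr ℝ ℝ (Fin (l + 1 + 1) → V)).comp
      (ContinuousLinearMap.single ℝ (fun _ => V) j))

/-- The Jacobi-Ostrogradsky momentum
`p̂^r = ∑_{i=0}^{l-r} (-1)^i d_T^i (∂L/∂q_{r+1+i})`, `0 ≤ r ≤ l`, in the adapted chart `c`. -/
def momentum (c : AdaptedChart V π) (L : Jet V π (l + 1) → ℝ) (r : Fin (l + 1))
    (y : Jet V π (2 * l + 1)) : V →L[ℝ] ℝ :=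
  ∑ i : Fin (l + 1 - r), (-1 : ℝ) ^ (i : ℕ) •
    iterTotalDeriv (lagPartial c L ⟨r + 1 + i, by omega⟩) i (y.proj (by omega))

/-- The covector `p dt + ∑ p̂^r dq_r`, in the adapted chart `c`, where
`p = L - ∑ p̂^r q_{r+1}`. -/
def legendreCoord (c : AdaptedChart V π) (L : Jet V π (l + 1) → ℝ)
    (y : Jet V π (2 * l + 1)) : JetModel V l →L[ℝ] ℝ :=
  (L (y.proj (by omega)) -
      ∑ r : Fin (l + 1), momentum c L r y ((y.coord c).2 ⟨r + 1, by omega⟩)) •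
    ContinuousLinearMap.fst ℝ ℝ (Fin (l + 1) → V) +
  ∑ r : Fin (l + 1), (momentum c L r y).comp
    ((ContinuousLinearMap.proj r).comp (ContinuousLinearMap.snd ℝ ℝ (Fin (l + 1) → V)))

/-- The extended Legendre-Ostrogradsky map, as a covector at the projection of `y` to `J^l π`,
through its local expression in natural coordinates (which is the same covector in all adapted
charts around `y`; a chosen one is used). -/
def legendreCovector (L : Jet V π (l + 1) → ℝ) (y : Jet V π (2 * l + 1)) :
    CotFibre V π l (projMap V π l y) :=
  (legendreCoord (Jet.someChart V π y.base) L y).comp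
    (mfderiv (jetModel V l) (jetModel V l) (Jet.natHomeo l (Jet.someChart V π y.base))
      (projMap V π l y))

/-- The extended Legendre-Ostrogradsky map `J^{2l+1} π → T^*(J^l π)`. -/
def legendreExt (L : Jet V π (l + 1) → ℝ) (y : Jet V π (2 * l + 1)) : Cot V π l :=
  ⟨projMap V π l y, legendreCovector L y⟩

/-- The map `J^{2l+1} π → W` whose image is the graph of the extended Legendre-Ostrogradsky map. -/
def legendreGraph (L : Jet V π (l + 1) → ℝ) (y : Jet V π (2 * l + 1)) : Unified V π l :=
  ⟨y, legendreCovector L y⟩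

/-- The submanifold `W_1` of `W_o`: the graph of the extended Legendre-Ostrogradsky map. -/
def W1 (L : Jet V π (l + 1) → ℝ) : Set (Unified V π l) := Set.range (legendreGraph L)

/-- The Poincaré-Cartan two-form `Ω_L` on `J^{2l+1} π`. -/
def poincareCartan (L : Jet V π (l + 1) → ℝ) :
    TwoForm (Jet V π (2 * l + 1)) (jetModel V (2 * l + 1)) :=
  (canonicalForm V π l).pullback (jetModel V (2 * l + 1)) (cotModel V l) (legendreExt L)

variable (V π) in
/-- Two covectors at the same point of `J^r π` which differ by a multiple of `dt`. -/
def restrictedSetoid (r : ℕ) : Setoid (Cot V π r) where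
  r α β := ∃ a : ℝ, β = ⟨α.proj, α.2 + a • dTime V π r α.proj⟩
  iseqv :=
    { refl := fun α => ⟨0, congrArg (Bundle.TotalSpace.mk α.proj) <|
        ContinuousLinearMap.ext fun v => by
          change (α.2 v : ℝ) = (α.2 v : ℝ) + 0 * dTime V π r α.proj v
          ring⟩
      symm := by
        rintro α β ⟨a, rfl⟩
        refine ⟨-a, congrArg (Bundle.TotalSpace.mk α.proj) <|
          ContinuousLinearMap.ext fun v => ?_⟩
        change (α.2 v : ℝ) =
          (α.2 v : ℝ) + a * dTime V π r α.proj v + -a * dTime V π r α.proj v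
        ring
      trans := by
        rintro α β γ ⟨a, rfl⟩ ⟨b, rfl⟩
        refine ⟨a + b, congrArg (Bundle.TotalSpace.mk α.proj) <|
          ContinuousLinearMap.ext fun v => ?_⟩
        change (α.2 v : ℝ) + a * dTime V π r α.proj v + b * dTime V π r α.proj v =
          (α.2 v : ℝ) + (a + b) * dTime V π r α.proj v
        ring }

variable (V π) in
/-- The bundle `J^r π^*`: the quotient of `T^*(J^r π)` by the multiples of `dt`. -/
def RestrictedCot (r : ℕ) : Type _ := Quotient (restrictedSetoid V π r)

/-- The quotient map `μ : T^*(J^r π) → J^r π^*`. -/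
def quotMap {r : ℕ} (α : Cot V π r) : RestrictedCot V π r := Quotient.mk _ α

/-- The restricted Legendre-Ostrogradsky map `J^{2l+1} π → J^l π^*`. -/
def legendre (L : Jet V π (l + 1) → ℝ) (y : Jet V π (2 * l + 1)) : RestrictedCot V π l :=
  quotMap (legendreExt L y)

/-- The Lagrangian is regular: the restricted Legendre-Ostrogradsky map is a local diffeomorphism.
The manifold structure of `J^l π^*` is the quotient one: a subset is open iff its preimage under
`μ` is open, and a map `g` on an open set is smooth iff `g ∘ μ` is smooth; the restricted
Legendre-Ostrogradsky map lifts to the extended one. -/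
def IsRegularLagrangian (L : Jet V π (l + 1) → ℝ) : Prop :=
  ∀ y : Jet V π (2 * l + 1), ∃ (U : Set (Jet V π (2 * l + 1))) (O : Set (RestrictedCot V π l))
    (g : RestrictedCot V π l → Jet V π (2 * l + 1)),
    y ∈ U ∧ IsOpen U ∧ IsOpen (quotMap ⁻¹' O) ∧
    Set.MapsTo (legendre L) U O ∧ Set.MapsTo g O U ∧
    Set.LeftInvOn g (legendre L) U ∧ Set.RightInvOn g (legendre L) O ∧
    ContMDiffOn (jetModel V (2 * l + 1)) (cotModel V l) ∞ (legendreExt L) U ∧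
    ContMDiffOn (cotModel V l) (jetModel V (2 * l + 1)) ∞ (fun α => g (quotMap α)) (quotMap ⁻¹' O)

end Legendre

/-! ### Vector fields along `W_1` and the dynamical equations -/

section Dynamics

variable {l : ℕ}

/-- A (not necessarily continuous) vector field on `W`. Only its values at the points of `W_1`
will matter. -/
abbrev UnifiedField (V : Type*) [NormedAddCommGroup V] [NormedSpace ℝ V]
    [ChartedSpace (ℝ × V) E] (π : E → ℝ) [IsFibred V π] (l : ℕ) : Type _ :=
  ∀ w : Unified V π l, TangentSpace (uniModel V l) w

namespace UnifiedField

/-- `X` is a smooth vector field on `W_o` at support on `W_1`: a smooth section over `W_1` of the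
tangent bundle of `W_o`. -/
structure IsFieldAlong (L : Jet V π (l + 1) → ℝ) (X : UnifiedField V π l) : Prop where
  contMDiffOn : ContMDiffOn (uniModel V l) (uniModel V l).tangent ∞
    (fun w => (⟨w, X w⟩ : TangentBundle (uniModel V l) (Unified V π l))) (W1 L)
  tangent : ∀ w ∈ W1 L, Unified.IsTangentWo L w (X w)

/-- `X` is a solution of `i(X) Ω_o = 0` and `i(X) ρ_ℝ^* η = 1` at the points of `A`, where `Ω_o`
is the pull-back of `Ω` to `W_o`. -/
def SolvesOn (L : Jet V π (l + 1) → ℝ) (X : UnifiedField V π l) (A : Set (Unified V π l)) :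
    Prop :=
  ∀ w ∈ A, (∀ v, Unified.IsTangentWo L w v → Unified.form V π l w (X w) v = 0) ∧
    (mfderiv (uniModel V l) 𝓘(ℝ, ℝ) Unified.rhoR w (X w) : ℝ) = 1

/-- `X` is tangent to `W_1` at the points of `A ⊆ W_1`. -/
def IsTangentW1On (L : Jet V π (l + 1) → ℝ) (X : UnifiedField V π l) (A : Set (Unified V π l)) :
    Prop :=
  ∀ y, legendreGraph L y ∈ A → ∃ u : TangentSpace (jetModel V (2 * l + 1)) y,
    mfderiv (jetModel V (2 * l + 1)) (uniModel V l) (legendreGraph L) y u = X (legendreGraph L y)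

/-- `X` and the vector field `Y` on `J^{2l+1} π` are related by `ρ_1` at the points of `A`:
`Y ∘ ρ_1 = Tρ_1 ∘ X`. -/
def RelatedOn (X : UnifiedField V π l) (Y : JetField V π (2 * l + 1))
    (A : Set (Unified V π l)) : Prop :=
  ∀ w ∈ A, mfderiv (uniModel V l) (jetModel V (2 * l + 1)) Unified.rho1 w (X w) = Y w.rho1

/-- `X`, a vector field along `W_1`, is a semispray of type `r`: for every integral section `ψ` of
`X` (over an open interval), the section `ρ_1 ∘ ψ` is holonomic of type `r`. -/
def IsSemispray (L : Jet V π (l + 1) → ℝ) (r : ℕ) (hr : 1 ≤ r ∧ r ≤ 2 * l + 1)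
    (X : UnifiedField V π l) : Prop :=
  ∀ (ψ : ℝ → Unified V π l) (a b : ℝ),
    ContMDiffOn 𝓘(ℝ, ℝ) (uniModel V l) ∞ ψ (Set.Ioo a b) →
    (∀ s ∈ Set.Ioo a b, ψ s ∈ W1 L ∧ (ψ s).rhoR = s) → IsMIntegralCurveOn ψ X (Set.Ioo a b) →
    IsHolonomicOn r hr (fun s => (ψ s).rho1) (Set.Ioo a b)

/-- `X` is a semispray of type `r` at the points of `A`, in terms of the coordinate expression of
semisprays. -/
def IsSemisprayOn (r : ℕ) (X : UnifiedField V π l) (A : Set (Unified V π l)) : Prop :=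
  ∀ w ∈ A, IsSemisprayVector r w.rho1
    (mfderiv (uniModel V l) (jetModel V (2 * l + 1)) Unified.rho1 w (X w))

end UnifiedField

/-- `Y` is a solution of `i(Y) Ω_L = 0` and `i(Y) dt = 1` at the points of `S`. -/
def JetField.SolvesOn (L : Jet V π (l + 1) → ℝ) (Y : JetField V π (2 * l + 1))
    (S : Set (Jet V π (2 * l + 1))) : Prop :=
  ∀ y ∈ S, (∀ v, poincareCartan L y (Y y) v = 0) ∧ dTime V π (2 * l + 1) y (Y y) = 1

end Dynamics

end Mechanics
end
end JetMech

open JetMech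

set_option linter.unusedSectionVars false

namespace JetMech

noncomputable section

variable {V : Type*} [NormedAddCommGroup V] [NormedSpace ℝ V]
  {E : Type*} [TopologicalSpace E] [ChartedSpace (ℝ × V) E]
  {π : E → ℝ} [IsFibred V π] {m r l : ℕ}

/-! ### Jets in natural coordinates -/

/-! Everything reduces to linear algebra at one point of `W_1`. In natural coordinates a tangent
vector of `W` at `w` is a pair `(u, a)`, with `u` tangent to `J^{2l+1} π` and `a` a covector on the
model of `J^l π`, and `Ω((u, a), (v, b)) = b(tr u) - a(tr v)`, where `tr` truncates to `J^l π`
(`Unified.form_apply`). The coefficient `p` of the extended Legendre map is chosen so that its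
covector pairs with the holonomic lift `h` of `∂/∂t` to `L`; so the graph `W_1` lies in `W_o`. At a
point of `W_1` each vector is a graph vector plus a vertical one `(0, b)`. Graph vectors are always
tangent to `W_o`, vertical ones exactly when `b(h) = 0`, and on graph vectors `Ω` is `Ω_L`.

Let `X` have projection `u` and solve (1). Pairing with the admissible vertical vectors gives `b(tr
u) = 0` whenever `b(h) = 0`, so `tr u` is a multiple of `h`: this is the semispray condition of type
`k = l + 1` (`isSemisprayVector_of_form`). If `X` is tangent to `W_1`, pairing with graph vectors
gives (2). Conversely, these two facts about `u` make its graph vector a solution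
(`form_graphVec_eq_zero`). Any other solution over `u` differs from it by a vertical `(0, b)`, and
pairing with all graph vectors gives `b ∘ tr = 0`, hence `b = 0`, without assuming tangency to `W_1`
(`eq_graphVec_of_form`).

For type `1` in the regular case, the momentum `p̂^r` depends on the coordinates up to `q_{2l+1-r}`,
and on the last one through plus or minus the Hessian of `L` in `q_{l+1}` (`localDeriv_momentum`).
Regularity makes the extended Legendre map an immersion, and a kernel vector of the Hessian, placed
in the direction `q_{2l+1}`, would violate this. Equation (2) tested on `∂/∂q_{r+1}` fixes
`dp̂^{r+1}(u)` to the value it has on a holonomic vector, and the triangular dependence then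
determines the components of `u` one after another.

Two analytic points remain. The extended Legendre map is defined through a chart chosen separately
at each point, so its smoothness requires chart independence. The Ostrogradsky momenta form the
boundary term of the first variation formula, and a cut-off argument shows that this term depends
only on the differential of `L` (`sum_ostrogradskySum_eq`). Finally, the two notions of semispray
are compared by the existence and smoothness of integral curves. -/

theorem ContDiffAt.iteratedDeriv_infty {G : Type*} [NormedAddCommGroup G] [NormedSpace ℝ G]
    {f : ℝ → G} {s : ℝ} (hf : ContDiffAt ℝ ∞ f s) (i : ℕ) :
    ContDiffAt ℝ ∞ (iteratedDeriv i f) s := by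
  induction i with
  | zero => simpa using hf
  | succ i ih =>
    have h : ContDiffAt ℝ ∞ (fun s => fderiv ℝ (iteratedDeriv i f) s 1) s :=
      (ih.fderiv_right (m := ∞) (by simp)).clm_apply contDiffAt_const
    rw [iteratedDeriv_succ]
    exact h

theorem ContDiffAt.hasDerivAt_iteratedDeriv {G : Type*} [NormedAddCommGroup G] [NormedSpace ℝ G]
    {f : ℝ → G} {s : ℝ} (hf : ContDiffAt ℝ ∞ f s) (i : ℕ) :
    HasDerivAt (iteratedDeriv i f) (iteratedDeriv (i + 1) f s) s := by
  have := ((ContDiffAt.iteratedDeriv_infty hf i).differentiableAt (by simp)).hasDerivAt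
  rwa [← iteratedDeriv_succ] at this

namespace JetModel

/-- The coordinate expression of the projection `J^m π → J^r π`. -/
def trunc (V : Type*) [NormedAddCommGroup V] [NormedSpace ℝ V] (h : r ≤ m) :
    JetModel V m →L[ℝ] JetModel V r :=
  (ContinuousLinearMap.fst ℝ ℝ _).prod (ContinuousLinearMap.pi fun i : Fin (r + 1) =>
    (ContinuousLinearMap.proj (Fin.castLE (Nat.succ_le_succ h) i)).comp
      (ContinuousLinearMap.snd ℝ ℝ (Fin (m + 1) → V)))

@[simp] theorem trunc_fst (h : r ≤ m) (x : JetModel V m) : (trunc V h x).1 = x.1 := rfl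

@[simp] theorem trunc_snd (h : r ≤ m) (x : JetModel V m) (i : Fin (r + 1)) :
    (trunc V h x).2 i = x.2 ⟨i, by omega⟩ := rfl

/-- The coordinate expression of the holonomic lift of `∂/∂t`. -/
def shift (h : r < m) (x : JetModel V m) : JetModel V r :=
  (1, fun i => x.2 ⟨i + 1, by omega⟩)

@[simp] theorem shift_fst (h : r < m) (x : JetModel V m) : (shift h x).1 = 1 := rfl

@[simp] theorem shift_snd (h : r < m) (x : JetModel V m) (i : Fin (r + 1)) :
    (shift h x).2 i = x.2 ⟨i + 1, by omega⟩ := rfl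

theorem contDiff_shift (h : r < m) : ContDiff ℝ ∞ (shift (V := V) h) := by
  unfold shift; fun_prop

end JetModel

open JetModel

namespace PreJet

/-- The local section of a jet, in an adapted chart. -/
def curve (p : PreJet V π) (c : AdaptedChart V π) (s : ℝ) : V := (c.chart (p.sec s)).2

theorem contDiffAt_curve (p : PreJet V π) (c : AdaptedChart V π) (h : p.base ∈ c.chart.source) :
    ContDiffAt ℝ ∞ (p.curve c) p.time := (p.contDiffAt_chart c h).snd

end PreJet

namespace Jet

theorem exists_mk (y : Jet V π m) : ∃ p : PreJet V π, mk m p = y := ⟨_, y.mk_rep⟩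

theorem mem_natHomeo_source {c : AdaptedChart V π} {y : Jet V π m} :
    y ∈ (natHomeo m c).source ↔ y.base ∈ c.chart.source := Iff.rfl

theorem mem_natHomeo_target {c : AdaptedChart V π} {x : JetModel V m} :
    x ∈ (natHomeo m c).target ↔ (x.1, x.2 0) ∈ c.chart.target := Iff.rfl

theorem natHomeo_apply (c : AdaptedChart V π) (y : Jet V π m) : natHomeo m c y = y.coord c := rfl

theorem natHomeo_mk (c : AdaptedChart V π) (p : PreJet V π) (h : p.base ∈ c.chart.source) :
    natHomeo m c (mk m p) = (p.time, fun i : Fin (m + 1) => p.deriv c i) := coord_mk c p h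

theorem natHomeo_proj (h : r ≤ m) (c : AdaptedChart V π) {y : Jet V π m}
    (hy : y.base ∈ c.chart.source) :
    natHomeo r c (y.proj h) = trunc V h (natHomeo m c y) := by
  obtain ⟨p, rfl⟩ := y.exists_mk
  rw [proj_mk, natHomeo_mk c p hy, natHomeo_mk c p hy]
  rfl

theorem natHomeo_fst (c : AdaptedChart V π) {y : Jet V π m} (hy : y.base ∈ c.chart.source) :
    (natHomeo m c y).1 = y.time := by
  obtain ⟨p, rfl⟩ := y.exists_mk
  rw [natHomeo_mk c p hy]
  rfl

theorem chart_base (c : AdaptedChart V π) {y : Jet V π m} (hy : y.base ∈ c.chart.source) :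
    c.chart y.base = ((natHomeo m c y).1, (natHomeo m c y).2 0) := by
  obtain ⟨p, rfl⟩ := y.exists_mk
  rw [natHomeo_mk c p hy]
  exact p.chart_base c hy

theorem proj_base (y : Jet V π m) : π y.base = y.time := by
  obtain ⟨p, rfl⟩ := y.exists_mk
  exact p.proj_base

theorem lift_eq {p : PreJet V π} {s : ℝ} (h : IsSectionAt V π p.sec s) :
    lift r p s = mk r ⟨s, p.sec, h⟩ := dif_pos h

theorem lift_time (p : PreJet V π) : lift r p p.time = mk r p := lift_eq p.isSectionAt

theorem eventually_isSectionAt (p : PreJet V π) :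
    ∀ᶠ s in 𝓝 p.time, IsSectionAt V π p.sec s := p.isSectionAt.eventually_nhds

theorem proj_lift (h : r ≤ m) (p : PreJet V π) (s : ℝ) : (lift m p s).proj h = lift r p s := by
  unfold lift
  split_ifs <;> rfl

theorem eventually_lift (p : PreJet V π) (c : AdaptedChart V π) (h : p.base ∈ c.chart.source) :
    ∀ᶠ s in 𝓝 p.time, (lift m p s).base ∈ c.chart.source ∧
      natHomeo m c (lift m p s) = (s, fun i : Fin (m + 1) => iteratedDeriv i (p.curve c) s) := by
  filter_upwards [p.eventually_mem_source c h, eventually_isSectionAt p] with s hs hs'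
  rw [lift_eq hs']
  refine ⟨hs, ?_⟩
  rw [natHomeo_mk _ _ hs]
  rfl

theorem hasDerivAt_lift (p : PreJet V π) (c : AdaptedChart V π) (h : p.base ∈ c.chart.source) :
    HasDerivAt (fun s => natHomeo m c (lift m p s))
      (1, fun i : Fin (m + 1) => p.deriv c (i + 1)) p.time := by
  refine HasDerivAt.congr_of_eventuallyEq ?_ ((eventually_lift p c h).mono fun s hs => hs.2)
  refine (hasDerivAt_id _).prodMk (hasDerivAt_pi.2 fun i => ?_)
  exact ContDiffAt.hasDerivAt_iteratedDeriv (p.contDiffAt_curve c h) i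

/-- Continuity of `f` is not presupposed: staying in the chart domain near `x` is enough to recover
`f` from its coordinates. The bound `n ≤ ∞` is there because the jet atlas is only `C^∞`. -/
theorem contMDiffAt_of_natHomeo {M H F : Type*} [NormedAddCommGroup F] [NormedSpace ℝ F]
    [TopologicalSpace H] {I : ModelWithCorners ℝ F H} [TopologicalSpace M] [ChartedSpace H M]
    {f : M → Jet V π m} {x : M} (c : AdaptedChart V π) {n : ℕ∞ω} (hn : n ≤ ∞)
    (hf : ∀ᶠ z in 𝓝 x, (f z).base ∈ c.chart.source)
    (h : ContMDiffAt I (jetModel V m) n (fun z => natHomeo m c (f z)) x) :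
    ContMDiffAt I (jetModel V m) n f x := by
  have h1 : ContMDiffAt (jetModel V m) (jetModel V m) n (natHomeo m c).symm (natHomeo m c (f x)) :=
    ((contMDiffOn_natHomeo_symm m c).contMDiffAt
      ((natHomeo m c).open_target.mem_nhds ((natHomeo m c).map_source hf.self_of_nhds))).of_le hn
  refine (h1.comp x h).congr_of_eventuallyEq ?_
  filter_upwards [hf] with z hz
  exact ((natHomeo m c).left_inv hz).symm

theorem contMDiffAt_natHomeo (c : AdaptedChart V π) {y : Jet V π m}
    (hy : y.base ∈ c.chart.source) :
    ContMDiffAt (jetModel V m) (jetModel V m) ∞ (natHomeo m c) y :=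
  (contMDiffOn_natHomeo m c).contMDiffAt ((natHomeo m c).open_source.mem_nhds hy)

theorem contMDiffAt_natHomeo_symm (c : AdaptedChart V π) {x : JetModel V m}
    (hx : x ∈ (natHomeo m c).target) :
    ContMDiffAt (jetModel V m) (jetModel V m) ∞ (natHomeo m c).symm x :=
  (contMDiffOn_natHomeo_symm m c).contMDiffAt ((natHomeo m c).open_target.mem_nhds hx)

theorem eventually_mem_source (c : AdaptedChart V π) {y : Jet V π m}
    (hy : y.base ∈ c.chart.source) : ∀ᶠ z in 𝓝 y, z.base ∈ c.chart.source :=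
  (natHomeo m c).open_source.mem_nhds hy

theorem contMDiffAt_lift (p : PreJet V π) :
    ContMDiffAt 𝓘(ℝ, ℝ) (jetModel V m) ∞ (lift m p) p.time := by
  obtain ⟨c, hc⟩ := IsFibred.exists_adaptedChart (V := V) (π := π) p.base
  refine contMDiffAt_of_natHomeo c le_rfl ((eventually_lift p c hc).mono fun s hs => hs.1) ?_
  refine ContMDiffAt.congr_of_eventuallyEq ?_ ((eventually_lift p c hc).mono fun s hs => hs.2)
  refine ContDiffAt.contMDiffAt ?_
  refine contDiffAt_id.prodMk (contDiffAt_pi.2 fun i => ?_)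
  exact ContDiffAt.iteratedDeriv_infty (p.contDiffAt_curve c hc) i

theorem contMDiff_time : ContMDiff (jetModel V m) 𝓘(ℝ, ℝ) ∞ (time (V := V) (π := π) (m := m)) := by
  intro y
  have hy := mem_someChart_source (V := V) (π := π) y.base
  refine ContMDiffAt.congr_of_eventuallyEq
    (f := fun z => (natHomeo m (someChart V π y.base) z).1) ?_ ?_
  · exact contDiff_fst.contMDiff.contMDiffAt.comp y (contMDiffAt_natHomeo _ hy)
  · filter_upwards [eventually_mem_source _ hy] with z hz
    exact (natHomeo_fst _ hz).symm

theorem contMDiff_base :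
    ContMDiff (jetModel V m) 𝓘(ℝ, ℝ × V) ∞ (base (V := V) (π := π) (m := m)) := by
  intro y
  set c := someChart V π y.base
  have hy : y.base ∈ c.chart.source := mem_someChart_source (V := V) (π := π) y.base
  have h1 : ContMDiffAt 𝓘(ℝ, ℝ × V) 𝓘(ℝ, ℝ × V) ∞ c.chart.symm
      ((natHomeo m c y).1, (natHomeo m c y).2 0) := by
    refine (contMDiffOn_symm_of_mem_maximalAtlas c.mem_maximalAtlas).contMDiffAt
      (c.chart.open_target.mem_nhds ?_)
    rw [← chart_base c hy]
    exact c.chart.map_source hy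
  have h2 : ContDiff ℝ ∞ fun x : JetModel V m => (x.1, x.2 0) := by fun_prop
  refine (h1.comp y (h2.contMDiff.contMDiffAt.comp y
    (contMDiffAt_natHomeo c hy))).congr_of_eventuallyEq ?_
  filter_upwards [eventually_mem_source c hy] with z hz
  change _ = c.chart.symm ((natHomeo m c z).1, (natHomeo m c z).2 0)
  rw [← chart_base c hz, c.chart.left_inv hz]

/-! ### Tangent vectors in natural coordinates -/

theorem extChartAt_eq (y : Jet V π m) :
    extChartAt (jetModel V m) y = (natHomeo m (someChart V π y.base)).toPartialEquiv := by
  rw [extChartAt, OpenPartialHomeomorph.extend, modelWithCornersSelf_partialEquiv,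
    PartialEquiv.trans_refl]
  rfl

theorem mfderiv_natHomeo_someChart (y : Jet V π m) :
    mfderiv (jetModel V m) (jetModel V m) (natHomeo m (someChart V π y.base)) y =
      ContinuousLinearMap.id ℝ (JetModel V m) := by
  have h := mfderiv_extChartAt_self (I := jetModel V m) (x := y)
  rw [extChartAt_eq] at h
  exact h

/-- The coordinates of a tangent vector in the natural chart induced by `c`. -/
def vecCoord (c : AdaptedChart V π) (y : Jet V π m) :
    TangentSpace (jetModel V m) y →L[ℝ] JetModel V m :=
  mfderiv (jetModel V m) (jetModel V m) (natHomeo m c) y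

/-- The preferred chart of `J^m π` at `y` is the natural chart of `someChart` at `y.base`, and the
tangent space at `y` is the model space read in that chart. Vectors may therefore be handled as
their own coordinates, provided this particular chart is used. -/
theorem vecCoord_someChart (y : Jet V π m) (u : TangentSpace (jetModel V m) y) :
    vecCoord (someChart V π y.base) y u = u := by
  rw [vecCoord, mfderiv_natHomeo_someChart]
  rfl

theorem hasMFDerivAt_natHomeo {c : AdaptedChart V π} {y : Jet V π m}
    (hy : y.base ∈ c.chart.source) :
    HasMFDerivAt (jetModel V m) (jetModel V m) (natHomeo m c) y (vecCoord c y) :=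
  ((contMDiffAt_natHomeo c hy).mdifferentiableAt (by simp)).hasMFDerivAt

theorem vecCoord_bijective {c : AdaptedChart V π} {y : Jet V π m}
    (hy : y.base ∈ c.chart.source) : Function.Bijective (vecCoord c y) :=
  (mdifferentiable_of_mem_atlas (natHomeo_mem_atlas m c)).mfderiv_bijective hy

theorem vecCoord_proj (h : r ≤ m) {c : AdaptedChart V π} {y : Jet V π m}
    (hy : y.base ∈ c.chart.source) (u : TangentSpace (jetModel V m) y) :
    vecCoord c (y.proj h) (mfderiv (jetModel V m) (jetModel V r) (proj h) y u) =
      trunc V h (vecCoord c y u) := by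
  have hy' : (y.proj h).base ∈ c.chart.source := by rwa [base_proj]
  have h1 := (hasMFDerivAt_natHomeo hy').comp y
    ((contMDiff_proj h y).mdifferentiableAt (by simp)).hasMFDerivAt
  have h2 := (trunc V h).hasMFDerivAt.comp y (hasMFDerivAt_natHomeo hy)
  have h3 := h2.congr_of_eventuallyEq (f₁ := natHomeo r c ∘ proj h)
    ((eventually_mem_source c hy).mono fun z hz => natHomeo_proj h c hz)
  exact congrArg (fun T => T u) (hasMFDerivAt_unique h1 h3)

theorem dTime_apply {c : AdaptedChart V π} {y : Jet V π m}
    (hy : y.base ∈ c.chart.source) (u : TangentSpace (jetModel V m) y) :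
    dTime V π m y u = (vecCoord c y u).1 := by
  have h1 := ((contMDiff_time (V := V) (π := π) y).mdifferentiableAt (by simp)).hasMFDerivAt
  have h2 := (ContinuousLinearMap.fst ℝ ℝ (Fin (m + 1) → V)).hasMFDerivAt.comp y
    (hasMFDerivAt_natHomeo hy)
  have h3 := h2.congr_of_eventuallyEq (f₁ := time)
    ((eventually_mem_source c hy).mono fun z hz => (natHomeo_fst c hz).symm)
  exact congrArg (fun T => T u) (hasMFDerivAt_unique h1 h3)

theorem vecCoord_lift (p : PreJet V π) (c : AdaptedChart V π) (h : p.base ∈ c.chart.source) :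
    vecCoord c (mk r p)
      ((mfderiv 𝓘(ℝ, ℝ) (jetModel V r) (lift r p) p.time : ℝ →L[ℝ] JetModel V r) 1) =
      (1, fun i : Fin (r + 1) => p.deriv c (i + 1)) := by
  have hy : (lift r p p.time).base ∈ c.chart.source := by rwa [lift_time]
  have h1 := (hasMFDerivAt_natHomeo hy).comp p.time
    ((contMDiffAt_lift (m := r) p).mdifferentiableAt (by simp)).hasMFDerivAt
  have h2 := (hasDerivAt_lift (m := r) p c h).hasFDerivAt.hasMFDerivAt
  have h3 := congrArg (fun T : ℝ →L[ℝ] JetModel V r => T 1) (hasMFDerivAt_unique h1 h2)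
  rw [lift_time] at h3
  refine h3.trans ?_
  simp

/-- The lift is defined through a chosen representative, but its coordinates involve derivatives
only up to order `r + 1 ≤ m`, which the jet `y` determines. This is why `r < m` must be strict. -/
theorem vecCoord_holonomicLift (h : r < m) {c : AdaptedChart V π} {y : Jet V π m}
    (hy : y.base ∈ c.chart.source) :
    vecCoord c (y.proj h.le) (holonomicLift h.le y) = shift h (natHomeo m c y) := by
  have hb : y.rep.base ∈ c.chart.source := by
    rw [← base_mk (m := m), mk_rep]; exact hy
  have h1 := vecCoord_lift (r := r) y.rep c hb
  have h2 := natHomeo_mk (m := m) c y.rep hb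
  rw [mk_rep] at h2
  have h3 : mk r y.rep = y.proj h.le := by rw [← proj_mk h.le, mk_rep]
  rw [h3] at h1
  refine h1.trans ?_
  rw [h2]
  rfl

/-- Coordinates are injective on tangent vectors, and the time component of the invariant condition
holds automatically; only the equations `X_i = f q_{i+1}` with `i ≤ m - r` remain. -/
theorem isSemisprayVector_iff (hr : 1 ≤ r ∧ r ≤ m) {c : AdaptedChart V π} {y : Jet V π m}
    (hy : y.base ∈ c.chart.source) (u : TangentSpace (jetModel V m) y) :
    IsSemisprayVector r y u ↔ ∀ i (hi : i ≤ m - r),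
      (vecCoord c y u).2 ⟨i, by omega⟩ =
        (vecCoord c y u).1 • (natHomeo m c y).2 ⟨i + 1, by omega⟩ := by
  have hlt : m - r < m := by omega
  have hy' : (y.proj hlt.le).base ∈ c.chart.source := by rwa [base_proj]
  rw [IsSemisprayVector, ← (vecCoord_bijective hy').1.eq_iff, vecCoord_proj _ hy, map_smul,
    vecCoord_holonomicLift hlt hy, dTime_apply hy]
  constructor
  · intro h i hi
    exact congrFun (congrArg Prod.snd h) ⟨i, by omega⟩
  · intro h
    refine Prod.ext ?_ (funext fun i => h i (by omega))
    simp

end Jet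

/-! ### The Ostrogradsky recursion for functions of one variable -/

section OneVariable

variable {G : Type*} [NormedAddCommGroup G] [NormedSpace ℝ G]

/-- The alternating sums `∑ (-1)^i a_{r+1+i}^{(i)}` of iterated derivatives. -/
def ostrogradskySum (a : ℕ → ℝ → G) (n r : ℕ) (s : ℝ) : G :=
  ∑ i ∈ Finset.range (n - r), (-1 : ℝ) ^ i • iteratedDeriv i (a (r + 1 + i)) s

theorem contDiffAt_ostrogradskySum {a : ℕ → ℝ → G} {s : ℝ} (ha : ∀ j, ContDiffAt ℝ ∞ (a j) s)
    (n r : ℕ) : ContDiffAt ℝ ∞ (ostrogradskySum a n r) s := by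
  unfold ostrogradskySum
  exact ContDiffAt.sum fun i _ =>
    contDiffAt_const.smul (ContDiffAt.iteratedDeriv_infty (ha _) i)

/-- The Ostrogradsky recursion: in the sum for `r` the term `i = 0` is `a_{r+1}`, and the other
terms, reindexed, are minus the derivative of the sum for `r + 1`. -/
theorem hasDerivAt_ostrogradskySum_succ {a : ℕ → ℝ → G} {s : ℝ}
    (ha : ∀ j, ContDiffAt ℝ ∞ (a j) s) {n r : ℕ} (h : r < n) :
    HasDerivAt (ostrogradskySum a n (r + 1)) (a (r + 1) s - ostrogradskySum a n r s) s := by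
  have h1 : HasDerivAt (ostrogradskySum a n (r + 1)) (∑ i ∈ Finset.range (n - (r + 1)),
      (-1 : ℝ) ^ i • iteratedDeriv (i + 1) (a (r + 1 + 1 + i)) s) s := by
    unfold ostrogradskySum
    exact HasDerivAt.fun_sum fun i _ =>
      (ContDiffAt.hasDerivAt_iteratedDeriv (ha _) i).const_smul _
  convert h1 using 1
  rw [ostrogradskySum, show n - r = n - (r + 1) + 1 by omega, Finset.sum_range_succ']
  simp only [pow_zero, one_smul, iteratedDeriv_zero, add_zero, sub_add_cancel_right,
    ← Finset.sum_neg_distrib]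
  refine Finset.sum_congr rfl fun i _ => ?_
  rw [show r + 1 + (i + 1) = r + 1 + 1 + i by omega, pow_succ]
  simp

theorem ostrogradskySum_last (a : ℕ → ℝ → G) (n : ℕ) (s : ℝ) :
    ostrogradskySum a (n + 1) n s = a (n + 1) s := by
  simp [ostrogradskySum]

/-- The first variation formula: integration by parts of `∑ a_r(η^{(r)})`. -/
theorem hasDerivAt_sum_ostrogradskySum {a : ℕ → ℝ → (V →L[ℝ] ℝ)} {s : ℝ}
    (ha : ∀ j, ContDiffAt ℝ ∞ (a j) s) (n : ℕ) {η : ℝ → V} (hη : ContDiffAt ℝ ∞ η s) :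
    HasDerivAt
      (fun s => ∑ r ∈ Finset.range (n + 1), ostrogradskySum a (n + 1) r s (iteratedDeriv r η s))
      ((deriv (ostrogradskySum a (n + 1) 0) s - a 0 s) (η s) +
        ∑ r ∈ Finset.range (n + 2), a r s (iteratedDeriv r η s)) s := by
  set P := ostrogradskySum a (n + 1)
  have hP : ∀ r, HasDerivAt (P r) (deriv (P r) s) s := fun r =>
    ((contDiffAt_ostrogradskySum ha (n + 1) r).differentiableAt (by simp)).hasDerivAt
  -- Telescoping: `P_r' = a_r - P_{r-1}`, and the resulting `-P_{r-1}(η^{(r)})` cancels the term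
  -- left over from the previous index. What survives is the boundary term `P_N(η^{(N+1)})`, which
  -- for `N = n` is `a_{n+1}(η^{(n+1)})`.
  have hstep : ∀ N ≤ n, ∑ r ∈ Finset.range (N + 1),
      (deriv (P r) s (iteratedDeriv r η s) + P r s (iteratedDeriv (r + 1) η s)) =
      (deriv (P 0) s - a 0 s) (η s) + ∑ r ∈ Finset.range (N + 1), a r s (iteratedDeriv r η s) +
        P N s (iteratedDeriv (N + 1) η s) := by
    intro N hN
    induction N with
    | zero => simp
    | succ N ih =>
      rw [Finset.sum_range_succ, ih (by omega), Finset.sum_range_succ _ (N + 1),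
        (hasDerivAt_ostrogradskySum_succ ha (show N < n + 1 by omega)).deriv,
        sub_apply]
      change _ + ((a (N + 1) s (iteratedDeriv (N + 1) η s) - P N s (iteratedDeriv (N + 1) η s)) + _)
        = _
      ring
  have h1 : HasDerivAt (fun s => ∑ r ∈ Finset.range (n + 1), P r s (iteratedDeriv r η s))
      (∑ r ∈ Finset.range (n + 1),
        (deriv (P r) s (iteratedDeriv r η s) + P r s (iteratedDeriv (r + 1) η s))) s :=
    HasDerivAt.fun_sum fun r _ => (hP r).clm_apply (ContDiffAt.hasDerivAt_iteratedDeriv hη r)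
  convert h1 using 1
  rw [hstep n le_rfl, Finset.sum_range_succ _ (n + 1)]
  simp only [P, ostrogradskySum_last]
  ring

/-- The Ostrogradsky momenta do not depend on the coordinates in which a linear differential
operator is written. -/
theorem sum_ostrogradskySum_eq {O : Set ℝ} (hO : IsOpen O) {t : ℝ} (ht : t ∈ O)
    {a a' : ℕ → ℝ → (V →L[ℝ] ℝ)} {A : ℝ → V →L[ℝ] V}
    (ha : ∀ s ∈ O, ∀ j, ContDiffAt ℝ ∞ (a j) s) (ha' : ∀ s ∈ O, ∀ j, ContDiffAt ℝ ∞ (a' j) s)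
    (hA : ∀ s ∈ O, ContDiffAt ℝ ∞ A s) (n : ℕ)
    (h : ∀ η : ℝ → V, ContDiff ℝ ∞ η → ∀ s ∈ O,
      ∑ r ∈ Finset.range (n + 2), a r s (iteratedDeriv r η s) =
        ∑ r ∈ Finset.range (n + 2), a' r s (iteratedDeriv r (fun s => A s (η s)) s))
    {η : ℝ → V} (hη : ContDiff ℝ ∞ η) :
    ∑ r ∈ Finset.range (n + 1), ostrogradskySum a (n + 1) r t (iteratedDeriv r η t) =
      ∑ r ∈ Finset.range (n + 1),
        ostrogradskySum a' (n + 1) r t (iteratedDeriv r (fun s => A s (η s)) t) := by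
  -- Each boundary form has as its derivative the differential operator minus the Euler-Lagrange
  -- expression applied to `η`. The operators agree by `h`, so the difference `D` of the boundary
  -- forms has derivative `κ(η)`, in which no derivative of `η` occurs.
  set κ : ℝ → V →L[ℝ] ℝ := fun s => (deriv (ostrogradskySum a (n + 1) 0) s - a 0 s) -
    (deriv (ostrogradskySum a' (n + 1) 0) s - a' 0 s).comp (A s)
  set D : (ℝ → V) → ℝ → ℝ := fun η s =>
    ∑ r ∈ Finset.range (n + 1), ostrogradskySum a (n + 1) r s (iteratedDeriv r η s) -
      ∑ r ∈ Finset.range (n + 1),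
        ostrogradskySum a' (n + 1) r s (iteratedDeriv r (fun s => A s (η s)) s)
  have hD : ∀ η : ℝ → V, ContDiff ℝ ∞ η → ∀ s ∈ O, HasDerivAt (D η) (κ s (η s)) s := by
    intro η hη s hs
    have h1 := hasDerivAt_sum_ostrogradskySum (ha s hs) n hη.contDiffAt
    have h2 := hasDerivAt_sum_ostrogradskySum (ha' s hs) n
      ((hA s hs).clm_apply hη.contDiffAt)
    refine (h1.sub h2).congr_deriv ?_
    rw [h η hη s hs]
    simp only [κ, sub_apply, ContinuousLinearMap.comp_apply]
    ring
  have hcongr : ∀ {η η' : ℝ → V} {s : ℝ}, η =ᶠ[𝓝 s] η' → D η s = D η' s := by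
    intro η η' s hs
    have hs' : (fun s => A s (η s)) =ᶠ[𝓝 s] fun s => A s (η' s) := by
      filter_upwards [hs] with x hx
      rw [hx]
    simp only [D]
    congr 1
    · exact Finset.sum_congr rfl fun r _ => by rw [hs.iteratedDeriv_eq]
    · exact Finset.sum_congr rfl fun r _ => by rw [hs'.iteratedDeriv_eq]
  have hκ : ContinuousAt κ t := by
    have hd : ∀ b : ℕ → ℝ → (V →L[ℝ] ℝ), (∀ j, ContDiffAt ℝ ∞ (b j) t) →
        ContinuousAt (deriv (ostrogradskySum b (n + 1) 0)) t := by
      intro b hb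
      rw [← iteratedDeriv_one]
      exact (ContDiffAt.iteratedDeriv_infty (contDiffAt_ostrogradskySum hb _ _) 1).continuousAt
    exact ((hd a (ha t ht)).sub (ha t ht 0).continuousAt).sub
      (((hd a' (ha' t ht)).sub (ha' t ht 0).continuousAt).clm_comp (hA t ht).continuousAt)
  -- This bound also serves for `χ • η` with any cut-off `0 ≤ χ ≤ 1`, however steep, because
  -- derivatives of `χ` never enter.
  obtain ⟨C, hC⟩ : ∃ C : ℝ, ∀ᶠ s in 𝓝 t, ‖κ s‖ * ‖η s‖ ≤ C := by
    refine ⟨‖κ t‖ * ‖η t‖ + 1, ?_⟩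
    have : ContinuousAt (fun s => ‖κ s‖ * ‖η s‖) t :=
      hκ.norm.mul hη.continuous.continuousAt.norm
    exact (this.eventually_lt_const (lt_add_one _)).mono fun s hs => hs.le
  obtain ⟨δ, hδ, hball⟩ := Metric.eventually_nhds_iff_ball.1 (hC.and (hO.mem_nhds ht))
  -- The bump `χ` is `1` near `t` and vanishes beyond distance `ε / 2`. As `D` depends only on
  -- germs, `D (χ η)` equals `D η` at `t` and `0` at `t + ε`; the mean value inequality over this
  -- interval gives `C ε`, and `ε → 0` finishes the argument.
  have hbound : ∀ ε, 0 < ε → ε < δ → ‖D η t‖ ≤ C * ε := by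
    intro ε hε hεδ
    let χ : ContDiffBump t := ⟨ε / 4, ε / 2, by positivity, by linarith⟩
    have hχη : ContDiff ℝ ∞ fun s => χ s • η s := χ.contDiff.smul hη
    have e1 : D (fun s => χ s • η s) t = D η t := by
      refine hcongr ?_
      filter_upwards [χ.eventuallyEq_one] with s hs
      simp [hs]
    have e2 : D (fun s => χ s • η s) (t + ε) = 0 := by
      have hz : (fun s => χ s • η s) =ᶠ[𝓝 (t + ε)] fun _ => 0 := by
        have : ∀ᶠ s in 𝓝 (t + ε), t + ε / 2 < s := lt_mem_nhds (by linarith)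
        filter_upwards [this] with s hs
        rw [χ.zero_of_le_dist, zero_smul]
        rw [Real.dist_eq]
        exact (by linarith : ε / 2 ≤ s - t).trans (le_abs_self _)
      rw [hcongr hz]
      simp [D, iteratedDeriv_fun_const_zero]
    have hmv := (convex_ball t δ).norm_image_sub_le_of_norm_hasDerivWithin_le
      (f := D fun s => χ s • η s) (f' := fun s => κ s (χ s • η s)) (C := C)
      (x := t + ε) (y := t) (fun s hs => (hD _ hχη s (hball s hs).2).hasDerivWithinAt)
      (fun s hs => ?_) (by simpa [abs_of_pos hε] using hεδ) (by simpa using hδ)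
    · rw [e1, e2, sub_zero] at hmv
      simpa [abs_of_pos hε] using hmv
    · refine ((κ s).le_opNorm _).trans (le_trans ?_ (hball s hs).1)
      rw [norm_smul]
      refine mul_le_mul_of_nonneg_left ?_ (norm_nonneg _)
      refine mul_le_of_le_one_left (norm_nonneg _) ?_
      rw [Real.norm_of_nonneg χ.nonneg]
      exact χ.le_one
  have hlim : ‖D η t‖ ≤ 0 := by
    have h1 : Filter.Tendsto (fun ε : ℝ => C * ε) (𝓝[>] 0) (𝓝 (C * 0)) :=
      ((continuous_const.mul continuous_id).tendsto 0).mono_left nhdsWithin_le_nhds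
    rw [mul_zero] at h1
    refine ge_of_tendsto h1 ?_
    filter_upwards [Ioo_mem_nhdsGT hδ] with ε hε
    exact hbound ε hε.1 hε.2
  exact sub_eq_zero.1 (norm_le_zero_iff.1 hlim)

theorem hasDerivAt_clm_comp_apply {X : Type*} [NormedAddCommGroup X] [NormedSpace ℝ X]
    {Φ : X → X →L[ℝ] G} {Φ' : X →L[ℝ] X →L[ℝ] G} {γ : ℝ → X} {γ' : X} {t : ℝ}
    (h : HasFDerivAt Φ Φ' (γ t)) (hγ : HasDerivAt γ γ' t) (w : X) :
    HasDerivAt (fun s => Φ (γ s) w) (Φ' γ' w) t := by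
  have := (h.comp_hasDerivAt t hγ).clm_apply (hasDerivAt_const t w)
  simpa using this

/-- Partial derivatives commute. -/
theorem deriv_iteratedDeriv_comm {O : Set (ℝ × ℝ)} (hO : IsOpen O) {F : ℝ × ℝ → G}
    (hF : ContDiffOn ℝ ∞ F O) (i : ℕ) {z : ℝ × ℝ} (hz : z ∈ O) :
    HasDerivAt (fun e => iteratedDeriv i (fun s => F (e, s)) z.2)
      (iteratedDeriv i (fun s => deriv (fun e => F (e, s)) z.1) z.2) z.1 := by
  induction i generalizing z with
  | zero =>
    have hd := ((hF.contDiffAt (hO.mem_nhds hz)).differentiableAt (by simp))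
    have hc : DifferentiableAt ℝ (fun e : ℝ => (e, z.2)) z.1 := by fun_prop
    simp only [iteratedDeriv_zero]
    exact (hd.comp z.1 hc).hasDerivAt
  | succ i ih =>
    set H : ℝ × ℝ → G := fun z => iteratedDeriv i (fun s => F (z.1, s)) z.2
    have hH : ContDiffOn ℝ ∞ H O := contDiffOn_iteratedDeriv hO hF i
    have hHd : ∀ w ∈ O, HasFDerivAt H (fderiv ℝ H w) w := fun w hw =>
      ((hH.contDiffAt (hO.mem_nhds hw)).differentiableAt (by simp)).hasFDerivAt
    have hH2 : HasFDerivAt (fderiv ℝ H) (fderiv ℝ (fderiv ℝ H) z) z :=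
      (((hH.contDiffAt (hO.mem_nhds hz)).fderiv_right (m := ∞) (by simp)).differentiableAt
        (by simp)).hasFDerivAt
    have hfst : ∀ w : ℝ × ℝ, HasDerivAt (fun e : ℝ => (e, w.2)) ((1 : ℝ), (0 : ℝ)) w.1 :=
      fun w => (hasDerivAt_id _).prodMk (hasDerivAt_const _ _)
    have hsnd : ∀ w : ℝ × ℝ, HasDerivAt (fun s : ℝ => (w.1, s)) ((0 : ℝ), (1 : ℝ)) w.2 :=
      fun w => (hasDerivAt_const _ _).prodMk (hasDerivAt_id _)
    -- The induction hypothesis turns both sides into mixed second derivatives of `H`, which differ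
    -- only in the order of `e` and `s`.
    have hsymm : fderiv ℝ (fderiv ℝ H) z (1, 0) (0, 1) = fderiv ℝ (fderiv ℝ H) z (0, 1) (1, 0) :=
      (hH.contDiffAt (hO.mem_nhds hz)).isSymmSndFDerivAt (by
        rw [minSmoothness_of_isRCLikeNormedField]; exact WithTop.coe_le_coe.2 (le_top (a := (2 : ℕ∞)))) _ _
    have hev1 : ∀ᶠ e in 𝓝 z.1, (e, z.2) ∈ O :=
      (hfst z).continuousAt.eventually (hO.mem_nhds hz)
    have hev2 : ∀ᶠ s in 𝓝 z.2, (z.1, s) ∈ O :=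
      (hsnd z).continuousAt.eventually (hO.mem_nhds hz)
    have h1 : (fun e => iteratedDeriv (i + 1) (fun s => F (e, s)) z.2) =ᶠ[𝓝 z.1]
        fun e => fderiv ℝ H (e, z.2) (0, 1) := by
      filter_upwards [hev1] with e he
      rw [iteratedDeriv_succ]
      exact ((hHd _ he).comp_hasDerivAt z.2 (hsnd (e, z.2))).deriv
    have h2 : (iteratedDeriv i fun s => deriv (fun e => F (e, s)) z.1) =ᶠ[𝓝 z.2]
        fun s => fderiv ℝ H (z.1, s) (1, 0) := by
      filter_upwards [hev2] with s hs
      rw [← (ih hs).deriv]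
      exact ((hHd _ hs).comp_hasDerivAt z.1 (hfst (z.1, s))).deriv
    rw [iteratedDeriv_succ, h2.deriv_eq]
    refine HasDerivAt.congr_of_eventuallyEq ?_ h1
    have h3 := hasDerivAt_clm_comp_apply hH2 (hsnd z) (1, 0)
    have h4 := hasDerivAt_clm_comp_apply hH2 (hfst z) (0, 1)
    rw [h3.deriv, ← hsymm]
    exact h4

end OneVariable

/-! ### Total derivatives and momenta along sections -/

namespace PreJet

/-- The times at which a section is smooth with values in the domain of an adapted chart. -/
def domain (p : PreJet V π) (c : AdaptedChart V π) : Set ℝ :=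
  {s | IsSectionAt V π p.sec s ∧ p.sec s ∈ c.chart.source}

/-- The germ at another time of the section underlying `p`. -/
def shiftTime (p : PreJet V π) {s : ℝ} (h : IsSectionAt V π p.sec s) : PreJet V π := ⟨s, p.sec, h⟩

theorem isOpen_domain (p : PreJet V π) (c : AdaptedChart V π) : IsOpen (p.domain c) := by
  rw [isOpen_iff_mem_nhds]
  intro s hs
  filter_upwards [(p.shiftTime hs.1).eventually_mem_source c hs.2,
    Jet.eventually_isSectionAt (p.shiftTime hs.1)] with x hx hx'
  exact ⟨hx', hx⟩

theorem time_mem_domain {p : PreJet V π} {c : AdaptedChart V π} (h : p.base ∈ c.chart.source) :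
    p.time ∈ p.domain c := ⟨p.isSectionAt, h⟩

variable {p : PreJet V π} {c : AdaptedChart V π} {s : ℝ}

theorem contDiffAt_curve_of_mem (hs : s ∈ p.domain c) : ContDiffAt ℝ ∞ (p.curve c) s :=
  (p.shiftTime hs.1).contDiffAt_curve c hs.2

theorem lift_shiftTime (hs : s ∈ p.domain c) :
    Jet.lift m (p.shiftTime hs.1) =ᶠ[𝓝 s] Jet.lift m p := by
  filter_upwards [(p.isOpen_domain c).mem_nhds hs] with x hx
  rw [Jet.lift_eq hx.1, Jet.lift_eq (p := p.shiftTime hs.1) hx.1]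
  rfl

theorem lift_of_mem (hs : s ∈ p.domain c) : Jet.lift m p s = Jet.mk m (p.shiftTime hs.1) :=
  Jet.lift_eq hs.1

theorem base_lift (hs : s ∈ p.domain c) : (Jet.lift m p s).base ∈ c.chart.source := by
  rw [lift_of_mem hs]
  exact hs.2

theorem natHomeo_lift (hs : s ∈ p.domain c) :
    Jet.natHomeo m c (Jet.lift m p s) =
      (s, fun i : Fin (m + 1) => iteratedDeriv i (p.curve c) s) := by
  rw [lift_of_mem hs, Jet.natHomeo_mk _ _ hs.2]
  rfl

end PreJet

/-! ### Functions that are smooth in a natural chart, and their total derivatives -/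

variable {G : Type*} [NormedAddCommGroup G] [NormedSpace ℝ G]

/-- The function `f` on the jet bundle is smooth on the domain of a natural chart. -/
def SmoothIn (c : AdaptedChart V π) (f : Jet V π m → G) : Prop :=
  ContDiffOn ℝ ∞ (fun x => f ((Jet.natHomeo m c).symm x)) (Jet.natHomeo m c).target

namespace SmoothIn

variable {c : AdaptedChart V π} {f : Jet V π m → G}

theorem contDiffAt (hf : SmoothIn c f) {y : Jet V π m} (hy : y.base ∈ c.chart.source) :
    ContDiffAt ℝ ∞ (fun x => f ((Jet.natHomeo m c).symm x)) (Jet.natHomeo m c y) :=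
  ContDiffOn.contDiffAt hf ((Jet.natHomeo m c).open_target.mem_nhds
    ((Jet.natHomeo m c).map_source hy))

theorem differentiableAt (hf : SmoothIn c f) {y : Jet V π m} (hy : y.base ∈ c.chart.source) :
    DifferentiableAt ℝ (fun x => f ((Jet.natHomeo m c).symm x)) (Jet.natHomeo m c y) :=
  (hf.contDiffAt hy).differentiableAt (by simp)

theorem of_contMDiff (hf : ContMDiff (jetModel V m) 𝓘(ℝ, G) ∞ f) : SmoothIn c f := by
  rw [SmoothIn, ← contMDiffOn_iff_contDiffOn]
  exact hf.comp_contMDiffOn (Jet.contMDiffOn_natHomeo_symm m c)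

theorem contMDiffAt (hf : SmoothIn c f) {y : Jet V π m} (hy : y.base ∈ c.chart.source) :
    ContMDiffAt (jetModel V m) 𝓘(ℝ, G) ∞ f y := by
  refine ((hf.contDiffAt hy).contMDiffAt.comp y
    (Jet.contMDiffAt_natHomeo c hy)).congr_of_eventuallyEq ?_
  filter_upwards [Jet.eventually_mem_source c hy] with z hz
  exact (congrArg f ((Jet.natHomeo m c).left_inv hz)).symm

theorem hasDerivAt_lift (hf : SmoothIn c f) (p : PreJet V π) (h : p.base ∈ c.chart.source) :
    HasDerivAt (fun s => f (Jet.lift m p s))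
      (fderiv ℝ (fun x => f ((Jet.natHomeo m c).symm x)) (Jet.natHomeo m c (Jet.mk m p))
        (1, fun i : Fin (m + 1) => p.deriv c (i + 1))) p.time := by
  have h1 := (hf.differentiableAt (y := Jet.mk m p) h).hasFDerivAt
  rw [← Jet.lift_time] at h1 ⊢
  refine (h1.comp_hasDerivAt p.time (Jet.hasDerivAt_lift p c h)).congr_of_eventuallyEq ?_
  filter_upwards [Jet.eventually_lift p c h] with s hs
  exact (congrArg f ((Jet.natHomeo m c).left_inv hs.1)).symm

theorem contDiffAt_lift (hf : SmoothIn c f) {p : PreJet V π} {s : ℝ} (hs : s ∈ p.domain c) :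
    ContDiffAt ℝ ∞ (fun s => f (Jet.lift m p s)) s := by
  have h1 := (hf.contMDiffAt (PreJet.base_lift hs)).comp s
    ((Jet.contMDiffAt_lift (m := m) (p.shiftTime hs.1)).congr_of_eventuallyEq
      (PreJet.lift_shiftTime hs).symm)
  exact contMDiffAt_iff_contDiffAt.1 h1

/-- The coordinate expression of the total derivative. -/
theorem totalDeriv_eq (hf : SmoothIn c f) {y : Jet V π (m + 1)} (hy : y.base ∈ c.chart.source) :
    totalDeriv f y = fderiv ℝ (fun x => f ((Jet.natHomeo m c).symm x))
      (trunc V m.le_succ (Jet.natHomeo (m + 1) c y))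
      (shift m.lt_succ_self (Jet.natHomeo (m + 1) c y)) := by
  have hb : y.rep.base ∈ c.chart.source := by
    rw [← Jet.base_mk (m := m + 1), Jet.mk_rep]; exact hy
  rw [totalDeriv, (hf.hasDerivAt_lift y.rep hb).deriv, ← Jet.natHomeo_proj _ c hy]
  have h1 := Jet.natHomeo_mk (m := m + 1) c y.rep hb
  rw [Jet.mk_rep] at h1
  have h2 : Jet.mk m y.rep = y.proj m.le_succ := by rw [← Jet.proj_mk m.le_succ, Jet.mk_rep]
  rw [h1, h2]
  rfl

theorem totalDeriv (hf : SmoothIn c f) : SmoothIn c (totalDeriv f) := by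
  have h1 : ContDiffOn ℝ ∞ (fun x : JetModel V (m + 1) =>
      fderiv ℝ (fun x => f ((Jet.natHomeo m c).symm x)) (trunc V m.le_succ x)
        (shift m.lt_succ_self x)) (Jet.natHomeo (m + 1) c).target :=
    ((ContDiffOn.fderiv_of_isOpen hf (Jet.natHomeo m c).open_target (by simp)).comp
      (trunc V m.le_succ).contDiff.contDiffOn fun x hx => hx).clm_apply
      (contDiff_shift m.lt_succ_self).contDiffOn
  refine h1.congr fun x hx => ?_
  rw [hf.totalDeriv_eq ((Jet.natHomeo (m + 1) c).map_target hx),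
    (Jet.natHomeo (m + 1) c).right_inv hx]

theorem iterTotalDeriv (hf : SmoothIn c f) (i : ℕ) : SmoothIn c (iterTotalDeriv f i) := by
  induction i with
  | zero => exact hf
  | succ i ih => exact ih.totalDeriv

theorem comp_proj (h : r ≤ m) {f : Jet V π r → G} (hf : SmoothIn c f) :
    SmoothIn c fun y : Jet V π m => f (y.proj h) := by
  have h1 : ContDiffOn ℝ ∞ (fun x : JetModel V m => f ((Jet.natHomeo r c).symm (trunc V h x)))
      (Jet.natHomeo m c).target :=
    ContDiffOn.comp (g := fun x => f ((Jet.natHomeo r c).symm x)) hf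
      (trunc V h).contDiff.contDiffOn fun x hx => hx
  refine h1.congr fun x hx => ?_
  have hb := (Jet.natHomeo m c).map_target hx
  have hb' : (((Jet.natHomeo m c).symm x).proj h).base ∈ c.chart.source := by
    rw [Jet.base_proj]; exact hb
  have h2 := Jet.natHomeo_proj h c hb
  rw [(Jet.natHomeo m c).right_inv hx] at h2
  rw [← h2]
  exact congrArg f ((Jet.natHomeo r c).left_inv hb').symm

/-- At each `s` the total derivative uses a representative of the jet chosen anew, unrelated to `p`.
The coordinate expression depends on the jet alone, so `p` itself may be used. -/
theorem totalDeriv_lift (hf : SmoothIn c f) {p : PreJet V π} {s : ℝ} (hs : s ∈ p.domain c) :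
    JetMech.totalDeriv f (Jet.lift (m + 1) p s) = deriv (fun s => f (Jet.lift m p s)) s := by
  have h1 := (hf.hasDerivAt_lift (p.shiftTime hs.1) hs.2).deriv
  have h2 : (fun x => f (Jet.lift m (p.shiftTime hs.1) x)) =ᶠ[𝓝 s] fun x => f (Jet.lift m p x) :=
    (PreJet.lift_shiftTime hs).fun_comp f
  rw [← h2.deriv_eq]
  refine Eq.trans ?_ h1.symm
  rw [hf.totalDeriv_eq (PreJet.base_lift hs), PreJet.lift_of_mem hs,
    ← Jet.natHomeo_proj _ _ hs.2, Jet.natHomeo_mk _ _ hs.2]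
  rfl

/-- Along a prolonged section `d_T` is ordinary differentiation; this carries the momenta over to
the one-variable sums `ostrogradskySum`. -/
theorem iterTotalDeriv_lift (hf : SmoothIn c f) {p : PreJet V π} (i : ℕ) {s : ℝ}
    (hs : s ∈ p.domain c) : JetMech.iterTotalDeriv f i (Jet.lift (m + i) p s) =
      iteratedDeriv i (fun s => f (Jet.lift m p s)) s := by
  induction i generalizing s with
  | zero => rfl
  | succ i ih =>
    rw [iteratedDeriv_succ]
    refine ((hf.iterTotalDeriv i).totalDeriv_lift hs).trans (Filter.EventuallyEq.deriv_eq ?_)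
    filter_upwards [(p.isOpen_domain c).mem_nhds hs] with x hx
    exact ih hx

end SmoothIn

section Momentum

variable {c : AdaptedChart V π} {L : Jet V π (l + 1) → ℝ}

theorem smoothIn_lagPartial (hL : ContMDiff (jetModel V (l + 1)) 𝓘(ℝ, ℝ) ∞ L)
    (j : Fin (l + 1 + 1)) : SmoothIn c (lagPartial c L j) := by
  have h0 : SmoothIn c L := .of_contMDiff hL
  have h1 := (ContDiffOn.fderiv_of_isOpen h0 (Jet.natHomeo (l + 1) c).open_target
    (m := ∞) (by simp)).clm_comp (contDiffOn_const (c :=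
      ((ContinuousLinearMap.inr ℝ ℝ (Fin (l + 1 + 1) → V)).comp
      (ContinuousLinearMap.single ℝ (fun _ => V) j))))
  refine h1.congr fun x hx => ?_
  rw [lagPartial, (Jet.natHomeo (l + 1) c).right_inv hx]

theorem smoothIn_momentum (hL : ContMDiff (jetModel V (l + 1)) 𝓘(ℝ, ℝ) ∞ L)
    (r : Fin (l + 1)) : SmoothIn c (momentum c L r) := by
  unfold momentum SmoothIn
  refine ContDiffOn.sum fun i _ => ?_
  exact ContDiffOn.const_smul _ (((smoothIn_lagPartial hL _).iterTotalDeriv i).comp_proj _)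

/-- The partial derivatives of the Lagrangian along a section. -/
def lagPartialAlong (c : AdaptedChart V π) (L : Jet V π (l + 1) → ℝ) (p : PreJet V π) (j : ℕ)
    (s : ℝ) : V →L[ℝ] ℝ :=
  if h : j < l + 1 + 1 then lagPartial c L ⟨j, h⟩ (Jet.lift (l + 1) p s) else 0

theorem contDiffAt_lagPartialAlong (hL : ContMDiff (jetModel V (l + 1)) 𝓘(ℝ, ℝ) ∞ L)
    {p : PreJet V π} {s : ℝ} (hs : s ∈ p.domain c) (j : ℕ) :
    ContDiffAt ℝ ∞ (lagPartialAlong c L p j) s := by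
  unfold lagPartialAlong
  split_ifs with h
  · exact (smoothIn_lagPartial hL _).contDiffAt_lift hs
  · exact contDiffAt_const

theorem momentum_lift (hL : ContMDiff (jetModel V (l + 1)) 𝓘(ℝ, ℝ) ∞ L) {p : PreJet V π} {s : ℝ}
    (hs : s ∈ p.domain c) (r : Fin (l + 1)) :
    momentum c L r (Jet.lift (2 * l + 1) p s) =
      ostrogradskySum (lagPartialAlong c L p) (l + 1) r s := by
  rw [momentum, ostrogradskySum, Finset.sum_range]
  refine Finset.sum_congr rfl fun i _ => ?_
  rw [Jet.proj_lift, (smoothIn_lagPartial hL _).iterTotalDeriv_lift i hs]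
  congr 2
  funext s
  rw [lagPartialAlong, dif_pos]

end Momentum

/-! ### Chart independence of the Legendre-Ostrogradsky map -/

/-- The derivative along the fibres of a change of adapted coordinates, along a section. -/
def fibreTransition (c c' : AdaptedChart V π) (p : PreJet V π) (s : ℝ) : V →L[ℝ] V :=
  (fderiv ℝ (fun x => (c'.chart (c.chart.symm x)).2) (c.chart (p.sec s))).comp
    (ContinuousLinearMap.inr ℝ ℝ V)

/-! ### Prolonged variations of a section under a change of chart -/

section Variation

variable {c c' : AdaptedChart V π} {p : PreJet V π} {s : ℝ}

theorem contDiffAt_trans_snd {x : ℝ × V} (hx : x ∈ (c.chart.symm.trans c'.chart).source) :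
    ContDiffAt ℝ ∞ (fun x => (c'.chart (c.chart.symm x)).2) x :=
  ((c.contDiffOn_trans c').contDiffAt
    ((c.chart.symm.trans c'.chart).open_source.mem_nhds hx)).snd

theorem chart_sec_mem (hs : s ∈ p.domain c) (hs' : s ∈ p.domain c') :
    c.chart (p.sec s) ∈ (c.chart.symm.trans c'.chart).source := by
  refine ⟨c.chart.map_source hs.2, ?_⟩
  change c.chart.symm (c.chart (p.sec s)) ∈ c'.chart.source
  rw [c.chart.left_inv hs.2]
  exact hs'.2

theorem chart_sec_eq (hs : s ∈ p.domain c) : c.chart (p.sec s) = (s, p.curve c s) :=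
  Prod.ext ((c.fst_eq _ hs.2).trans hs.1.self_of_nhds.2) rfl

theorem contDiffAt_fibreTransition (hs : s ∈ p.domain c) (hs' : s ∈ p.domain c') :
    ContDiffAt ℝ ∞ (fibreTransition c c' p) s := by
  have h1 := ((contDiffAt_trans_snd (chart_sec_mem hs hs')).fderiv_right (m := ∞) (by simp))
  have h2 : ContDiffAt ℝ ∞ (fun s => c.chart (p.sec s)) s :=
    (p.shiftTime hs.1).contDiffAt_chart c hs.2
  exact (h1.comp s h2).clm_comp contDiffAt_const

/-- A section of `π` with a prescribed coordinate expression. -/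
def sectionOfCurve (c : AdaptedChart V π) (u : ℝ → V) (s : ℝ) (hu : ∀ᶠ s in 𝓝 s, ContDiffAt ℝ ∞ u s)
    (h : (s, u s) ∈ c.chart.target) : PreJet V π where
  time := s
  sec s := c.chart.symm (s, u s)
  isSectionAt := by
    have hc : ContinuousAt (fun s => (s, u s)) s :=
      continuousAt_id.prodMk hu.self_of_nhds.continuousAt
    filter_upwards [hc.eventually (c.chart.open_target.mem_nhds h), hu] with x hx hux
    refine ⟨?_, c.fst_symm hx⟩
    exact ((contMDiffOn_symm_of_mem_maximalAtlas c.mem_maximalAtlas).contMDiffAt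
      (c.chart.open_target.mem_nhds hx)).comp x (contDiffAt_id.prodMk hux).contMDiffAt

theorem natHomeo_sectionOfCurve (c : AdaptedChart V π) (u : ℝ → V) (s : ℝ)
    (hu : ∀ᶠ s in 𝓝 s, ContDiffAt ℝ ∞ u s) (h : (s, u s) ∈ c.chart.target) :
    Jet.natHomeo m c (Jet.mk m (sectionOfCurve c u s hu h)) =
      (s, fun i : Fin (m + 1) => iteratedDeriv i u s) := by
  have hb : (sectionOfCurve c u s hu h).base ∈ c.chart.source := c.chart.map_target h
  rw [Jet.natHomeo_mk _ _ hb]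
  refine Prod.ext rfl (funext fun i => Filter.EventuallyEq.iteratedDeriv_eq (x := s) i ?_)
  have hc : ContinuousAt (fun s => (s, u s)) s :=
    continuousAt_id.prodMk hu.self_of_nhds.continuousAt
  filter_upwards [hc.eventually (c.chart.open_target.mem_nhds h)] with x hx
  change (c.chart (c.chart.symm (x, u x))).2 = _
  rw [c.chart.right_inv hx]

/-- Both sides are the `c'`-coordinates of the jet at `s` of one section, the one given by `u` in
the chart `c`. The jet transition map is thus evaluated without an explicit formula. -/
theorem natHomeo_trans_curve (c c' : AdaptedChart V π) (u : ℝ → V) (s : ℝ)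
    (hu : ∀ᶠ s in 𝓝 s, ContDiffAt ℝ ∞ u s)
    (h : (s, u s) ∈ (c.chart.symm.trans c'.chart).source) :
    Jet.natHomeo m c' ((Jet.natHomeo m c).symm (s, fun i : Fin (m + 1) => iteratedDeriv i u s)) =
      (s, fun i : Fin (m + 1) =>
        iteratedDeriv i (fun s => (c'.chart (c.chart.symm (s, u s))).2) s) := by
  have hb : (sectionOfCurve c u s hu h.1).base ∈ c.chart.source := c.chart.map_target h.1
  rw [← natHomeo_sectionOfCurve c u s hu h.1,
    (Jet.natHomeo m c).left_inv (show _ ∈ (Jet.natHomeo m c).source from hb),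
    Jet.natHomeo_mk _ _ (show (sectionOfCurve c u s hu h.1).base ∈ c'.chart.source from h.2)]
  rfl

/-- The derivative in the parameter `e` is moved inside the iterated derivative in `s`. There it is
the fibre derivative of the transition map at `p.curve c`, applied to `η`. -/
theorem hasDerivAt_variation (hs : s ∈ p.domain c) (hs' : s ∈ p.domain c') {η : ℝ → V}
    (hη : ContDiff ℝ ∞ η) (i : ℕ) :
    HasDerivAt (fun e : ℝ => iteratedDeriv i
        (fun s => (c'.chart (c.chart.symm (s, p.curve c s + e • η s))).2) s)
      (iteratedDeriv i (fun s => fibreTransition c c' p s (η s)) s) 0 := by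
  set S := (c.chart.symm.trans c'.chart).source
  have hS : IsOpen S := (c.chart.symm.trans c'.chart).open_source
  set D : Set (ℝ × ℝ) := Prod.snd ⁻¹' p.domain c
  have hDo : IsOpen D := (p.isOpen_domain c).preimage continuous_snd
  set g : ℝ × ℝ → ℝ × V := fun z => (z.2, p.curve c z.2 + z.1 • η z.2)
  have hg : ContDiffOn ℝ ∞ g D := by
    intro z hz
    have h1 : ContDiffAt ℝ ∞ (fun z : ℝ × ℝ => p.curve c z.2) z :=
      (PreJet.contDiffAt_curve_of_mem hz).comp z contDiffAt_snd
    have h2 : ContDiff ℝ ∞ (fun z : ℝ × ℝ => z.1 • η z.2) :=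
      contDiff_fst.smul (hη.comp contDiff_snd)
    exact (contDiffAt_snd.prodMk (h1.add h2.contDiffAt)).contDiffWithinAt
  set O := D ∩ g ⁻¹' S
  have hO : IsOpen O := hg.continuousOn.isOpen_inter_preimage hDo hS
  have hF : ContDiffOn ℝ ∞ (fun z => (c'.chart (c.chart.symm (g z))).2) O := by
    intro z hz
    exact (contDiffAt_trans_snd hz.2).comp_contDiffWithinAt z ((hg z hz.1).mono fun _ h => h.1)
  have hmem : ∀ x ∈ p.domain c, x ∈ p.domain c' → ((0 : ℝ), x) ∈ O := by
    intro x hx hx'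
    refine ⟨hx, ?_⟩
    change (x, p.curve c x + (0 : ℝ) • η x) ∈ S
    rw [zero_smul, add_zero, ← chart_sec_eq hx]
    exact chart_sec_mem hx hx'
  refine (deriv_iteratedDeriv_comm hO hF i (hmem s hs hs')).congr_deriv ?_
  refine Filter.EventuallyEq.iteratedDeriv_eq (x := s) i ?_
  filter_upwards [(p.isOpen_domain c).mem_nhds hs, (p.isOpen_domain c').mem_nhds hs'] with x hx hx'
  have h1 := ((contDiffAt_trans_snd (chart_sec_mem hx hx')).differentiableAt
    (by simp)).hasFDerivAt
  have h2 : HasDerivAt (fun e : ℝ => g (e, x)) (0, η x) 0 := by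
    have : HasDerivAt (fun e : ℝ => e • η x) ((1 : ℝ) • η x) 0 := (hasDerivAt_id _).smul_const _
    rw [one_smul] at this
    exact (hasDerivAt_const _ _).prodMk (this.const_add (p.curve c x))
  have h3 : g (0, x) = c.chart (p.sec x) := by
    rw [chart_sec_eq hx]
    simp [g]
  rw [← h3] at h1
  refine (h1.comp_hasDerivAt (0 : ℝ) h2).deriv.trans ?_
  rw [h3]
  rfl

theorem fderiv_natHomeo_trans {y : Jet V π m} (hc : y.base ∈ c.chart.source)
    (hc' : y.base ∈ c'.chart.source) :
    ∃ T : JetModel V m →L[ℝ] JetModel V m,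
      HasFDerivAt (fun x => Jet.natHomeo m c' ((Jet.natHomeo m c).symm x)) T
        (Jet.natHomeo m c y) ∧
      ∀ v, Jet.vecCoord c' y v = T (Jet.vecCoord c y v) := by
  have h1 : ContDiffAt ℝ ∞ (fun x => Jet.natHomeo m c' ((Jet.natHomeo m c).symm x))
      (Jet.natHomeo m c y) := by
    rw [← contMDiffAt_iff_contDiffAt]
    refine ContMDiffAt.comp _ (Jet.contMDiffAt_natHomeo c' ?_)
      (Jet.contMDiffAt_natHomeo_symm c ((Jet.natHomeo m c).map_source hc))
    rw [(Jet.natHomeo m c).left_inv hc]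
    exact hc'
  have h2 := (h1.differentiableAt (by simp)).hasFDerivAt
  refine ⟨_, h2, fun v => ?_⟩
  have h3 := h2.hasMFDerivAt.comp y (Jet.hasMFDerivAt_natHomeo hc)
  have h4 := h3.congr_of_eventuallyEq (f₁ := Jet.natHomeo m c') (by
    filter_upwards [Jet.eventually_mem_source c hc] with z hz
    exact congrArg (Jet.natHomeo m c') ((Jet.natHomeo m c).left_inv hz).symm)
  exact congrArg (fun T => T v) (hasMFDerivAt_unique (Jet.hasMFDerivAt_natHomeo hc') h4)

/-- Such a `v` is the velocity at `e = 0` of the jets of `p.curve c + e • η`. Read in `c'`, the same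
family of sections has first-order variation `fibreTransition c c' p` applied to `η`, so the
components of `v` are the derivatives of that curve. -/
theorem vecCoord_variation (hs : s ∈ p.domain c) (hs' : s ∈ p.domain c') {η : ℝ → V}
    (hη : ContDiff ℝ ∞ η) {v : TangentSpace (jetModel V m) (Jet.lift m p s)}
    (hv : Jet.vecCoord c (Jet.lift m p s) v = (0, fun i : Fin (m + 1) => iteratedDeriv i η s)) :
    Jet.vecCoord c' (Jet.lift m p s) v =
      (0, fun i : Fin (m + 1) => iteratedDeriv i (fun s => fibreTransition c c' p s (η s)) s) := by
  obtain ⟨T, hT, hTv⟩ := fderiv_natHomeo_trans (PreJet.base_lift (m := m) hs)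
    (PreJet.base_lift (m := m) hs')
  rw [hTv, hv]
  -- The `c`-coordinates of the jets of the varied section; affine in `e`, with velocity the given
  -- coordinates of `v`.
  set x : ℝ → JetModel V m := fun e =>
    (s, fun i : Fin (m + 1) => iteratedDeriv i (fun s => p.curve c s + e • η s) s)
  have hx : ∀ e, x e = (s, fun i : Fin (m + 1) =>
      iteratedDeriv i (p.curve c) s + e • iteratedDeriv i η s) := by
    intro e
    refine Prod.ext rfl (funext fun i => ?_)
    have h1 : ContDiffAt ℝ (i : ℕ) (p.curve c) s :=
      (PreJet.contDiffAt_curve_of_mem hs).of_le (by exact_mod_cast le_top)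
    have h2 : ContDiffAt ℝ (i : ℕ) η s := hη.contDiffAt.of_le (by exact_mod_cast le_top)
    change iteratedDeriv i (p.curve c + fun s => e • η s) s = _
    rw [iteratedDeriv_add h1 (h2.const_smul e)]
    exact congrArg _ (iteratedDeriv_fun_const_smul h2 e)
  have h0 : x 0 = Jet.natHomeo m c (Jet.lift m p s) := by
    rw [hx, PreJet.natHomeo_lift hs]
    simp
  have hxd : HasDerivAt x (0, fun i : Fin (m + 1) => iteratedDeriv i η s) 0 := by
    rw [show x = _ from funext hx]
    refine (hasDerivAt_const _ _).prodMk (hasDerivAt_pi.2 fun i => ?_)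
    have : HasDerivAt (fun e : ℝ => e • iteratedDeriv i η s) ((1 : ℝ) • iteratedDeriv i η s) 0 :=
      (hasDerivAt_id _).smul_const _
    rw [one_smul] at this
    exact this.const_add _
  rw [← h0] at hT
  have h1 := hT.comp_hasDerivAt (0 : ℝ) hxd
  have h2 : HasDerivAt (fun e : ℝ => ((s, fun i : Fin (m + 1) => iteratedDeriv i
        (fun s => (c'.chart (c.chart.symm (s, p.curve c s + e • η s))).2) s) : JetModel V m))
      (0, fun i : Fin (m + 1) => iteratedDeriv i (fun s => fibreTransition c c' p s (η s)) s) 0 :=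
    (hasDerivAt_const _ _).prodMk (hasDerivAt_pi.2 fun i => hasDerivAt_variation hs hs' hη i)
  refine h1.unique (h2.congr_of_eventuallyEq ?_)
  have hS : IsOpen (c.chart.symm.trans c'.chart).source :=
    (c.chart.symm.trans c'.chart).open_source
  have hcont : ContinuousAt (fun e : ℝ => (s, p.curve c s + e • η s)) 0 := by fun_prop
  filter_upwards [hcont.eventually (hS.mem_nhds (by
    change (s, p.curve c s + (0 : ℝ) • η s) ∈ _
    rw [zero_smul, add_zero, ← chart_sec_eq hs]; exact chart_sec_mem hs hs'))] with e he
  refine natHomeo_trans_curve c c' (fun s => p.curve c s + e • η s) s ?_ he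
  filter_upwards [(p.isOpen_domain c).mem_nhds hs] with x hx
  exact (PreJet.contDiffAt_curve_of_mem hx).add (contDiffAt_const.smul hη.contDiffAt)

end Variation

section Invariance

variable {c c' : AdaptedChart V π} {L : Jet V π (l + 1) → ℝ}

/-- The differential of the Lagrangian on vertical vectors, in natural coordinates. -/
theorem mfderiv_lagrangian_vertical (hL : ContMDiff (jetModel V (l + 1)) 𝓘(ℝ, ℝ) ∞ L)
    {z : Jet V π (l + 1)} (hz : z.base ∈ c.chart.source) {v : TangentSpace (jetModel V (l + 1)) z}
    (hv : (Jet.vecCoord c z v).1 = 0) :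
    mfderiv (jetModel V (l + 1)) 𝓘(ℝ, ℝ) L z v =
      ∑ j, lagPartial c L j z ((Jet.vecCoord c z v).2 j) := by
  have h0 : SmoothIn c L := .of_contMDiff hL
  have h1 := (h0.differentiableAt hz).hasFDerivAt.hasMFDerivAt.comp z
    (Jet.hasMFDerivAt_natHomeo hz)
  have h2 := h1.congr_of_eventuallyEq (f₁ := L) (by
    filter_upwards [Jet.eventually_mem_source c hz] with x hx
    exact congrArg L ((Jet.natHomeo (l + 1) c).left_inv hx).symm)
  rw [h2.mfderiv]
  change fderiv ℝ (fun x => L ((Jet.natHomeo (l + 1) c).symm x)) (Jet.natHomeo (l + 1) c z)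
    (Jet.vecCoord c z v) = _
  have h3 : Jet.vecCoord c z v = ∑ j, ContinuousLinearMap.inr ℝ ℝ (Fin (l + 1 + 1) → V)
      (ContinuousLinearMap.single ℝ (fun _ => V) j ((Jet.vecCoord c z v).2 j)) := by
    rw [← map_sum]
    refine Prod.ext hv ?_
    exact (Finset.univ_sum_single _).symm
  conv_lhs => rw [h3, map_sum]
  rfl

/-- The left side mentions no chart. Hence the operators `∑ a_r η^{(r)}` of two charts correspond
under `η ↦ fibreTransition c c' p η`, which is the hypothesis needed in `sum_ostrogradskySum_eq`. -/
theorem sum_lagPartialAlong (hL : ContMDiff (jetModel V (l + 1)) 𝓘(ℝ, ℝ) ∞ L) {p : PreJet V π}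
    {s : ℝ} (hs : s ∈ p.domain c) {η : ℝ → V} {v : TangentSpace (jetModel V (l + 1)) _}
    (hv : Jet.vecCoord c (Jet.lift (l + 1) p s) v =
      (0, fun i : Fin (l + 1 + 1) => iteratedDeriv i η s)) :
    mfderiv (jetModel V (l + 1)) 𝓘(ℝ, ℝ) L (Jet.lift (l + 1) p s) v =
      ∑ r ∈ Finset.range (l + 2), lagPartialAlong c L p r s (iteratedDeriv r η s) := by
  rw [mfderiv_lagrangian_vertical hL (PreJet.base_lift hs) (by rw [hv]), hv, Finset.sum_range]
  refine Finset.sum_congr rfl fun i _ => ?_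
  rw [lagPartialAlong, dif_pos i.2]

theorem sum_momentum_eq (hL : ContMDiff (jetModel V (l + 1)) 𝓘(ℝ, ℝ) ∞ L) {p : PreJet V π}
    (hc : p.base ∈ c.chart.source) (hc' : p.base ∈ c'.chart.source) {η : ℝ → V}
    (hη : ContDiff ℝ ∞ η) :
    ∑ r : Fin (l + 1), momentum c L r (Jet.mk _ p) (iteratedDeriv r η p.time) =
      ∑ r : Fin (l + 1), momentum c' L r (Jet.mk _ p)
        (iteratedDeriv r (fun s => fibreTransition c c' p s (η s)) p.time) := by
  have ht := PreJet.time_mem_domain hc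
  have ht' := PreJet.time_mem_domain hc'
  have h := sum_ostrogradskySum_eq ((p.isOpen_domain c).inter (p.isOpen_domain c')) ⟨ht, ht'⟩
    (fun s hs j => contDiffAt_lagPartialAlong hL hs.1 j)
    (fun s hs j => contDiffAt_lagPartialAlong hL hs.2 j)
    (fun s hs => contDiffAt_fibreTransition hs.1 hs.2) l (fun η hη s hs => by
      obtain ⟨v, hv⟩ := (Jet.vecCoord_bijective (m := l + 1) (PreJet.base_lift hs.1)).2
        (0, fun i : Fin (l + 1 + 1) => iteratedDeriv i η s)
      rw [← sum_lagPartialAlong hL hs.1 hv,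
        sum_lagPartialAlong hL hs.2 (vecCoord_variation hs.1 hs.2 hη hv)]) hη
  rw [Finset.sum_range, Finset.sum_range] at h
  rw [← Jet.lift_time]
  simp only [momentum_lift hL ht, momentum_lift hL ht']
  exact h

theorem legendreCoord_apply (c : AdaptedChart V π) (L : Jet V π (l + 1) → ℝ)
    (y : Jet V π (2 * l + 1)) (x : JetModel V l) :
    legendreCoord c L y x = (L (y.proj (by omega)) -
      ∑ r : Fin (l + 1), momentum c L r y ((y.coord c).2 ⟨r + 1, by omega⟩)) * x.1 +
      ∑ r : Fin (l + 1), momentum c L r y (x.2 r) := by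
  simp [legendreCoord]

/-- The coefficient `p = L - ∑ p̂^r q_{r+1}` is made for this: on the holonomic lift `(1, q_1, q_2,
…)` the momentum terms cancel. It is the reason why the graph lies in `W_o`. -/
theorem legendreCoord_shift (c : AdaptedChart V π) (L : Jet V π (l + 1) → ℝ)
    (y : Jet V π (2 * l + 1)) :
    legendreCoord c L y (shift (by omega) (Jet.natHomeo _ c y)) = L (y.proj (by omega)) := by
  rw [legendreCoord_apply, shift_fst, mul_one]
  exact sub_add_cancel _ _

/-- The covector of the extended Legendre-Ostrogradsky map is the same in all adapted charts. -/
theorem legendreCoord_eq (hL : ContMDiff (jetModel V (l + 1)) 𝓘(ℝ, ℝ) ∞ L)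
    {y : Jet V π (2 * l + 1)} (hc : y.base ∈ c.chart.source) (hc' : y.base ∈ c'.chart.source)
    (v : TangentSpace (jetModel V l) (projMap V π l y)) :
    legendreCoord c L y (Jet.vecCoord c (projMap V π l y) v) =
      legendreCoord c' L y (Jet.vecCoord c' (projMap V π l y) v) := by
  have hlt : l < 2 * l + 1 := by omega
  set h : TangentSpace (jetModel V l) (projMap V π l y) := holonomicLift hlt.le y
  have hsh : ∀ c : AdaptedChart V π, y.base ∈ c.chart.source →
      Jet.vecCoord c (projMap V π l y) h = shift hlt (Jet.natHomeo _ c y) :=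
    fun c hc => Jet.vecCoord_holonomicLift hlt hc
  set τ := (Jet.vecCoord c (projMap V π l y) v).1
  -- On the holonomic lift `h` both expressions equal `L`, so only the part `w` without time
  -- component has to be compared.
  obtain ⟨w, hw⟩ : ∃ w, v = w + τ • h := ⟨v - τ • h, by abel⟩
  have hw0 : (Jet.vecCoord c (projMap V π l y) w).1 = 0 := by
    have : w = v - τ • h := by rw [hw]; abel
    rw [this, map_sub, map_smul, hsh c hc]
    simp [τ]
  have hwη : legendreCoord c L y (Jet.vecCoord c (projMap V π l y) w) =
      legendreCoord c' L y (Jet.vecCoord c' (projMap V π l y) w) := by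
    obtain ⟨p, rfl⟩ := y.exists_mk
    -- The Taylor polynomial with derivatives the components of `w` realizes `w` as a prolonged
    -- variation, to which the invariance of the momenta applies.
    let x : JetModel V l := (p.time, (Jet.vecCoord c (Jet.mk l p) w).2)
    set η := taylorCurve x
    have hη : ContDiff ℝ ∞ η := contDiff_taylorCurve.comp (contDiff_const.prodMk contDiff_id)
    have hv : Jet.vecCoord c (Jet.mk l p) w =
        (0, fun i : Fin (l + 1) => iteratedDeriv i η p.time) :=
      Prod.ext hw0 (funext fun i => (iteratedDeriv_taylorCurve x i).symm)
    have ht := PreJet.time_mem_domain hc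
    have ht' := PreJet.time_mem_domain hc'
    have hv' : Jet.vecCoord c' (Jet.mk l p) w = (0, fun i : Fin (l + 1) =>
        iteratedDeriv i (fun s => fibreTransition c c' p s (η s)) p.time) := by
      have := @vecCoord_variation _ _ _ _ _ _ _ _ l c c' p p.time ht ht' η hη
      rw [Jet.lift_time] at this
      exact this hv
    have e1 := sum_momentum_eq hL (p := p) hc hc' hη
    rw [legendreCoord_apply, legendreCoord_apply]
    change _ * (Jet.vecCoord c (Jet.mk l p) w).1 +
      ∑ r : Fin (l + 1), momentum c L r _ ((Jet.vecCoord c (Jet.mk l p) w).2 r) =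
      _ * (Jet.vecCoord c' (Jet.mk l p) w).1 +
      ∑ r : Fin (l + 1), momentum c' L r _ ((Jet.vecCoord c' (Jet.mk l p) w).2 r)
    rw [hv, hv', mul_zero, mul_zero, zero_add, zero_add]
    exact e1
  rw [hw]
  simp only [map_add, map_smul, hwη, hsh c hc, hsh c' hc', legendreCoord_shift]

/-- Chart independence replaces the chart chosen at `y` by a fixed one valid for all nearby `y`, as
smoothness requires. -/
theorem legendreCovector_apply (hL : ContMDiff (jetModel V (l + 1)) 𝓘(ℝ, ℝ) ∞ L)
    {y : Jet V π (2 * l + 1)} (hc : y.base ∈ c.chart.source)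
    (v : TangentSpace (jetModel V l) (projMap V π l y)) :
    legendreCovector L y v = legendreCoord c L y (Jet.vecCoord c (projMap V π l y) v) :=
  legendreCoord_eq hL (Jet.mem_someChart_source y.base) hc v

theorem legendreCovector_holonomicLift (hL : ContMDiff (jetModel V (l + 1)) 𝓘(ℝ, ℝ) ∞ L)
    (y : Jet V π (2 * l + 1)) :
    legendreCovector L y (holonomicLift (by omega) y) = L (y.proj (by omega)) := by
  have hb := Jet.mem_someChart_source (V := V) (π := π) y.base
  have h := Jet.vecCoord_holonomicLift (show l < 2 * l + 1 by omega) hb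
  rw [legendreCovector_apply hL hb]
  exact (congrArg _ h).trans (legendreCoord_shift _ L y)

theorem contDiffOn_legendreCoord (hL : ContMDiff (jetModel V (l + 1)) 𝓘(ℝ, ℝ) ∞ L)
    (c : AdaptedChart V π) : SmoothIn c (legendreCoord c L) := by
  have h1 : SmoothIn c fun y : Jet V π (2 * l + 1) => L (y.proj (by omega)) :=
    (SmoothIn.of_contMDiff hL).comp_proj (by omega)
  have h2 := fun r => smoothIn_momentum (c := c) hL r
  unfold SmoothIn at h1 h2 ⊢
  unfold legendreCoord
  refine ContDiffOn.add (ContDiffOn.smul (h1.sub (ContDiffOn.sum fun r _ => ?_)) contDiffOn_const)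
    (ContDiffOn.sum fun r _ => (h2 r).clm_comp contDiffOn_const)
  refine (h2 r).clm_apply ?_
  have h3 : ContDiff ℝ ∞ fun x : JetModel V (2 * l + 1) => x.2 ⟨r + 1, by omega⟩ := by fun_prop
  refine h3.contDiffOn.congr fun x hx => ?_
  rw [← Jet.natHomeo_apply, (Jet.natHomeo _ c).right_inv hx]

end Invariance

/-! ### The cotangent bundle and the unified bundle in coordinates -/

/-- The coordinates of a covector in the trivialization of the cotangent bundle at `q₀`. -/
def covCoord (q₀ : Jet V π l) (α : Cot V π l) : JetModel V l →L[ℝ] ℝ :=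
  (trivializationAt (JetModel V l →L[ℝ] ℝ) (CotFibre V π l) q₀ α).2

/-- The cotangent trivialization is dual to the tangent one, and the latter is the derivative of the
natural chart at `q₀`; the two coordinate changes therefore cancel in the pairing. -/
theorem covCoord_apply {q₀ : Jet V π l} {α : Cot V π l}
    (h : α.proj.base ∈ (Jet.someChart V π q₀.base).chart.source)
    (v : TangentSpace (jetModel V l) α.proj) :
    covCoord q₀ α (Jet.vecCoord (Jet.someChart V π q₀.base) α.proj v) = α.2 v := by
  have hmem : α.proj ∈ (chartAt (JetModel V l) q₀).source := h
  have h1 : Jet.vecCoord (Jet.someChart V π q₀.base) α.proj v =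
      (trivializationAt (JetModel V l) (TangentSpace (jetModel V l)) q₀).continuousLinearMapAt ℝ
        α.proj v := by
    rw [TangentBundle.continuousLinearMapAt_trivializationAt hmem, Jet.extChartAt_eq]
    rfl
  rw [h1, covCoord, hom_trivializationAt_apply]
  have h2 := (trivializationAt (JetModel V l) (TangentSpace (jetModel V l))
    q₀).symmL_continuousLinearMapAt (R := ℝ) (show α.proj ∈ _ from hmem) v
  change (Bundle.Trivialization.continuousLinearMapAt ℝ (trivializationAt ℝ (Bundle.Trivial (Jet V π l) ℝ) q₀) α.proj)
    (α.2 ((trivializationAt (JetModel V l) (TangentSpace (jetModel V l)) q₀).symmL ℝ α.proj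
      ((trivializationAt (JetModel V l) (TangentSpace (jetModel V l)) q₀).continuousLinearMapAt ℝ
        α.proj v))) = _
  rw [h2]
  simp

theorem extChartAt_cot_apply (α β : Cot V π l) :
    extChartAt (cotModel V l) α β =
      (Jet.natHomeo l (Jet.someChart V π α.proj.base)
        (trivializationAt (JetModel V l →L[ℝ] ℝ) (CotFibre V π l) α.proj β).1, covCoord α.proj β) := by
  rw [FiberBundle.extChartAt, Jet.extChartAt_eq]
  rfl

theorem mem_extChartAt_cot_source {α β : Cot V π l}
    (h : β ∈ (extChartAt (cotModel V l) α).source) :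
    β.proj.base ∈ (Jet.someChart V π α.proj.base).chart.source ∧
      extChartAt (cotModel V l) α β =
        (Jet.natHomeo l (Jet.someChart V π α.proj.base) β.proj, covCoord α.proj β) := by
  rw [FiberBundle.extChartAt, PartialEquiv.trans_source] at h
  have h1 := (trivializationAt (JetModel V l →L[ℝ] ℝ) (CotFibre V π l) α.proj).coe_fst h.1
  refine ⟨?_, by rw [extChartAt_cot_apply, h1]⟩
  have h2 := h.2.1
  rw [Jet.extChartAt_eq] at h2
  have h3 : ((trivializationAt (JetModel V l →L[ℝ] ℝ) (CotFibre V π l) α.proj) β).1 ∈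
      (Jet.natHomeo l (Jet.someChart V π α.proj.base)).source := h2
  rw [h1] at h3
  exact h3

/-- In coordinates `Θ` is `p dt + ∑ p^i dq_i`. It is linear in the point `z`, so its derivative is
constant and the coordinate expression of `Ω` follows at once. -/
theorem tautForm_inChart (α : Cot V π l) {z : JetModel V l × (JetModel V l →L[ℝ] ℝ)}
    (hz : z ∈ (extChartAt (cotModel V l) α).target) :
    (tautForm V π l).inChart (cotModel V l) α z =
      z.2.comp (ContinuousLinearMap.fst ℝ (JetModel V l) (JetModel V l →L[ℝ] ℝ)) := by
  set c := Jet.someChart V π α.proj.base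
  set σ := (extChartAt (cotModel V l) α).symm
  obtain ⟨hb, hco⟩ := mem_extChartAt_cot_source ((extChartAt (cotModel V l) α).map_target hz)
  rw [(extChartAt (cotModel V l) α).right_inv hz] at hco
  have hσ : MDifferentiableAt 𝓘(ℝ, JetModel V l × (JetModel V l →L[ℝ] ℝ)) (cotModel V l) σ z :=
    ((contMDiffOn_extChartAt_symm (n := 1) α).contMDiffAt
      ((isOpen_extChartAt_target α).mem_nhds hz)).mdifferentiableAt (by simp)
  have hp : MDifferentiableAt (cotModel V l) (jetModel V l)
      (Bundle.TotalSpace.proj (F := JetModel V l →L[ℝ] ℝ) (E := CotFibre V π l)) (σ z) :=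
    (Bundle.contMDiffAt_proj (n := 1) (CotFibre V π l)).mdifferentiableAt (by simp)
  have h1 := ((Jet.hasMFDerivAt_natHomeo hb).comp _ hp.hasMFDerivAt).comp z hσ.hasMFDerivAt
  have h2 := (ContinuousLinearMap.fst ℝ (JetModel V l) (JetModel V l →L[ℝ] ℝ)).hasMFDerivAt (x := z)
  have h3 := h2.congr_of_eventuallyEq (f₁ := (Jet.natHomeo l c ∘ Bundle.TotalSpace.proj) ∘ σ) (by
    filter_upwards [(isOpen_extChartAt_target α).mem_nhds hz] with x hx
    have h := (mem_extChartAt_cot_source ((extChartAt (cotModel V l) α).map_target hx)).2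
    rw [(extChartAt (cotModel V l) α).right_inv hx] at h
    exact (congrArg Prod.fst h).symm)
  refine ContinuousLinearMap.ext fun w => ?_
  have h4 := congrArg (fun T => T w) (hasMFDerivAt_unique h1 h3)
  refine (covCoord_apply hb _).symm.trans ?_
  have h5 : covCoord α.proj (σ z) = z.2 := (congrArg Prod.snd hco).symm
  rw [h5]
  exact congrArg z.2 h4

/-- A tangent vector of the cotangent bundle in the coordinates at its base point. -/
abbrev cotVec {α : Cot V π l} (u : TangentSpace (cotModel V l) α) :
    JetModel V l × (JetModel V l →L[ℝ] ℝ) := u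

/-- The canonical two-form in the coordinates at a point. -/
theorem canonicalForm_apply (α : Cot V π l) (u v : TangentSpace (cotModel V l) α) :
    canonicalForm V π l α u v =
      (cotVec v).2 (cotVec u).1 - (cotVec u).2 (cotVec v).1 := by
  set T : JetModel V l × (JetModel V l →L[ℝ] ℝ) →L[ℝ]
      (JetModel V l × (JetModel V l →L[ℝ] ℝ) →L[ℝ] ℝ) :=
    (ContinuousLinearMap.precomp ℝ
      (ContinuousLinearMap.fst ℝ (JetModel V l) (JetModel V l →L[ℝ] ℝ))).comp
      (ContinuousLinearMap.snd ℝ (JetModel V l) (JetModel V l →L[ℝ] ℝ))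
  have h1 : (tautForm V π l).inChart (cotModel V l) α =ᶠ[𝓝 (extChartAt (cotModel V l) α α)] T := by
    filter_upwards [(isOpen_extChartAt_target α).mem_nhds (mem_extChartAt_target α)] with z hz
    exact tautForm_inChart α hz
  have h2 : fderiv ℝ ((tautForm V π l).inChart (cotModel V l) α)
      (extChartAt (cotModel V l) α α) = T := by
    rw [h1.fderiv_eq]
    exact ContinuousLinearMap.fderiv (𝕜 := ℝ) (E := JetModel V l × (JetModel V l →L[ℝ] ℝ))
      (F := JetModel V l × (JetModel V l →L[ℝ] ℝ) →L[ℝ] ℝ) T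
  unfold canonicalForm OneForm.d
  simp only [h2, mfderiv_extChartAt_self]
  exact neg_sub _ _

/-! ### The unified bundle -/

namespace Unified

theorem contMDiff_rho1 : ContMDiff (uniModel V l) (jetModel V (2 * l + 1)) ∞
    (rho1 (V := V) (π := π) (l := l)) :=
  Bundle.contMDiff_proj _

theorem contMDiffAt_covCoord (w₀ : Unified V π l) :
    ContMDiffAt (uniModel V l) 𝓘(ℝ, JetModel V l →L[ℝ] ℝ) ∞
      (fun w : Unified V π l => covCoord (projMap V π l w₀.proj) (rho2 w)) w₀ :=
  (Bundle.contMDiffAt_totalSpace.1 (contMDiffAt_id (x := w₀) (n := ∞) (I := uniModel V l))).2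

theorem contMDiff_rho2 : ContMDiff (uniModel V l) (cotModel V l) ∞
    (rho2 (V := V) (π := π) (l := l)) := fun w =>
  Bundle.contMDiffAt_totalSpace.2
    ⟨((projMap V π l).contMDiff.comp contMDiff_rho1) w, contMDiffAt_covCoord w⟩

end Unified

theorem hasDerivAt_line {X : Type*} [NormedAddCommGroup X] [NormedSpace ℝ X] (a b : X) :
    HasDerivAt (fun e : ℝ => a + e • b) b 0 := by
  have : HasDerivAt (fun e : ℝ => e • b) ((1 : ℝ) • b) 0 := (hasDerivAt_id _).smul_const _
  rw [one_smul] at this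
  exact this.const_add a

namespace Unified

/-- The model vector space of `W`. -/
abbrev Model (V : Type*) [NormedAddCommGroup V] [NormedSpace ℝ V] (l : ℕ) : Type _ :=
  JetModel V (2 * l + 1) × (JetModel V l →L[ℝ] ℝ)

/-- A tangent vector of `W` in the coordinates at its base point. -/
abbrev vec {w : Unified V π l} (v : TangentSpace (uniModel V l) w) : Model V l := v

/-- The tangent vector of `W` at `w` which is vertical over `J^{2l+1} π` and has the fibre
component `b`. -/
def vertVec (w : Unified V π l) (b : JetModel V l →L[ℝ] ℝ) : TangentSpace (uniModel V l) w :=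
  ((0, b) : Model V l)

/-- `W` is a pull-back bundle, so its fibre coordinate at `w₀` is the covector coordinate at the
projection of `w₀` to `J^l π`. -/
theorem extChartAt_apply {w₀ w : Unified V π l}
    (h : w ∈ (extChartAt (uniModel V l) w₀).source) :
    extChartAt (uniModel V l) w₀ w =
      (Jet.natHomeo (2 * l + 1) (Jet.someChart V π w₀.proj.base) w.proj,
        covCoord (projMap V π l w₀.proj) (rho2 w)) := by
  rw [FiberBundle.extChartAt, PartialEquiv.trans_source] at h
  have h1 := (trivializationAt (JetModel V l →L[ℝ] ℝ)
    (Bundle.Pullback (projMap V π l) (CotFibre V π l)) w₀.proj).coe_fst h.1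
  rw [FiberBundle.extChartAt, Jet.extChartAt_eq]
  exact congrArg (fun q => (Jet.natHomeo (2 * l + 1) (Jet.someChart V π w₀.proj.base) q,
    covCoord (projMap V π l w₀.proj) (rho2 w))) h1

theorem hasMFDerivAt_coord (w : Unified V π l) :
    HasMFDerivAt (uniModel V l) 𝓘(ℝ, Model V l)
      (fun w' => ((Jet.natHomeo (2 * l + 1) (Jet.someChart V π w.proj.base) w'.proj,
        covCoord (projMap V π l w.proj) (rho2 w')) : Model V l)) w
      (ContinuousLinearMap.id ℝ (Model V l)) := by
  have h : HasMFDerivAt (uniModel V l) 𝓘(ℝ, Model V l) (extChartAt (uniModel V l) w) w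
      (mfderiv (uniModel V l) 𝓘(ℝ, Model V l) (extChartAt (uniModel V l) w) w) :=
    (mdifferentiableAt_extChartAt (mem_chart_source _ w)).hasMFDerivAt
  rw [mfderiv_extChartAt_self] at h
  refine h.congr_of_eventuallyEq ?_
  filter_upwards [extChartAt_source_mem_nhds (I := uniModel V l) w] with x hx
  exact (extChartAt_apply hx).symm

/-- The preferred charts at `w` and at `ρ_1(w)` come from the same adapted chart; both tangent
spaces are read in it, and `Tρ_1` is literally the first projection. -/
theorem hasMFDerivAt_rho1 (w : Unified V π l) :
    HasMFDerivAt (uniModel V l) (jetModel V (2 * l + 1)) rho1 w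
      (ContinuousLinearMap.fst ℝ (JetModel V (2 * l + 1)) (JetModel V l →L[ℝ] ℝ)) := by
  have h1 := ((contMDiff_rho1 w).mdifferentiableAt (by simp)).hasMFDerivAt
  have h2 := (Jet.hasMFDerivAt_natHomeo (y := rho1 w) (c := Jet.someChart V π w.proj.base)
    (Jet.mem_someChart_source _)).comp w h1
  have h3 := (ContinuousLinearMap.fst ℝ (JetModel V (2 * l + 1))
    (JetModel V l →L[ℝ] ℝ)).hasMFDerivAt.comp w (hasMFDerivAt_coord w)
  have h4 := hasMFDerivAt_unique h2 h3
  refine h1.congr_mfderiv ?_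
  apply ContinuousLinearMap.ext
  intro v
  exact (Jet.vecCoord_someChart _ _).symm.trans (congrArg (fun T => T v) h4)

theorem mfderiv_rho1 (w : Unified V π l) (v : TangentSpace (uniModel V l) w) :
    mfderiv (uniModel V l) (jetModel V (2 * l + 1)) rho1 w v = (vec v).1 := by
  rw [(hasMFDerivAt_rho1 w).mfderiv]
  rfl

theorem _root_.JetMech.hasMFDerivAt_cotCoord (α : Cot V π l) :
    HasMFDerivAt (cotModel V l) 𝓘(ℝ, JetModel V l × (JetModel V l →L[ℝ] ℝ))
      (fun β => ((Jet.natHomeo l (Jet.someChart V π α.proj.base) β.proj,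
        covCoord α.proj β) : JetModel V l × (JetModel V l →L[ℝ] ℝ))) α
      (ContinuousLinearMap.id ℝ (JetModel V l × (JetModel V l →L[ℝ] ℝ))) := by
  have h : HasMFDerivAt (cotModel V l) 𝓘(ℝ, JetModel V l × (JetModel V l →L[ℝ] ℝ))
      (extChartAt (cotModel V l) α) α
      (mfderiv (cotModel V l) 𝓘(ℝ, JetModel V l × (JetModel V l →L[ℝ] ℝ))
        (extChartAt (cotModel V l) α) α) :=
    (mdifferentiableAt_extChartAt (mem_chart_source _ α)).hasMFDerivAt
  rw [mfderiv_extChartAt_self] at h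
  refine h.congr_of_eventuallyEq ?_
  filter_upwards [extChartAt_source_mem_nhds (I := cotModel V l) α] with x hx
  exact (mem_extChartAt_cot_source hx).2.symm

theorem mfderiv_rho2 (w : Unified V π l) (v : TangentSpace (uniModel V l) w) :
    mfderiv (uniModel V l) (cotModel V l) rho2 w v =
      (trunc V (by omega) (vec v).1, (vec v).2) := by
  have h1 := ((contMDiff_rho2 w).mdifferentiableAt (by simp)).hasMFDerivAt
  have h2 := (hasMFDerivAt_cotCoord (rho2 w)).comp w h1
  set T : Model V l →L[ℝ] JetModel V l × (JetModel V l →L[ℝ] ℝ) :=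
    (trunc V (show l ≤ 2 * l + 1 by omega)).prodMap (ContinuousLinearMap.id ℝ (JetModel V l →L[ℝ] ℝ))
  have h3 := T.hasMFDerivAt.comp w (hasMFDerivAt_coord w)
  -- The adapted chart chosen at a jet depends only on its base point in `E`, so `w` and `rho2 w`
  -- use the same one.
  have hb : (rho2 w).proj.base = w.proj.base := Jet.base_proj (show l ≤ 2 * l + 1 by omega) _
  have h4 := h3.congr_of_eventuallyEq (f₁ := fun w' =>
      ((Jet.natHomeo l (Jet.someChart V π (rho2 w).proj.base) (rho2 w').proj,
        covCoord (rho2 w).proj (rho2 w')) : JetModel V l × (JetModel V l →L[ℝ] ℝ))) (by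
    have hev := contMDiff_rho1.continuous.continuousAt.eventually (Jet.eventually_mem_source
      (y := rho1 w) (Jet.someChart V π w.proj.base) (Jet.mem_someChart_source _))
    filter_upwards [hev] with x hx
    rw [hb]
    exact Prod.ext (Jet.natHomeo_proj (show l ≤ 2 * l + 1 by omega) _ hx) rfl)
  exact congrArg (fun S => S v) (hasMFDerivAt_unique h2 h4)

/-- The two-form on `W` in the coordinates at a point. -/
theorem form_apply (w : Unified V π l) (u v : TangentSpace (uniModel V l) w) :
    form V π l w u v =
      (vec v).2 (trunc V (by omega) (vec u).1) -
      (vec u).2 (trunc V (by omega) (vec v).1) := by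
  unfold form TwoForm.pullback
  rw [canonicalForm_apply, mfderiv_rho2, mfderiv_rho2]

theorem coupling_eq {w₀ w : Unified V π l}
    (h : w.proj.base ∈ (Jet.someChart V π w₀.proj.base).chart.source) :
    w.coupling = covCoord (projMap V π l w₀.proj) (rho2 w)
      (shift (by omega) (Jet.natHomeo (2 * l + 1) (Jet.someChart V π w₀.proj.base) w.proj)) := by
  have hb : (projMap V π l w₀.proj).base = w₀.proj.base := Jet.base_proj (show l ≤ 2 * l + 1 by omega) _
  have hb' : (rho2 w).proj.base = w.proj.base := Jet.base_proj (show l ≤ 2 * l + 1 by omega) _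
  have h1 := covCoord_apply (q₀ := projMap V π l w₀.proj) (α := rho2 w) (by rwa [hb, hb'])
    (holonomicLift (show l ≤ 2 * l + 1 by omega) w.proj)
  refine h1.symm.trans ?_
  rw [hb]
  exact congrArg _ (Jet.vecCoord_holonomicLift (show l < 2 * l + 1 by omega) h)

/-- The constraint function in coordinates. -/
def constraintCoord (c : AdaptedChart V π) (L : Jet V π (l + 1) → ℝ) (x : Model V l) : ℝ :=
  x.2 (shift (by omega) x.1) - L ((Jet.natHomeo (l + 1) c).symm (trunc V (by omega) x.1))

theorem constraint_eq (L : Jet V π (l + 1) → ℝ) {w₀ w : Unified V π l}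
    (h : w.proj.base ∈ (Jet.someChart V π w₀.proj.base).chart.source) :
    constraint L w = constraintCoord (Jet.someChart V π w₀.proj.base) L
      (Jet.natHomeo (2 * l + 1) (Jet.someChart V π w₀.proj.base) w.proj,
        covCoord (projMap V π l w₀.proj) (rho2 w)) := by
  rw [constraint, constraintCoord, coupling_eq h]
  dsimp only
  have hle : l + 1 ≤ 2 * l + 1 := by omega
  rw [← Jet.natHomeo_proj hle _ h]
  congr 2
  refine ((Jet.natHomeo (l + 1) (Jet.someChart V π w₀.proj.base)).left_inv ?_).symm
  rw [Jet.mem_natHomeo_source, Jet.base_proj]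
  exact h

theorem contDiffAt_constraintCoord {L : Jet V π (l + 1) → ℝ}
    (hL : ContMDiff (jetModel V (l + 1)) 𝓘(ℝ, ℝ) ∞ L) (c : AdaptedChart V π) {x : Model V l}
    (hx : x.1 ∈ (Jet.natHomeo (2 * l + 1) c).target) :
    ContDiffAt ℝ ∞ (constraintCoord c L) x := by
  unfold constraintCoord
  refine (contDiffAt_snd.clm_apply ((contDiff_shift _).contDiffAt.comp x contDiffAt_fst)).sub ?_
  have h1 : SmoothIn c L := .of_contMDiff hL
  have h2 : ContDiffAt ℝ ∞ (fun z => L ((Jet.natHomeo (l + 1) c).symm z))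
      (trunc V (show l + 1 ≤ 2 * l + 1 by omega) x.1) :=
    ContDiffOn.contDiffAt h1 ((Jet.natHomeo (l + 1) c).open_target.mem_nhds hx)
  exact ContDiffAt.comp (g := fun z => L ((Jet.natHomeo (l + 1) c).symm z)) x h2
    ((trunc V (show l + 1 ≤ 2 * l + 1 by omega)).contDiff.contDiffAt.comp x contDiffAt_fst)

theorem eventually_mem_source (w : Unified V π l) :
    ∀ᶠ w' in 𝓝 w, w'.proj.base ∈ (Jet.someChart V π w.proj.base).chart.source :=
  contMDiff_rho1.continuous.continuousAt.eventually (Jet.eventually_mem_source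
    (y := rho1 w) (Jet.someChart V π w.proj.base) (Jet.mem_someChart_source _))

/-- Along the fibres the constraint is affine: `Ĉ` is linear in the covector and `L̂` does not see
it. The vertical part of the differential is all that has to be explicit. -/
theorem hasMFDerivAt_constraint {L : Jet V π (l + 1) → ℝ}
    (hL : ContMDiff (jetModel V (l + 1)) 𝓘(ℝ, ℝ) ∞ L) (w : Unified V π l) :
    ∃ T : Model V l →L[ℝ] ℝ, HasMFDerivAt (uniModel V l) 𝓘(ℝ, ℝ) (constraint L) w T ∧
      ∀ b, T (0, b) = b (shift (by omega)
        (Jet.natHomeo (2 * l + 1) (Jet.someChart V π w.proj.base) w.proj)) := by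
  have hmem := Jet.mem_someChart_source (V := V) (π := π) w.proj.base
  set c := Jet.someChart V π w.proj.base
  set x := Jet.natHomeo (2 * l + 1) c w.proj
  set a := covCoord (projMap V π l w.proj) (rho2 w)
  have h1 := ((contDiffAt_constraintCoord hL c (x := (x, a))
    ((Jet.natHomeo (2 * l + 1) c).map_source hmem)).differentiableAt (by simp)).hasFDerivAt
  refine ⟨_, (h1.hasMFDerivAt.comp w (hasMFDerivAt_coord w)).congr_of_eventuallyEq ?_,
    fun b => ?_⟩
  · filter_upwards [eventually_mem_source w] with w' hw'
    exact constraint_eq L hw'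
  · have h2 := hasDerivAt_line ((x, a) : Model V l) (0, b)
    have h3 : ((x, a) : Model V l) + (0 : ℝ) • ((0, b) : Model V l) = (x, a) := by simp
    rw [← h3] at h1
    have h4 := h1.comp_hasDerivAt (0 : ℝ) h2
    rw [h3] at h4
    refine h4.unique ?_
    have h5 : constraintCoord c L ∘ (fun e : ℝ => ((x, a) : Model V l) + e • ((0, b) : Model V l)) =
        fun e => constraintCoord c L (x, a) + e • b (shift (by omega) x) := by
      funext e
      simp [constraintCoord]
      ring
    rw [h5]
    exact hasDerivAt_line _ _

theorem isTangentWo_iff {L : Jet V π (l + 1) → ℝ} {w : Unified V π l}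
    {v : TangentSpace (uniModel V l) w} :
    IsTangentWo L w v ↔ (mfderiv (uniModel V l) 𝓘(ℝ, ℝ) (constraint L) w v : ℝ) = 0 := Iff.rfl

/-- Vectors of `W` which are vertical over `J^{2l+1} π` are tangent to `W_o` if and only if they
vanish on the holonomic lift. -/
theorem isTangentWo_vertical {L : Jet V π (l + 1) → ℝ}
    (hL : ContMDiff (jetModel V (l + 1)) 𝓘(ℝ, ℝ) ∞ L) (w : Unified V π l)
    (b : JetModel V l →L[ℝ] ℝ) :
    IsTangentWo L w (vertVec w b) ↔
      b (shift (by omega) (Jet.natHomeo (2 * l + 1) (Jet.someChart V π w.proj.base) w.proj)) = 0 := by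
  obtain ⟨T, hT, hTb⟩ := hasMFDerivAt_constraint hL w
  rw [isTangentWo_iff, hT.mfderiv, ← hTb b]
  rfl

end Unified

/-! ### The graph of the extended Legendre-Ostrogradsky map -/

section Graph

variable {L : Jet V π (l + 1) → ℝ}

open Unified

/-- On the left the covector at `y` is built with the chart chosen at `y`; on the right the chart of
`y₀` is fixed. This form of chart independence yields smoothness of the graph and the derivative of
its fibre component. -/
theorem covCoord_legendreExt (hL : ContMDiff (jetModel V (l + 1)) 𝓘(ℝ, ℝ) ∞ L)
    {y₀ y : Jet V π (2 * l + 1)} (h : y.base ∈ (Jet.someChart V π y₀.base).chart.source) :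
    covCoord (projMap V π l y₀) (legendreExt L y) =
      legendreCoord (Jet.someChart V π y₀.base) L y := by
  have hle : l ≤ 2 * l + 1 := by omega
  have hb : (projMap V π l y₀).base = y₀.base := Jet.base_proj hle _
  have hb' : (legendreExt L y).proj.base = y.base := Jet.base_proj hle _
  have hmem : (legendreExt L y).proj.base ∈ (Jet.someChart V π y₀.base).chart.source := by
    rwa [hb']
  refine ContinuousLinearMap.ext fun x => ?_
  obtain ⟨v, rfl⟩ := (Jet.vecCoord_bijective hmem).2 x
  have h1 := covCoord_apply (q₀ := projMap V π l y₀) (α := legendreExt L y) (by rwa [hb]) v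
  rw [hb] at h1
  exact h1.trans (legendreCovector_apply hL h v)

theorem contMDiff_legendreGraph (hL : ContMDiff (jetModel V (l + 1)) 𝓘(ℝ, ℝ) ∞ L) :
    ContMDiff (jetModel V (2 * l + 1)) (uniModel V l) ∞ (legendreGraph L) := by
  intro y₀
  refine Bundle.contMDiffAt_totalSpace.2 ⟨contMDiffAt_id, ?_⟩
  have hmem := Jet.mem_someChart_source (V := V) (π := π) y₀.base
  refine ((contDiffOn_legendreCoord hL _).contMDiffAt hmem).congr_of_eventuallyEq ?_
  filter_upwards [Jet.eventually_mem_source _ hmem] with y hy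
  exact covCoord_legendreExt hL hy

theorem hasMFDerivAt_legendreGraph (hL : ContMDiff (jetModel V (l + 1)) 𝓘(ℝ, ℝ) ∞ L)
    (y : Jet V π (2 * l + 1)) :
    HasMFDerivAt (jetModel V (2 * l + 1)) (uniModel V l) (legendreGraph L) y
      (mfderiv (jetModel V (2 * l + 1)) (uniModel V l) (legendreGraph L) y) :=
  ((contMDiff_legendreGraph hL y).mdifferentiableAt (by simp)).hasMFDerivAt

/-- The tangent map of the graph of the extended Legendre-Ostrogradsky map. -/
def graphVec (L : Jet V π (l + 1) → ℝ) (y : Jet V π (2 * l + 1))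
    (u : TangentSpace (jetModel V (2 * l + 1)) y) :
    TangentSpace (uniModel V l) (legendreGraph L y) :=
  mfderiv (jetModel V (2 * l + 1)) (uniModel V l) (legendreGraph L) y u

theorem graphVec_fst (hL : ContMDiff (jetModel V (l + 1)) 𝓘(ℝ, ℝ) ∞ L)
    (y : Jet V π (2 * l + 1)) (u : TangentSpace (jetModel V (2 * l + 1)) y) :
    (vec (graphVec L y u)).1 = u := by
  have h1 := (hasMFDerivAt_rho1 (legendreGraph L y)).comp y (hasMFDerivAt_legendreGraph hL y)
  exact congrArg (fun T => T u) (hasMFDerivAt_unique h1 (hasMFDerivAt_id y))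

theorem mfderiv_rho1_graphVec (hL : ContMDiff (jetModel V (l + 1)) 𝓘(ℝ, ℝ) ∞ L)
    (y : Jet V π (2 * l + 1)) (u : TangentSpace (jetModel V (2 * l + 1)) y) :
    mfderiv (uniModel V l) (jetModel V (2 * l + 1)) rho1 (legendreGraph L y) (graphVec L y u) =
      u := by
  rw [mfderiv_rho1]
  exact graphVec_fst hL y u

theorem constraint_legendreGraph (hL : ContMDiff (jetModel V (l + 1)) 𝓘(ℝ, ℝ) ∞ L)
    (y : Jet V π (2 * l + 1)) : constraint L (legendreGraph L y) = 0 :=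
  sub_eq_zero.2 (legendreCovector_holonomicLift hL y)

/-- The constraint vanishes identically along the graph, so its derivative in the direction of a
graph vector is zero. -/
theorem isTangentWo_graphVec (hL : ContMDiff (jetModel V (l + 1)) 𝓘(ℝ, ℝ) ∞ L)
    (y : Jet V π (2 * l + 1)) (u : TangentSpace (jetModel V (2 * l + 1)) y) :
    IsTangentWo L (legendreGraph L y) (graphVec L y u) := by
  obtain ⟨T, hT, -⟩ := hasMFDerivAt_constraint hL (legendreGraph L y)
  have h1 := (hT.comp y (hasMFDerivAt_legendreGraph hL y)).congr_of_eventuallyEq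
    (f₁ := fun _ => (0 : ℝ))
    (Filter.Eventually.of_forall fun y => (constraint_legendreGraph hL y).symm)
  rw [isTangentWo_iff, hT.mfderiv]
  exact congrArg (fun T => T u) (hasMFDerivAt_unique h1 (hasMFDerivAt_const _ _))

theorem mfderiv_legendreExt (hL : ContMDiff (jetModel V (l + 1)) 𝓘(ℝ, ℝ) ∞ L)
    (y : Jet V π (2 * l + 1)) :
    mfderiv (jetModel V (2 * l + 1)) (cotModel V l) (legendreExt L) y =
    (mfderiv (uniModel V l) (cotModel V l) rho2 (legendreGraph L y)).comp
      (mfderiv (jetModel V (2 * l + 1)) (uniModel V l) (legendreGraph L) y) :=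
  (((contMDiff_rho2 (legendreGraph L y)).mdifferentiableAt (by simp)).hasMFDerivAt.comp y
    (hasMFDerivAt_legendreGraph hL y)).mfderiv

/-- The extended Legendre map is `ρ_2` composed with the graph map, so `Ω_L` is the pull-back of `Ω`
by the graph map. -/
theorem poincareCartan_eq (hL : ContMDiff (jetModel V (l + 1)) 𝓘(ℝ, ℝ) ∞ L)
    (y : Jet V π (2 * l + 1)) (u v : TangentSpace (jetModel V (2 * l + 1)) y) :
    poincareCartan L y u v = form V π l (legendreGraph L y) (graphVec L y u) (graphVec L y v) := by
  unfold poincareCartan form TwoForm.pullback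
  rw [mfderiv_legendreExt hL]
  rfl

/-- Tangent vectors of `W` along `W_1` split into a vector tangent to `W_1` and a vertical one. -/
theorem exists_eq_graphVec_add (hL : ContMDiff (jetModel V (l + 1)) 𝓘(ℝ, ℝ) ∞ L)
    (y : Jet V π (2 * l + 1)) (v : TangentSpace (uniModel V l) (legendreGraph L y)) :
    ∃ (u : TangentSpace (jetModel V (2 * l + 1)) y) (b : JetModel V l →L[ℝ] ℝ),
      (vec v).1 = u ∧ v = graphVec L y u + vertVec (legendreGraph L y) b := by
  let u : TangentSpace (jetModel V (2 * l + 1)) y := (vec v).1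
  refine ⟨u, (vec v).2 - (vec (graphVec L y u)).2, rfl, Prod.ext ?_ ?_⟩
  · exact (graphVec_fst hL y u).symm.trans (add_zero (vec (graphVec L y u)).1).symm
  · exact (add_sub_cancel (vec (graphVec L y u)).2 (vec v).2).symm

/-! ### Linear algebra of `Ω` at the points of `W_1` -/

theorem form_add_left (w : Unified V π l) (u u' v : TangentSpace (uniModel V l) w) :
    form V π l w (u + u') v = form V π l w u v + form V π l w u' v := by
  simp only [form_apply]
  change (vec v).2 (trunc V _ ((vec u).1 + (vec u').1)) - ((vec u).2 + (vec u').2) _ = _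
  simp only [map_add, add_apply]
  ring

theorem form_add_right (w : Unified V π l) (u v v' : TangentSpace (uniModel V l) w) :
    form V π l w u (v + v') = form V π l w u v + form V π l w u v' := by
  simp only [form_apply]
  change ((vec v).2 + (vec v').2) _ - (vec u).2 (trunc V _ ((vec v).1 + (vec v').1)) = _
  simp only [map_add, add_apply]
  ring

theorem form_vertVec_right (w : Unified V π l) (u : TangentSpace (uniModel V l) w)
    (b : JetModel V l →L[ℝ] ℝ) :
    form V π l w u (vertVec w b) = b (trunc V (by omega) (vec u).1) := by
  rw [form_apply]
  change b _ - (vec u).2 (trunc V _ 0) = _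
  rw [map_zero, map_zero, sub_zero]

theorem form_vertVec_left (w : Unified V π l) (v : TangentSpace (uniModel V l) w)
    (b : JetModel V l →L[ℝ] ℝ) :
    form V π l w (vertVec w b) v = -b (trunc V (by omega) (vec v).1) := by
  rw [form_apply]
  change (vec v).2 (trunc V _ 0) - b _ = _
  rw [map_zero, map_zero, zero_sub]

theorem isTangentWo_add {w : Unified V π l} {v v' : TangentSpace (uniModel V l) w}
    (h : IsTangentWo L w v) : IsTangentWo L w (v + v') ↔ IsTangentWo L w v' := by
  simp only [isTangentWo_iff] at h ⊢
  rw [map_add, h]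
  exact Eq.congr_left (zero_add _)

theorem mfderiv_rhoR (w : Unified V π l) (v : TangentSpace (uniModel V l) w) :
    (mfderiv (uniModel V l) 𝓘(ℝ, ℝ) rhoR w v : ℝ) = (vec v).1.1 := by
  have h1 := ((Jet.contMDiff_time (V := V) (π := π) (rho1 w)).mdifferentiableAt
    (by simp)).hasMFDerivAt.comp w (hasMFDerivAt_rho1 w)
  have h2 : mfderiv (uniModel V l) 𝓘(ℝ, ℝ) rhoR w = _ := h1.mfderiv
  rw [h2]
  refine (Jet.dTime_apply (Jet.mem_someChart_source (rho1 w).base) (vec v).1).trans ?_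
  exact congrArg Prod.fst (Jet.vecCoord_someChart _ _)

theorem dTime_eq (y : Jet V π m) (u : TangentSpace (jetModel V m) y) :
    dTime V π m y u = (show JetModel V m from u).1 := by
  rw [Jet.dTime_apply (Jet.mem_someChart_source y.base), Jet.vecCoord_someChart]

/-- For type `l + 1` on `J^{2l+1} π` the condition concerns the projection to `J^l π`, the very
space whose covectors enter `W`. This coincidence of orders links the form `Ω` with semisprays of
type `k`. -/
theorem isSemisprayVector_last_iff (y : Jet V π (2 * l + 1))
    (u : TangentSpace (jetModel V (2 * l + 1)) y) :
    IsSemisprayVector (l + 1) y u ↔ trunc V (show l ≤ 2 * l + 1 by omega) u =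
      (show JetModel V (2 * l + 1) from u).1 • shift (show l < 2 * l + 1 by omega)
        (Jet.natHomeo (2 * l + 1) (Jet.someChart V π y.base) y) := by
  rw [Jet.isSemisprayVector_iff ⟨by omega, by omega⟩ (Jet.mem_someChart_source y.base),
    Jet.vecCoord_someChart]
  constructor
  · intro h
    refine Prod.ext ?_ (funext fun i => h i (by omega))
    exact (mul_one (show JetModel V (2 * l + 1) from u).1).symm
  · intro h i hi
    exact congrFun (congrArg Prod.snd h) ⟨i, by omega⟩

/-- Solutions of the dynamical equation on `W_o` are semisprays of type `k`. -/
theorem isSemisprayVector_of_form (hL : ContMDiff (jetModel V (l + 1)) 𝓘(ℝ, ℝ) ∞ L)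
    (w : Unified V π l) (u : TangentSpace (uniModel V l) w)
    (h : ∀ v, IsTangentWo L w v → form V π l w u v = 0) :
    IsSemisprayVector (l + 1) w.rho1
      (mfderiv (uniModel V l) (jetModel V (2 * l + 1)) rho1 w u) := by
  rw [isSemisprayVector_last_iff, mfderiv_rho1]
  set s := shift (show l < 2 * l + 1 by omega)
    (Jet.natHomeo (2 * l + 1) (Jet.someChart V π w.rho1.base) w.rho1)
  change trunc V _ (vec u).1 = (vec u).1.1 • s
  refine sub_eq_zero.1 (SeparatingDual.eq_zero_of_forall_dual_eq_zero (R := ℝ) fun b => ?_)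
  -- Since `dt s = 1`, subtracting `b s • dt` from an arbitrary functional `b` makes it vanish on
  -- `s`, hence an admissible vertical test vector. The dual separates points, so testing against
  -- every `b` suffices.
  set dt := ContinuousLinearMap.fst ℝ ℝ (Fin (l + 1) → V)
  have hs : (b - b s • dt) s = 0 := by
    have : dt s = 1 := rfl
    simp [this]
  have h1 := h (vertVec w (b - b s • dt)) ((isTangentWo_vertical hL w _).2 hs)
  rw [form_vertVec_right] at h1
  have h2 : dt (trunc V (show l ≤ 2 * l + 1 by omega) (vec u).1) = (vec u).1.1 := rfl
  rw [sub_apply, smul_apply, h2, smul_eq_mul] at h1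
  rw [map_sub, map_smul, smul_eq_mul]
  linarith

/-- Vectors tangent to `W_1` which lift solutions of the Poincaré-Cartan equation solve the
equation on `W_o`. -/
theorem form_graphVec_eq_zero (hL : ContMDiff (jetModel V (l + 1)) 𝓘(ℝ, ℝ) ∞ L)
    (y : Jet V π (2 * l + 1)) {u : TangentSpace (jetModel V (2 * l + 1)) y}
    (hs : IsSemisprayVector (l + 1) y u) (hu : ∀ v, poincareCartan L y u v = 0)
    (v : TangentSpace (uniModel V l) (legendreGraph L y))
    (hv : IsTangentWo L (legendreGraph L y) v) :
    form V π l (legendreGraph L y) (graphVec L y u) v = 0 := by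
  -- The graph part of `v` contributes `Ω_L(u, u') = 0`. The vertical part contributes `b(tr u)`, a
  -- multiple of `b(h)` by the semispray condition, and `b(h) = 0` by tangency to `W_o`.
  obtain ⟨u', b, -, hb⟩ := exists_eq_graphVec_add hL y v
  rw [hb, isTangentWo_add (isTangentWo_graphVec hL y _), isTangentWo_vertical hL] at hv
  rw [hb, form_add_right, ← poincareCartan_eq hL, hu, form_vertVec_right, zero_add]
  refine (congrArg (fun z => b (trunc V _ z)) (graphVec_fst hL y u)).trans ?_
  refine (congrArg b ((isSemisprayVector_last_iff y u).1 hs)).trans ?_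
  rw [map_smul]
  exact (congrArg _ hv).trans (smul_zero _)

/-- A solution on `W_o` along `W_1` is determined by its projection to `J^{2l+1} π`. -/
theorem eq_graphVec_of_form (hL : ContMDiff (jetModel V (l + 1)) 𝓘(ℝ, ℝ) ∞ L)
    (y : Jet V π (2 * l + 1)) {u : TangentSpace (jetModel V (2 * l + 1)) y}
    (hs : IsSemisprayVector (l + 1) y u) (hu : ∀ v, poincareCartan L y u v = 0)
    (X : TangentSpace (uniModel V l) (legendreGraph L y))
    (hX : ∀ v, IsTangentWo L (legendreGraph L y) v → form V π l (legendreGraph L y) X v = 0)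
    (hXu : mfderiv (uniModel V l) (jetModel V (2 * l + 1)) rho1 (legendreGraph L y) X = u) :
    X = graphVec L y u := by
  rw [mfderiv_rho1] at hXu
  obtain ⟨u', b, hu', hb⟩ := exists_eq_graphVec_add hL y X
  obtain rfl : u' = u := hu'.symm.trans hXu
  have hb0 : b = 0 := by
    refine ContinuousLinearMap.ext fun x => ?_
    -- Truncation is onto: the missing coordinates are filled with zeros. Graph vectors thus test
    -- `b` on every vector.
    obtain ⟨z, hz⟩ : ∃ z : TangentSpace (jetModel V (2 * l + 1)) y,
        trunc V (show l ≤ 2 * l + 1 by omega) z = x := by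
      refine ⟨((x.1, fun i => if h : (i : ℕ) < l + 1 then x.2 ⟨i, h⟩ else 0) :
        JetModel V (2 * l + 1)), Prod.ext rfl ?_⟩
      funext i
      exact dif_pos i.2
    have h1 := hX (graphVec L y z) (isTangentWo_graphVec hL y z)
    have h2 := form_graphVec_eq_zero hL y hs hu (graphVec L y z) (isTangentWo_graphVec hL y z)
    rw [hb, form_add_left, h2, zero_add, form_vertVec_left, neg_eq_zero] at h1
    rw [← hz]
    exact (congrArg (fun z => b (trunc V _ z)) (graphVec_fst hL y z)).symm.trans h1
  rw [hb, hb0]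
  exact add_zero _

end Graph

/-! ### Integral sections of semisprays -/

section IntegralSections

variable {Y : JetField V π m} {ψ : ℝ → Jet V π m} {S : Set ℝ} {s : ℝ}

theorem hasDerivAt_jetModel_fst {x : ℝ → JetModel V m} {x' : JetModel V m}
    (h : HasDerivAt x x' s) : HasDerivAt (fun s => (x s).1) x'.1 s :=
  (ContinuousLinearMap.fst ℝ ℝ (Fin (m + 1) → V)).hasFDerivAt.comp_hasDerivAt s h

theorem hasDerivAt_jetModel_snd {x : ℝ → JetModel V m} {x' : JetModel V m}
    (h : HasDerivAt x x' s) (i : Fin (m + 1)) : HasDerivAt (fun s => (x s).2 i) (x'.2 i) s :=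
  hasDerivAt_pi.1 ((ContinuousLinearMap.snd ℝ ℝ (Fin (m + 1) → V)).hasFDerivAt.comp_hasDerivAt s h) i

theorem hasDerivAt_natHomeo_of_isMIntegralCurveOn {c : AdaptedChart V π}
    (hψ : IsMIntegralCurveOn ψ Y S) (hS : S ∈ 𝓝 s) (hc : (ψ s).base ∈ c.chart.source) :
    HasDerivAt (fun s => Jet.natHomeo m c (ψ s)) (Jet.vecCoord c (ψ s) (Y (ψ s))) s := by
  have h1 := (Jet.hasMFDerivAt_natHomeo hc).comp s ((hψ s (mem_of_mem_nhds hS)).hasMFDerivAt hS)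
  have h2 := hasMFDerivAt_iff_hasFDerivAt.1 h1
  have h3 := HasFDerivAt.hasDerivAt (𝕜 := ℝ) (F := JetModel V m) h2
  refine h3.congr_deriv ?_
  change Jet.vecCoord c (ψ s) ((1 : ℝ) • Y (ψ s)) = _
  rw [one_smul]

theorem eventually_base_mem {c : AdaptedChart V π} (hψ : IsMIntegralCurveOn ψ Y S) (hS : S ∈ 𝓝 s)
    (hc : (ψ s).base ∈ c.chart.source) : ∀ᶠ s in 𝓝 s, (ψ s).base ∈ c.chart.source :=
  (hψ.continuousWithinAt (mem_of_mem_nhds hS)).continuousAt hS |>.eventually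
    (Jet.eventually_mem_source c hc)

theorem iteratedDeriv_eq_of_hasDerivAt {G : Type*} [NormedAddCommGroup G] [NormedSpace ℝ G]
    {x : ℕ → ℝ → G} {n : ℕ} (h : ∀ i < n, ∀ᶠ s in 𝓝 s, HasDerivAt (x i) (x (i + 1) s) s) :
    ∀ i ≤ n, iteratedDeriv i (x 0) =ᶠ[𝓝 s] x i := by
  intro i hi
  induction i with
  | zero => rw [iteratedDeriv_zero]
  | succ i ih =>
    rw [iteratedDeriv_succ]
    filter_upwards [(ih (by omega)).deriv, h i (by omega)] with z hz hz'
    rw [hz, hz'.deriv]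

theorem isSectionAt_base (hS : S ∈ 𝓝 s)
    (hsm : ContMDiffOn 𝓘(ℝ, ℝ) (jetModel V m) ∞ ψ S) (ht : ∀ s ∈ S, (ψ s).time = s) :
    IsSectionAt V π (fun s => (ψ s).base) s := by
  filter_upwards [eventually_mem_nhds_iff.2 hS] with z hz
  refine ⟨(Jet.contMDiff_base _).comp z (hsm.contMDiffAt hz), ?_⟩
  exact (Jet.proj_base (V := V) (ψ z)).trans (ht z (mem_of_mem_nhds hz))

/-- For an integral section the factor `f` is `1`, and the semispray equations read `q_i' = q_{i+1}`
for `i ≤ m - r`. The coordinates up to order `m - r + 1` are then the successive derivatives of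
`q_0`. -/
theorem isHolonomicOn_of_isSemisprayVector (hr : 1 ≤ r ∧ r ≤ m) (hS : IsOpen S)
    (hsm : ContMDiffOn 𝓘(ℝ, ℝ) (jetModel V m) ∞ ψ S) (ht : ∀ s ∈ S, (ψ s).time = s)
    (hψ : IsMIntegralCurveOn ψ Y S) (hY : ∀ s ∈ S, IsSemisprayVector r (ψ s) (Y (ψ s))) :
    IsHolonomicOn r hr ψ S := by
  intro s hs
  have hsec := isSectionAt_base (hS.mem_nhds hs) hsm ht
  refine ⟨hsec, ?_⟩
  set c := Jet.someChart V π (ψ s).base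
  have hc : (ψ s).base ∈ c.chart.source := Jet.mem_someChart_source _
  have hev := (eventually_base_mem hψ (hS.mem_nhds hs) hc).and (hS.mem_nhds hs)
  set x : ℕ → ℝ → V := fun i s => if h : i < m + 1 then (Jet.natHomeo m c (ψ s)).2 ⟨i, h⟩ else 0
  have hx : ∀ i (h : i < m + 1), x i = fun s => (Jet.natHomeo m c (ψ s)).2 ⟨i, h⟩ := by
    intro i h
    funext s
    exact dif_pos h
  have h1 : ∀ i < m - r + 1, ∀ᶠ s in 𝓝 s, HasDerivAt (x i) (x (i + 1) s) s := by
    intro i hi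
    filter_upwards [hev, hev.eventually_nhds] with z ⟨hz, hzS⟩ hev
    have hd := hasDerivAt_natHomeo_of_isMIntegralCurveOn hψ (hS.mem_nhds hzS) hz
    -- The time coordinate of `ψ` is the parameter itself, so the time component of `Y` along `ψ` is
    -- `1`.
    have h0 : HasDerivAt (fun s : ℝ => s) (Jet.vecCoord c (ψ z) (Y (ψ z))).1 z := by
      refine (hasDerivAt_jetModel_fst hd).congr_of_eventuallyEq ?_
      filter_upwards [hev] with a ha
      rw [Jet.natHomeo_fst c ha.1, ht a ha.2]
    have h2 := (Jet.isSemisprayVector_iff hr hz _).1 (hY z hzS) i (by omega)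
    rw [h0.unique (hasDerivAt_id z), one_smul] at h2
    have h3 := hasDerivAt_jetModel_snd hd ⟨i, by omega⟩
    rw [h2] at h3
    rw [hx i (by omega), hx (i + 1) (by omega)]
    exact h3
  have h2 := iteratedDeriv_eq_of_hasDerivAt h1
  have h3 : (fun s => (c.chart (ψ s).base).2) =ᶠ[𝓝 s] x 0 := by
    filter_upwards [hev] with z hz
    rw [Jet.chart_base c hz.1, hx 0 (by omega)]
    rfl
  have hb : ((ψ s).proj (show m - r + 1 ≤ m by omega)).base ∈ c.chart.source := by
    rwa [Jet.base_proj]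
  refine (Jet.natHomeo (m - r + 1) c).injOn hc hb ?_
  rw [Jet.natHomeo_proj _ c hc]
  refine (Jet.natHomeo_mk c ⟨s, _, hsec⟩ hc).trans ?_
  refine Prod.ext ?_ (funext fun i => ?_)
  · exact ((Jet.natHomeo_fst c hc).trans (ht s hs)).symm
  · rw [trunc_snd]
    refine (h3.iteratedDeriv_eq i).trans ?_
    rw [(h2 i (by omega)).self_of_nhds, hx i (by omega)]

/-- The coordinate expression of a smooth vector field is smooth. -/
theorem contMDiffAt_vecCoord (hY : Y.IsSmooth) (y : Jet V π m) :
    ContMDiffAt (jetModel V m) (jetModel V m) ∞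
      (fun z => Jet.vecCoord (Jet.someChart V π y.base) z (Y z)) y := by
  refine ((Bundle.contMDiffAt_section y).1 (hY y)).congr_of_eventuallyEq ?_
  have hy : y.base ∈ (Jet.someChart V π y.base).chart.source := Jet.mem_someChart_source _
  filter_upwards [Jet.eventually_mem_source _ hy] with z hz
  have h1 := TangentBundle.continuousLinearMapAt_trivializationAt (I := jetModel V m)
    (x₀ := y) (x := z) hz
  rw [Jet.extChartAt_eq] at h1
  have h2 := (trivializationAt (JetModel V m) (TangentSpace (jetModel V m)) y).coe_linearMapAt_of_mem
    (R := ℝ) (b := z) hz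
  exact (congrArg (fun T => T (Y z)) h1).symm.trans (congrFun h2 (Y z))

/-- Bootstrapping: if `ψ` is `C^n`, then its derivative `Y ∘ ψ` is `C^n`, so `ψ` is `C^{n+1}`. This
is needed because semisprays are tested on smooth integral sections only. -/
theorem contMDiffOn_of_isMIntegralCurveOn (hY : Y.IsSmooth) (hS : IsOpen S)
    (hψ : IsMIntegralCurveOn ψ Y S) : ContMDiffOn 𝓘(ℝ, ℝ) (jetModel V m) ∞ ψ S := by
  have key : ∀ n : ℕ, ∀ s ∈ S, ContMDiffAt 𝓘(ℝ, ℝ) (jetModel V m) n ψ s := by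
    intro n
    induction n with
    | zero =>
      intro s hs
      set c := Jet.someChart V π (ψ s).base
      have hc : (ψ s).base ∈ c.chart.source := Jet.mem_someChart_source _
      have hev := (eventually_base_mem hψ (hS.mem_nhds hs) hc).and (hS.mem_nhds hs)
      refine Jet.contMDiffAt_of_natHomeo c (by simp) (hev.mono fun z hz => hz.1) ?_
      refine ContDiffAt.contMDiffAt (contDiffAt_zero.2 ⟨_, hev, fun z hz => ?_⟩)
      exact (hasDerivAt_natHomeo_of_isMIntegralCurveOn hψ (hS.mem_nhds hz.2)
        hz.1).continuousAt.continuousWithinAt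
    | succ n ih =>
      intro s hs
      set c := Jet.someChart V π (ψ s).base
      have hc : (ψ s).base ∈ c.chart.source := Jet.mem_someChart_source _
      have hev := (eventually_base_mem hψ (hS.mem_nhds hs) hc).and (hS.mem_nhds hs)
      refine Jet.contMDiffAt_of_natHomeo c (by exact_mod_cast le_top) (hev.mono fun z hz => hz.1) ?_
      refine ContDiffAt.contMDiffAt ?_
      refine contDiffAt_succ_iff_hasFDerivAt.2 ⟨fun z => (1 : ℝ →L[ℝ] ℝ).smulRight
        (Jet.vecCoord c (ψ z) (Y (ψ z))), ⟨_, hev, fun z hz => ?_⟩, ?_⟩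
      · exact (hasDerivAt_natHomeo_of_isMIntegralCurveOn hψ (hS.mem_nhds hz.2) hz.1).hasFDerivAt
      · have h1 := ((contMDiffAt_vecCoord hY (ψ s)).of_le (m := (n : ℕ∞ω))
          (by exact_mod_cast le_top)).comp s (ih s hs)
        exact contDiffAt_const.smulRight (contMDiffAt_iff_contDiffAt.1 h1)
  exact fun s hs => (contMDiffAt_infty.2 fun n => key n s hs).contMDiffWithinAt

theorem JetField.IsSemispray.of_isSemisprayOn (hr : 1 ≤ r ∧ r ≤ m)
    (hY : Y.IsSemisprayOn r Set.univ) : Y.IsSemispray r hr :=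
  fun _ _ _ hsm ht hψ => isHolonomicOn_of_isSemisprayVector hr isOpen_Ioo hsm ht hψ
    fun _ _ => hY _ trivial

/-- Through every point passes an integral curve, by completeness of `V`, and `dt(Y) = 1` makes it a
section. Holonomy says that its coordinates are derivatives of `q_0`; differentiating once more at
the starting time gives the coordinate form of `Y` there. -/
theorem JetField.IsSemispray.isSemisprayOn [CompleteSpace V] {hr : 1 ≤ r ∧ r ≤ m}
    (hs : Y.IsSemispray r hr) (hY : Y.IsSmooth) (hdt : ∀ y, dTime V π m y (Y y) = 1) :
    Y.IsSemisprayOn r Set.univ := by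
  intro y₀ _
  obtain ⟨ψ, h0, hψ⟩ := exists_isMIntegralCurveAt_of_contMDiffAt_boundaryless y₀.time
    ((hY y₀).of_le (m := 1) (by exact_mod_cast le_top))
  obtain ⟨ε, hε, hψ⟩ := isMIntegralCurveAt_iff'.1 hψ
  rw [Real.ball_eq_Ioo] at hψ
  set S := Set.Ioo (y₀.time - ε) (y₀.time + ε)
  have hS : IsOpen S := isOpen_Ioo
  have ht₀ : y₀.time ∈ S := ⟨by linarith, by linarith⟩
  have hsm := contMDiffOn_of_isMIntegralCurveOn hY hS hψ
  -- The difference of the two sides has derivative `dt(Y) - 1 = 0`, and it vanishes at the starting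
  -- parameter, which was chosen to be `y₀.time`.
  have ht : ∀ s ∈ S, (ψ s).time = s := by
    have h1 : ∀ s ∈ S, HasDerivAt (fun s => (ψ s).time - s) 0 s := by
      intro s hs
      set c := Jet.someChart V π (ψ s).base
      have hc : (ψ s).base ∈ c.chart.source := Jet.mem_someChart_source _
      have hd := hasDerivAt_jetModel_fst (hasDerivAt_natHomeo_of_isMIntegralCurveOn hψ (hS.mem_nhds hs) hc)
      rw [← Jet.dTime_apply hc, hdt] at hd
      have hd' : HasDerivAt (fun s => (ψ s).time) 1 s := by
        refine hd.congr_of_eventuallyEq ?_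
        filter_upwards [eventually_base_mem hψ (hS.mem_nhds hs) hc] with z hz
        rw [Jet.natHomeo_fst c hz]
      exact (hd'.sub (hasDerivAt_id s)).congr_deriv (sub_self 1)
    intro s hs
    have h2 := hS.is_const_of_deriv_eq_zero isPreconnected_Ioo
      (fun s hs => (h1 s hs).differentiableAt.differentiableWithinAt) (fun s hs => (h1 s hs).deriv)
      hs ht₀
    simp only [h0, sub_self] at h2
    linarith
  have hhol := hs ψ _ _ hsm ht hψ
  set c := Jet.someChart V π (ψ y₀.time).base
  have hc : (ψ y₀.time).base ∈ c.chart.source := Jet.mem_someChart_source _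
  have hev := (eventually_base_mem hψ (hS.mem_nhds ht₀) hc).and (hS.mem_nhds ht₀)
  have hd := hasDerivAt_natHomeo_of_isMIntegralCurveOn hψ (hS.mem_nhds ht₀) hc
  have hsec := isSectionAt_base (hS.mem_nhds ht₀) hsm ht
  set q : ℝ → V := fun s => (c.chart (ψ s).base).2
  have hq : ContDiffAt ℝ ∞ q y₀.time := PreJet.contDiffAt_curve ⟨y₀.time, _, hsec⟩ c hc
  have hco : ∀ i (h : i ≤ m - r + 1), (fun s => (Jet.natHomeo m c (ψ s)).2 ⟨i, by omega⟩)
      =ᶠ[𝓝 y₀.time] iteratedDeriv i q := by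
    intro i hi
    filter_upwards [hev] with z hz
    obtain ⟨h, hh⟩ := hhol z hz.2
    have h1 := congrArg (Jet.natHomeo _ c) hh
    rw [Jet.natHomeo_proj _ c hz.1] at h1
    have h2 := (Jet.natHomeo_mk c ⟨z, _, h⟩ hz.1).symm.trans h1
    exact (congrFun (congrArg Prod.snd h2) ⟨i, by omega⟩).symm
  suffices h : IsSemisprayVector r (ψ y₀.time) (Y (ψ y₀.time)) by rwa [h0] at h
  rw [Jet.isSemisprayVector_iff hr hc]
  intro i hi
  rw [← Jet.dTime_apply hc, hdt, one_smul]
  have h1 := (hasDerivAt_jetModel_snd hd ⟨i, by omega⟩).congr_of_eventuallyEq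
    (hco i (by omega)).symm
  exact (h1.unique (ContDiffAt.hasDerivAt_iteratedDeriv hq i)).trans
    (hco (i + 1) (by omega)).self_of_nhds.symm

/-- A larger type imposes fewer of the equations `X_i = f q_{i+1}`. -/
theorem IsSemisprayVector.mono {r' : ℕ} (hr : 1 ≤ r) (hrr : r ≤ r') (hr' : r' ≤ m)
    {y : Jet V π m} {u : TangentSpace (jetModel V m) y} (h : IsSemisprayVector r y u) :
    IsSemisprayVector r' y u := by
  have hy := Jet.mem_someChart_source (V := V) (π := π) y.base
  rw [Jet.isSemisprayVector_iff ⟨by omega, by omega⟩ hy] at h ⊢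
  exact fun i hi => h i (by omega)

end IntegralSections

/-! ### Derivatives of functions on jet bundles in natural coordinates -/

section LocalDeriv

variable {G : Type*} [NormedAddCommGroup G] [NormedSpace ℝ G] {c : AdaptedChart V π}

/-- The derivative of a function on `J^m π` in the natural chart induced by `c`. -/
def localDeriv (c : AdaptedChart V π) (f : Jet V π m → G) (y : Jet V π m) : JetModel V m →L[ℝ] G :=
  fderiv ℝ (fun x => f ((Jet.natHomeo m c).symm x)) (Jet.natHomeo m c y)

namespace SmoothIn

variable {f : Jet V π m → G}

theorem hasFDerivAt (hf : SmoothIn c f) {y : Jet V π m} (hy : y.base ∈ c.chart.source) :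
    HasFDerivAt (fun x => f ((Jet.natHomeo m c).symm x)) (localDeriv c f y)
      (Jet.natHomeo m c y) :=
  (hf.differentiableAt hy).hasFDerivAt

theorem hasMFDerivAt (hf : SmoothIn c f) {y : Jet V π m} (hy : y.base ∈ c.chart.source) :
    HasMFDerivAt (jetModel V m) 𝓘(ℝ, G) f y ((localDeriv c f y).comp (Jet.vecCoord c y)) := by
  have h1 := (hf.hasFDerivAt hy).hasMFDerivAt.comp y (Jet.hasMFDerivAt_natHomeo hy)
  refine h1.congr_of_eventuallyEq ?_
  filter_upwards [Jet.eventually_mem_source c hy] with z hz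
  exact (congrArg f ((Jet.natHomeo m c).left_inv hz)).symm

theorem localDeriv_comp_proj (h : r ≤ m) {f : Jet V π r → G} (hf : SmoothIn c f) {y : Jet V π m}
    (hy : y.base ∈ c.chart.source) :
    localDeriv c (fun y : Jet V π m => f (y.proj h)) y =
      (localDeriv c f (y.proj h)).comp (trunc V h) := by
  have hy' : (y.proj h).base ∈ c.chart.source := by rwa [Jet.base_proj]
  have h1 := hf.hasFDerivAt hy'
  rw [Jet.natHomeo_proj h c hy] at h1
  refine HasFDerivAt.fderiv ((h1.comp _ (trunc V h).hasFDerivAt).congr_of_eventuallyEq ?_)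
  filter_upwards [(Jet.natHomeo m c).open_target.mem_nhds ((Jet.natHomeo m c).map_source hy)]
    with x hx
  have hb := (Jet.natHomeo m c).map_target hx
  have hb' : (((Jet.natHomeo m c).symm x).proj h).base ∈ c.chart.source := by
    rwa [Jet.base_proj]
  refine congrArg f ?_
  rw [← (Jet.natHomeo r c).left_inv hb', Jet.natHomeo_proj h c hb,
    (Jet.natHomeo m c).right_inv hx]

/-- The highest partial derivative of a total derivative. -/
theorem localDeriv_totalDeriv_single (hf : SmoothIn c f) {y : Jet V π (m + 1)}
    (hy : y.base ∈ c.chart.source) (ξ : V) :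
    localDeriv c (JetMech.totalDeriv f) y (0, Pi.single (Fin.last (m + 1)) ξ) =
      localDeriv c f (y.proj m.le_succ) (0, Pi.single (Fin.last m) ξ) := by
  set x := Jet.natHomeo (m + 1) c y
  set e : JetModel V (m + 1) := (0, Pi.single (Fin.last (m + 1)) ξ)
  set D := fderiv ℝ (fun x => f ((Jet.natHomeo m c).symm x)) (trunc V m.le_succ x)
  have h1 := (hf.totalDeriv.hasFDerivAt hy).comp_hasDerivAt_of_eq (0 : ℝ)
    (hasDerivAt_line x e) (by simp [x])
  -- Moving only `q_{m+1}` leaves the truncation to `J^m π` fixed and moves the last slot of the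
  -- shift. Hence `d_T f = D(shift)` is affine in `ε`, with slope `∂f/∂q_m`. The line stays in the
  -- chart domain, which only restricts `t` and `q_0`.
  have h2 : HasDerivAt (fun ε : ℝ => D (shift m.lt_succ_self x) + ε • D (0, Pi.single (Fin.last m) ξ))
      (D (0, Pi.single (Fin.last m) ξ)) 0 := hasDerivAt_line _ _
  have hD : D = localDeriv c f (y.proj m.le_succ) := by
    rw [localDeriv, Jet.natHomeo_proj _ c hy]
  rw [← hD]
  refine h1.unique (h2.congr_of_eventuallyEq (Filter.Eventually.of_forall fun ε => ?_))
  have hx : x + ε • e ∈ (Jet.natHomeo (m + 1) c).target := by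
    have hx0 : x ∈ (Jet.natHomeo (m + 1) c).target := (Jet.natHomeo (m + 1) c).map_source hy
    rw [Jet.mem_natHomeo_target] at hx0 ⊢
    have h0 : (0 : Fin (m + 1 + 1)) ≠ Fin.last (m + 1) := (Fin.last_pos).ne
    simpa [e, Pi.single_eq_of_ne h0] using hx0
  change JetMech.totalDeriv f ((Jet.natHomeo (m + 1) c).symm (x + ε • e)) = _
  rw [hf.totalDeriv_eq ((Jet.natHomeo (m + 1) c).map_target hx),
    (Jet.natHomeo (m + 1) c).right_inv hx]
  have ht : trunc V m.le_succ (x + ε • e) = trunc V m.le_succ x := by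
    refine Prod.ext (by simp [e]) (funext fun i => ?_)
    have h0 : (⟨i, by omega⟩ : Fin (m + 1 + 1)) ≠ Fin.last (m + 1) :=
      fun h => by have := congrArg Fin.val h; simp at this; omega
    simp [e, Pi.single_eq_of_ne h0]
  have hs : shift m.lt_succ_self (x + ε • e) =
      shift m.lt_succ_self x + ε • ((0, Pi.single (Fin.last m) ξ) : JetModel V m) := by
    refine Prod.ext (by simp) (funext fun i => ?_)
    simp only [shift_snd, Prod.snd_add, Prod.smul_snd, Pi.add_apply, Pi.smul_apply, e]
    congr 2
    by_cases hi : i = Fin.last m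
    · subst hi
      rw [Pi.single_eq_same]
      exact Pi.single_eq_same _ _
    · rw [Pi.single_eq_of_ne hi, Pi.single_eq_of_ne]
      intro h
      exact hi (Fin.ext (by simpa using congrArg Fin.val h))
  rw [ht, hs, map_add, map_smul]

theorem localDeriv_iterTotalDeriv_single (hf : SmoothIn c f) (i : ℕ) {y : Jet V π (m + i)}
    (hy : y.base ∈ c.chart.source) (ξ : V) :
    localDeriv c (JetMech.iterTotalDeriv f i) y (0, Pi.single (Fin.last (m + i)) ξ) =
      localDeriv c f (y.proj (Nat.le_add_right m i)) (0, Pi.single (Fin.last m) ξ) := by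
  induction i with
  | zero =>
    have : y.proj (Nat.le_add_right m 0) = y := by
      obtain ⟨p, rfl⟩ := y.exists_mk
      rfl
    rw [this]
    rfl
  | succ i ih =>
    have hy' : (y.proj (Nat.le_succ (m + i))).base ∈ c.chart.source := by rwa [Jet.base_proj]
    have hp : (y.proj (Nat.le_succ (m + i))).proj (Nat.le_add_right m i) =
        y.proj (Nat.le_add_right m (i + 1)) := by
      obtain ⟨p, rfl⟩ := y.exists_mk
      rfl
    exact ((hf.iterTotalDeriv i).localDeriv_totalDeriv_single hy ξ).trans
      ((ih hy').trans (by rw [hp]))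

end SmoothIn

variable {L : Jet V π (l + 1) → ℝ}

/-- The derivatives of the momenta with respect to the highest coordinates on which they depend
are, up to sign, the derivatives of `∂L/∂q_{l+1}` with respect to `q_{l+1}`. -/
theorem localDeriv_momentum (hL : ContMDiff (jetModel V (l + 1)) 𝓘(ℝ, ℝ) ∞ L)
    {y : Jet V π (2 * l + 1)} (hy : y.base ∈ c.chart.source) {a : ℕ} {r : Fin (l + 1)}
    (ha : r + a = l) {u : JetModel V (2 * l + 1)} (hu : u.1 = 0)
    (hu' : ∀ i : Fin (2 * l + 1 + 1), i < l + 1 + a → u.2 i = 0) :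
    localDeriv c (momentum c L r) y u = (-1 : ℝ) ^ a •
      localDeriv c (lagPartial c L (Fin.last (l + 1))) (y.proj (by omega))
        (0, Pi.single (Fin.last (l + 1)) (u.2 ⟨l + 1 + a, by omega⟩)) := by
  have hterm : ∀ i : Fin (l + 1 - r), HasFDerivAt (fun x => (-1 : ℝ) ^ (i : ℕ) •
      iterTotalDeriv (lagPartial c L ⟨r + 1 + i, by omega⟩) i
        (((Jet.natHomeo (2 * l + 1) c).symm x).proj (show l + 1 + i ≤ 2 * l + 1 by omega)))
      ((-1 : ℝ) ^ (i : ℕ) • (localDeriv c (iterTotalDeriv (lagPartial c L ⟨r + 1 + i, by omega⟩) i)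
        (y.proj (by omega))).comp (trunc V (by omega))) (Jet.natHomeo (2 * l + 1) c y) := by
    intro i
    have h1 := (smoothIn_lagPartial (c := c) hL ⟨r + 1 + i, by omega⟩).iterTotalDeriv i
    have h2 := (h1.comp_proj (show l + 1 + i ≤ 2 * l + 1 by omega)).hasFDerivAt hy
    rw [h1.localDeriv_comp_proj _ hy] at h2
    exact HasFDerivAt.const_smul (F := V →L[ℝ] ℝ) h2 ((-1 : ℝ) ^ (i : ℕ))
  have h1 := HasFDerivAt.fun_sum (u := Finset.univ) fun i _ => hterm i
  have h2 : localDeriv c (momentum c L r) y = _ := h1.fderiv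
  -- The `i`-th term of the momentum lives on `J^{l+1+i} π`. For `i < a` the truncation of `u` to
  -- that order is zero, and since `r + a = l` the index `a` is the last one in the sum.
  rw [h2, sum_apply, Finset.sum_eq_single ⟨a, by omega⟩]
  · have ht : trunc V (show l + 1 + a ≤ 2 * l + 1 by omega) u =
        (0, Pi.single (Fin.last (l + 1 + a)) (u.2 ⟨l + 1 + a, by omega⟩)) := by
      refine Prod.ext hu (funext fun i => ?_)
      by_cases hi : i = Fin.last (l + 1 + a)
      · subst hi
        exact (Pi.single_eq_same (M := fun _ => V) _ _).symm
      · have hi' : (i : ℕ) < l + 1 + a :=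
          lt_of_le_of_ne (Nat.lt_succ_iff.1 i.2) fun h => hi (Fin.ext h)
        refine (hu' ⟨i, by omega⟩ hi').trans ?_
        exact (Pi.single_eq_of_ne (M := fun _ => V) hi _).symm
    have hlast : (⟨r + 1 + a, by omega⟩ : Fin (l + 1 + 1)) = Fin.last (l + 1) :=
      Fin.ext (by simp; omega)
    have hy' : (y.proj (show l + 1 + a ≤ 2 * l + 1 by omega)).base ∈ c.chart.source := by
      rwa [Jet.base_proj]
    have hp : (y.proj (show l + 1 + a ≤ 2 * l + 1 by omega)).proj (Nat.le_add_right (l + 1) a) =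
        y.proj (show l + 1 ≤ 2 * l + 1 by omega) := by
      obtain ⟨p, rfl⟩ := y.exists_mk
      rfl
    have h3 := (smoothIn_lagPartial (c := c) hL
      ⟨r + 1 + a, by omega⟩).localDeriv_iterTotalDeriv_single a hy' (u.2 ⟨l + 1 + a, by omega⟩)
    rw [hp, hlast] at h3
    rw [smul_apply, ContinuousLinearMap.comp_apply]
    refine congrArg _ ?_
    simp only [hlast, ht]
    exact h3
  · intro i _ hi
    have hia : (i : ℕ) < a := by
      have h3 := i.2
      have : (i : ℕ) ≠ a := fun h => hi (Fin.ext h)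
      omega
    have ht : trunc V (show l + 1 + (i : ℕ) ≤ 2 * l + 1 by omega) u = 0 :=
      Prod.ext hu (funext fun j => hu' ⟨j, by omega⟩ (by have := j.2; simp; omega))
    rw [smul_apply, ContinuousLinearMap.comp_apply, ht, map_zero, smul_zero]
  · simp

theorem localDeriv_legendreCoord_vertical (hL : ContMDiff (jetModel V (l + 1)) 𝓘(ℝ, ℝ) ∞ L)
    {y : Jet V π (2 * l + 1)} (hy : y.base ∈ c.chart.source) (u : JetModel V (2 * l + 1))
    (w : Fin (l + 1) → V) :
    localDeriv c (legendreCoord c L) y u (0, w) =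
      ∑ r : Fin (l + 1), localDeriv c (momentum c L r) y u (w r) := by
  set x := Jet.natHomeo (2 * l + 1) c y
  have hx : x = x + (0 : ℝ) • u := by simp
  have hline := hasDerivAt_line x u
  have h1 := (((contDiffOn_legendreCoord hL c).hasFDerivAt hy).comp_hasDerivAt_of_eq (0 : ℝ)
    hline hx).clm_apply (hasDerivAt_const (0 : ℝ) ((0, w) : JetModel V l))
  have h2 := HasDerivAt.fun_sum (u := Finset.univ) fun r (_ : r ∈ Finset.univ) =>
    (((smoothIn_momentum (c := c) hL r).hasFDerivAt hy).comp_hasDerivAt_of_eq (0 : ℝ)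
      hline hx).clm_apply (hasDerivAt_const (0 : ℝ) (w r))
  simp only [map_zero, add_zero] at h1 h2
  refine h1.unique (h2.congr_of_eventuallyEq (Filter.Eventually.of_forall fun ε => ?_))
  change legendreCoord c L _ (0, w) = _
  rw [legendreCoord_apply, mul_zero, zero_add]
  rfl

/-- Differentiating the identity `legendreCoord_shift` in the direction `u`: the product rule gives
the derivative of the covector and that of the shift. The derivative of the coefficient `p` never
has to be computed. -/
theorem localDeriv_legendreCoord_shift (hL : ContMDiff (jetModel V (l + 1)) 𝓘(ℝ, ℝ) ∞ L)
    {y : Jet V π (2 * l + 1)} (hy : y.base ∈ c.chart.source) (u : JetModel V (2 * l + 1)) :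
    localDeriv c (legendreCoord c L) y u (shift (by omega) (Jet.natHomeo (2 * l + 1) c y)) +
      ∑ r : Fin (l + 1), momentum c L r y (u.2 ⟨r + 1, by omega⟩) =
      localDeriv c L (y.proj (by omega)) (trunc V (by omega) u) := by
  set x := Jet.natHomeo (2 * l + 1) c y
  have hx : x = x + (0 : ℝ) • u := by simp
  have hline := hasDerivAt_line x u
  have hsh : HasDerivAt (fun ε : ℝ => shift (show l < 2 * l + 1 by omega) (x + ε • u))
      ((0, fun i => u.2 ⟨i + 1, by omega⟩) : JetModel V l) 0 :=
    (hasDerivAt_const _ _).prodMk (hasDerivAt_pi.2 fun i => hasDerivAt_jetModel_snd hline _)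
  have h1 := (((contDiffOn_legendreCoord hL c).hasFDerivAt hy).comp_hasDerivAt_of_eq (0 : ℝ)
    hline hx).clm_apply hsh
  have h0 : SmoothIn c L := .of_contMDiff hL
  have h2 := ((h0.comp_proj (show l + 1 ≤ 2 * l + 1 by omega)).hasFDerivAt
    hy).comp_hasDerivAt_of_eq (0 : ℝ) hline hx
  rw [h0.localDeriv_comp_proj _ hy] at h2
  -- The identity to be differentiated uses that the chart inverts its inverse, which holds only on
  -- the target; hence small `ε`.
  have hev : ∀ᶠ ε : ℝ in 𝓝 0, x + ε • u ∈ (Jet.natHomeo (2 * l + 1) c).target := by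
    refine hline.continuousAt.eventually (p := fun z => z ∈ (Jet.natHomeo (2 * l + 1) c).target) ?_
    change ∀ᶠ z in 𝓝 (x + (0 : ℝ) • u), _
    rw [← hx]
    exact (Jet.natHomeo (2 * l + 1) c).open_target.mem_nhds
      ((Jet.natHomeo (2 * l + 1) c).map_source hy)
  have h3 := h1.unique (h2.congr_of_eventuallyEq (hev.mono fun ε hε => ?_))
  · refine Eq.trans ?_ h3
    have e1 : ∀ z, z = x → legendreCoord c L ((Jet.natHomeo (2 * l + 1) c).symm z)
        ((0, fun i => u.2 ⟨i + 1, by omega⟩) : JetModel V l) =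
        ∑ r : Fin (l + 1), momentum c L r y (u.2 ⟨r + 1, by omega⟩) := by
      rintro z rfl
      rw [legendreCoord_apply, mul_zero, zero_add, (Jet.natHomeo (2 * l + 1) c).left_inv hy]
    rw [← e1 _ hx.symm, ← hx]
    exact congrArg (fun z => _ + legendreCoord c L ((Jet.natHomeo (2 * l + 1) c).symm z) _) hx
  · have h4 := legendreCoord_shift c L ((Jet.natHomeo (2 * l + 1) c).symm (x + ε • u))
    rw [(Jet.natHomeo (2 * l + 1) c).right_inv hε] at h4
    exact h4

end LocalDeriv

/-! ### Solutions for regular Lagrangians -/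

section Regular

open Unified

variable {L : Jet V π (l + 1) → ℝ}

theorem graphVec_snd (hL : ContMDiff (jetModel V (l + 1)) 𝓘(ℝ, ℝ) ∞ L)
    (y : Jet V π (2 * l + 1)) (u : TangentSpace (jetModel V (2 * l + 1)) y) :
    (vec (graphVec L y u)).2 =
      localDeriv (Jet.someChart V π y.base) (legendreCoord (Jet.someChart V π y.base) L) y u := by
  have hy := Jet.mem_someChart_source (V := V) (π := π) y.base
  have h1 := (hasMFDerivAt_coord (legendreGraph L y)).comp y (hasMFDerivAt_legendreGraph hL y)
  have h2 := (ContinuousLinearMap.snd ℝ (JetModel V (2 * l + 1))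
    (JetModel V l →L[ℝ] ℝ)).hasMFDerivAt.comp y h1
  have h3 := ((contDiffOn_legendreCoord hL (Jet.someChart V π y.base)).hasMFDerivAt
    hy).congr_of_eventuallyEq (f₁ := fun z => covCoord (projMap V π l y) (legendreExt L z)) (by
      filter_upwards [Jet.eventually_mem_source _ hy] with z hz
      exact covCoord_legendreExt hL hz)
  have h4 : (_ : JetModel V (2 * l + 1) →L[ℝ] (JetModel V l →L[ℝ] ℝ)) = _ :=
    hasMFDerivAt_unique h2 h3
  exact (congrArg (fun T => T u) h4).trans
    (congrArg (localDeriv _ (legendreCoord _ L) y) (Jet.vecCoord_someChart y u))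

theorem poincareCartan_apply (hL : ContMDiff (jetModel V (l + 1)) 𝓘(ℝ, ℝ) ∞ L)
    (y : Jet V π (2 * l + 1)) (u v : TangentSpace (jetModel V (2 * l + 1)) y) :
    poincareCartan L y u v =
      localDeriv (Jet.someChart V π y.base) (legendreCoord (Jet.someChart V π y.base) L) y v
        (trunc V (by omega) u) -
      localDeriv (Jet.someChart V π y.base) (legendreCoord (Jet.someChart V π y.base) L) y u
        (trunc V (by omega) v) := by
  rw [poincareCartan_eq hL, form_apply, graphVec_snd hL, graphVec_snd hL]
  exact congrArg₂ (fun a b => localDeriv _ (legendreCoord _ L) y v (trunc V _ a) -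
    localDeriv _ (legendreCoord _ L) y u (trunc V _ b)) (graphVec_fst hL y u) (graphVec_fst hL y v)

/-- The extended Legendre-Ostrogradsky map of a regular Lagrangian is an immersion. -/
theorem IsRegularLagrangian.eq_zero (hL : ContMDiff (jetModel V (l + 1)) 𝓘(ℝ, ℝ) ∞ L)
    (hreg : IsRegularLagrangian L) (y : Jet V π (2 * l + 1))
    (u : TangentSpace (jetModel V (2 * l + 1)) y) (hu : trunc V (show l ≤ 2 * l + 1 by omega) u = 0)
    (hu' : localDeriv (Jet.someChart V π y.base)
      (legendreCoord (Jet.someChart V π y.base) L) y u = 0) : u = 0 := by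
  -- On `U` the smooth map `g ∘ quotMap` is a left inverse of `legendreExt L`. By the chain rule the
  -- differential of the latter is injective.
  obtain ⟨U, O, g, hyU, hU, hO, hUO, -, hgU, -, hsm, hg⟩ := hreg y
  have h1 := ((hsm.contMDiffAt (hU.mem_nhds hyU)).mdifferentiableAt (by simp)).hasMFDerivAt
  have h2 := ((hg.contMDiffAt (x := legendreExt L y)
    (hO.mem_nhds (hUO hyU))).mdifferentiableAt (by simp)).hasMFDerivAt
  have h3 := (h2.comp y h1).congr_of_eventuallyEq (f₁ := id)
    (Filter.eventuallyEq_of_mem (hU.mem_nhds hyU) fun z hz => (hgU hz).symm)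
  have h4 : mfderiv (jetModel V (2 * l + 1)) (cotModel V l) (legendreExt L) y u =
      (0 : JetModel V l × (JetModel V l →L[ℝ] ℝ)) := by
    rw [mfderiv_legendreExt hL]
    refine (mfderiv_rho2 (legendreGraph L y) (graphVec L y u)).trans (Prod.ext ?_ ?_)
    · exact (congrArg (trunc V _) (graphVec_fst hL y u)).trans hu
    · exact (graphVec_snd hL y u).trans hu'
  have h5 := congrArg (fun T => T u) (hasMFDerivAt_unique (hasMFDerivAt_id y) h3)
  refine h5.trans ?_
  exact (congrArg (mfderiv (cotModel V l) (jetModel V (2 * l + 1))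
    (fun α => g (quotMap α)) (legendreExt L y)) h4).trans (map_zero _)

theorem momentum_last (c : AdaptedChart V π) (L : Jet V π (l + 1) → ℝ) (y : Jet V π (2 * l + 1)) :
    momentum c L (Fin.last l) y = lagPartial c L (Fin.last (l + 1)) (y.proj (by omega)) := by
  rw [momentum, Finset.sum_eq_single ⟨0, by simp⟩]
  · exact one_smul _ _
  · intro i _ hi
    exact absurd (Fin.ext (by have := i.2; simp at this ⊢; omega)) hi
  · simp

theorem localDeriv_single (c : AdaptedChart V π) (L : Jet V π (l + 1) → ℝ) (j : Fin (l + 1 + 1))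
    (z : Jet V π (l + 1)) (ξ : V) :
    localDeriv c L z (0, Pi.single j ξ) = lagPartial c L j z ξ := rfl

/-- The Hessian `∂²L/∂q_{l+1}∂q_{l+1}` of a regular Lagrangian is nondegenerate. -/
theorem IsRegularLagrangian.hessian (hL : ContMDiff (jetModel V (l + 1)) 𝓘(ℝ, ℝ) ∞ L)
    (hreg : IsRegularLagrangian L) (y : Jet V π (2 * l + 1)) (ξ : V)
    (hξ : localDeriv (Jet.someChart V π y.base) (lagPartial (Jet.someChart V π y.base) L
      (Fin.last (l + 1))) (y.proj (show l + 1 ≤ 2 * l + 1 by omega))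
        (0, Pi.single (Fin.last (l + 1)) ξ) = 0) : ξ = 0 := by
  set c := Jet.someChart V π y.base
  have hy : y.base ∈ c.chart.source := Jet.mem_someChart_source y.base
  -- Only `p̂^0` can feel the highest coordinate `q_{2l+1}`, and it does so through the Hessian,
  -- which kills `ξ`. The aim is to show that this `u` lies in the kernel of the differential of the
  -- extended Legendre map.
  set u : JetModel V (2 * l + 1) := (0, Pi.single (Fin.last (2 * l + 1)) ξ)
  have hu0 : ∀ i : Fin (2 * l + 1 + 1), (i : ℕ) < 2 * l + 1 → u.2 i = 0 := fun i hi =>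
    Pi.single_eq_of_ne (M := fun _ => V) (fun h => by rw [h] at hi; simp at hi) _
  have hmom : ∀ r : Fin (l + 1), localDeriv c (momentum c L r) y u = 0 := by
    intro r
    obtain ⟨a, ha⟩ : ∃ a, (r : ℕ) + a = l := ⟨l - r, by omega⟩
    rw [localDeriv_momentum hL hy ha rfl fun i hi => hu0 i (by omega)]
    by_cases hal : a = l
    · have : (⟨l + 1 + a, by omega⟩ : Fin (2 * l + 1 + 1)) = Fin.last (2 * l + 1) :=
        Fin.ext (by simp; omega)
      rw [this, show u.2 (Fin.last (2 * l + 1)) = ξ from Pi.single_eq_same (M := fun _ => V) _ _,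
        hξ, smul_zero]
    · rw [hu0 _ (by simp; omega), Pi.single_zero]
      exact (congrArg _ (map_zero _)).trans (smul_zero _)
  have htr : trunc V (show l ≤ 2 * l + 1 by omega) u = 0 :=
    Prod.ext rfl (funext fun i => hu0 ⟨i, by omega⟩ (by simp; omega))
  have hA : localDeriv c (legendreCoord c L) y u = 0 := by
    have hs := localDeriv_legendreCoord_shift hL hy u
    have hv := localDeriv_legendreCoord_vertical hL hy u
    set sh := shift (show l < 2 * l + 1 by omega) (Jet.natHomeo (2 * l + 1) c y)
    -- For `l > 0` both sides vanish, as `u` has no component of order at most `l + 1`. For `l = 0`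
    -- the direction `q_{2l+1}` is `q_{l+1}`, and the two sides agree because `p̂^l = ∂L/∂q_{l+1}`.
    have hsum : ∑ r : Fin (l + 1), momentum c L r y (u.2 ⟨r + 1, by omega⟩) =
        localDeriv c L (y.proj (by omega)) (trunc V (by omega) u) := by
      rw [Finset.sum_eq_single (Fin.last l)]
      · rw [momentum_last, ← localDeriv_single]
        refine congrArg _ (Prod.ext rfl (funext fun i => ?_))
        by_cases hi : i = Fin.last (l + 1)
        · subst hi
          exact Pi.single_eq_same (M := fun _ => V) _ _
        · have : (i : ℕ) < l + 1 :=
            lt_of_le_of_ne (Nat.lt_succ_iff.1 i.2) fun h => hi (Fin.ext h)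
          exact (Pi.single_eq_of_ne (M := fun _ => V) hi _).trans
            (hu0 ⟨i, by omega⟩ (by simp; omega)).symm
      · intro r _ hr
        have : (r : ℕ) < l := lt_of_le_of_ne (Nat.lt_succ_iff.1 r.2) fun h => hr (Fin.ext h)
        rw [hu0 _ (by simp; omega), map_zero]
      · simp
    rw [hsum] at hs
    refine ContinuousLinearMap.ext fun x => ?_
    -- The holonomic lift `sh` and the vectors without time component span the model; the derivative
    -- of the covector has been shown to vanish on each.
    have hx : x = x.1 • sh + (0, x.2 - x.1 • sh.2) :=
      Prod.ext (by simp [sh]) (by simp)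
    rw [hx, map_add, map_smul, hv, Finset.sum_eq_zero fun r _ => by rw [hmom r]; rfl,
      add_eq_right.1 hs]
    simp
  have h0 := IsRegularLagrangian.eq_zero hL hreg y u htr hA
  have h1 := congrFun (congrArg Prod.snd h0) (Fin.last (2 * l + 1))
  exact (Pi.single_eq_same (M := fun _ => V) _ _).symm.trans h1

/-- The Ostrogradsky recursion at a single jet: the left side is the time derivative of `p̂^{r+1}`
along the prolongation of `p`. -/
theorem localDeriv_momentum_lift (hL : ContMDiff (jetModel V (l + 1)) 𝓘(ℝ, ℝ) ∞ L)
    {c : AdaptedChart V π} (p : PreJet V π) (hc : p.base ∈ c.chart.source) {r : ℕ} (hr : r < l) :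
    localDeriv c (momentum c L ⟨r + 1, by omega⟩) (Jet.mk (2 * l + 1) p)
        (1, fun i => p.deriv c (i + 1)) =
      lagPartial c L ⟨r + 1, by omega⟩ (Jet.mk (l + 1) p) -
        momentum c L ⟨r, by omega⟩ (Jet.mk (2 * l + 1) p) := by
  have ht := PreJet.time_mem_domain hc
  have h1 := (smoothIn_momentum (c := c) hL ⟨r + 1, by omega⟩).hasDerivAt_lift p hc
  have h2 := hasDerivAt_ostrogradskySum_succ (fun j => contDiffAt_lagPartialAlong hL ht j)
    (show r < l + 1 by omega)
  have h3 := h1.unique (h2.congr_of_eventuallyEq (by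
    filter_upwards [(p.isOpen_domain c).mem_nhds ht] with s hs
    exact momentum_lift hL hs _))
  refine h3.trans ?_
  rw [← momentum_lift hL ht ⟨r, by omega⟩, lagPartialAlong, dif_pos (by omega), Jet.lift_time,
    Jet.lift_time]

/-- The vector `u` is compared with a holonomic vector `e`. Their difference `z` vanishes up to
order `l` by the type `l + 1` condition and is killed by `dp̂^1, …, dp̂^l` by the equation;
nondegeneracy of the Hessian then forces the components of orders `l + 1, …, 2l` to vanish too. -/
theorem IsRegularLagrangian.isSemisprayVector
    (hL : ContMDiff (jetModel V (l + 1)) 𝓘(ℝ, ℝ) ∞ L) (hreg : IsRegularLagrangian L)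
    (y : Jet V π (2 * l + 1)) (u : TangentSpace (jetModel V (2 * l + 1)) y)
    (hs : IsSemisprayVector (l + 1) y u) (ht : dTime V π (2 * l + 1) y u = 1)
    (h : ∀ v, poincareCartan L y u v = 0) : IsSemisprayVector 1 y u := by
  set c := Jet.someChart V π y.base
  have hy : y.base ∈ c.chart.source := Jet.mem_someChart_source y.base
  rw [dTime_eq] at ht
  have htr := (isSemisprayVector_last_iff y u).1 hs
  rw [ht, one_smul] at htr
  set u' : JetModel V (2 * l + 1) := u
  set x := Jet.natHomeo (2 * l + 1) c y
  set p := y.rep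
  have hp : Jet.mk (2 * l + 1) p = y := y.mk_rep
  have hpc : p.base ∈ c.chart.source := by
    rw [← hp] at hy
    exact hy
  have hx : x = (p.time, fun i : Fin (2 * l + 1 + 1) => p.deriv c i) := by
    rw [← Jet.natHomeo_mk c p hpc, hp]
  -- The last entry of `e` is a derivative of order `2l + 2`, which depends on the representative
  -- `p` and not only on `y`. This is harmless: only the entries of index at most `2l` matter for
  -- type `1`.
  set e : JetModel V (2 * l + 1) := (1, fun i => p.deriv c (i + 1))
  set z := u' - e
  have hz0 : z.1 = 0 := sub_eq_zero.2 ht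
  have hzi : ∀ i (hi : i ≤ l), z.2 ⟨i, by omega⟩ = 0 := by
    intro i hi
    refine sub_eq_zero.2 ((congrFun (congrArg Prod.snd htr) ⟨i, by omega⟩).trans ?_)
    rw [shift_snd]
    rw [hx]
  have hmom : ∀ r (hr : r < l), localDeriv c (momentum c L ⟨r + 1, by omega⟩) y z = 0 := by
    intro r hr
    have h1 := localDeriv_momentum_lift hL p hpc hr
    rw [hp] at h1
    refine (map_sub _ u' e).trans (sub_eq_zero.2 ?_)
    rw [h1]
    refine ContinuousLinearMap.ext fun ξ => ?_
    -- The test vector `ξ ∂/∂q_{r+1}`, with `r + 1 ≤ l` so that it survives truncation to `J^l π`.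
    -- Then `Ω_L(u, v) = 0` reads `dp̂^{r+1}(u) = ∂L/∂q_{r+1} - p̂^r` on `ξ`, the value already
    -- found for `e`.
    set v : JetModel V (2 * l + 1) := (0, Pi.single ⟨r + 1, by omega⟩ ξ)
    have h2 := sub_eq_zero.1 ((poincareCartan_apply hL y u v).symm.trans (h v))
    have h3 := localDeriv_legendreCoord_shift hL hy v
    have h4 := localDeriv_legendreCoord_vertical hL hy u' (Pi.single ⟨r + 1, by omega⟩ ξ)
    have hv : ∀ (m : ℕ) (hm : m ≤ 2 * l + 1) (hrm : r + 1 ≤ m),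
        trunc V hm v = (0, Pi.single ⟨r + 1, by omega⟩ ξ) := by
      intro m hm hrm
      refine Prod.ext rfl (funext fun i => ?_)
      simp only [trunc_snd, v, Pi.single_apply, Fin.ext_iff]
    rw [hv (l + 1) (by omega) (by omega), localDeriv_single] at h3
    have h5 : localDeriv c (legendreCoord c L) y v (shift (by omega) x) =
        localDeriv c (legendreCoord c L) y u' (0, Pi.single ⟨r + 1, by omega⟩ ξ) := by
      rw [← htr, ← hv l (by omega) (by omega)]
      exact h2
    rw [h5, h4, Finset.sum_eq_single ⟨r + 1, by omega⟩, Finset.sum_eq_single ⟨r, by omega⟩] at h3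
    · have hp' : Jet.mk (l + 1) p = y.proj (by omega) := by
        rw [← hp]
        rfl
      rw [hp', sub_apply, ← h3]
      simp [v]
    · intro j _ hj
      have : (⟨j + 1, by omega⟩ : Fin (2 * l + 1 + 1)) ≠ ⟨r + 1, by omega⟩ :=
        fun h => hj (Fin.ext (by simpa using h))
      simp [v, Pi.single_eq_of_ne this]
    · simp
    · intro j _ hj
      rw [Pi.single_eq_of_ne hj, map_zero]
    · simp
  -- Triangular induction: once the components below order `l + 1 + a` vanish, `dp̂^{l-a}(z)` is, up
  -- to sign, the Hessian applied to the component of order `l + 1 + a`. As `a ≤ l - 1`, the index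
  -- `l - a` is at least `1`, where `dp̂` is known to kill `z`; it is written `l - 1 - a + 1` to
  -- match `hmom`.
  have hz : ∀ i (hi : i ≤ 2 * l), z.2 ⟨i, by omega⟩ = 0 := by
    intro i
    induction i using Nat.strong_induction_on with
    | _ i ih =>
      intro hi
      by_cases hil : i ≤ l
      · exact hzi i hil
      · obtain ⟨a, rfl⟩ : ∃ a, i = l + 1 + a := ⟨i - (l + 1), by omega⟩
        have h1 := localDeriv_momentum hL hy (r := ⟨l - 1 - a + 1, by omega⟩) (a := a)
          (by simp; omega) hz0 fun j hj => ih j hj (by omega)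
        rw [hmom (l - 1 - a) (by omega)] at h1
        exact hreg.hessian hL y _ ((smul_eq_zero_iff_right (by simp)).1 h1.symm)
  rw [Jet.isSemisprayVector_iff ⟨le_rfl, by omega⟩ hy]
  intro i hi
  rw [Jet.vecCoord_someChart]
  have h1 := sub_eq_zero.1 (hz i (by omega))
  have h2 : u'.1 • x.2 ⟨i + 1, by omega⟩ = p.deriv c (i + 1) := by
    rw [show u'.1 = 1 from ht, one_smul, hx]
  exact h1.trans h2.symm

end Regular

/-! ### The correspondence between solutions on `W_o` and on `J^{2l+1} π` -/

section Correspondence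

open Unified

variable {L : Jet V π (l + 1) → ℝ}

/-- The vector field on `J^{2l+1} π` to which a vector field along `W_1` projects. -/
def projField (L : Jet V π (l + 1) → ℝ) (X : UnifiedField V π l) : JetField V π (2 * l + 1) :=
  fun y => mfderiv (uniModel V l) (jetModel V (2 * l + 1)) rho1 (legendreGraph L y)
    (X (legendreGraph L y))

theorem relatedOn_projField (X : UnifiedField V π l) : X.RelatedOn (projField L X) (W1 L) := by
  rintro _ ⟨y, rfl⟩
  rfl

/-- `ρ_1` maps `W_1` onto `J^{2l+1} π`, so the relation alone prescribes every value of `Y`. -/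
theorem eq_projField {X : UnifiedField V π l} {Y : JetField V π (2 * l + 1)}
    (h : X.RelatedOn Y (W1 L)) : Y = projField L X :=
  funext fun y => (h (legendreGraph L y) ⟨y, rfl⟩).symm

theorem isSmooth_projField (hL : ContMDiff (jetModel V (l + 1)) 𝓘(ℝ, ℝ) ∞ L)
    {X : UnifiedField V π l} (hX : X.IsFieldAlong L) : (projField L X).IsSmooth := by
  have h1 := hX.contMDiffOn.comp_contMDiff (contMDiff_legendreGraph hL) fun y => ⟨y, rfl⟩
  have h2 := (contMDiff_rho1 (V := V) (π := π) (l := l)).contMDiff_tangentMap (m := ∞) (by simp)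
  exact h2.comp h1

/-- `Tρ_1` is a left inverse of the tangent map of the graph, so a vector tangent to `W_1` is
recovered from its projection. -/
theorem eq_graphVec_of_isTangentW1On (hL : ContMDiff (jetModel V (l + 1)) 𝓘(ℝ, ℝ) ∞ L)
    {X : UnifiedField V π l} {A : Set (Unified V π l)} (hX : X.IsTangentW1On L A)
    {y : Jet V π (2 * l + 1)} (hy : legendreGraph L y ∈ A) :
    X (legendreGraph L y) = graphVec L y (projField L X y) := by
  obtain ⟨u, hu⟩ := hX y hy
  have h1 : projField L X y = u := by
    rw [projField, ← hu]
    exact mfderiv_rho1_graphVec hL y u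
  rw [h1]
  exact hu.symm

/-- The pointwise core of (a). Graph vectors are tangent to `W_o` and thus admissible in (1), where
they give `Ω_L`; the vertical test vectors give the semispray condition. -/
theorem solves_projField (hL : ContMDiff (jetModel V (l + 1)) 𝓘(ℝ, ℝ) ∞ L)
    {X : UnifiedField V π l} {A : Set (Unified V π l)} (hX : X.IsTangentW1On L A)
    (hs : X.SolvesOn L A) {y : Jet V π (2 * l + 1)} (hy : legendreGraph L y ∈ A) :
    (∀ v, poincareCartan L y (projField L X y) v = 0) ∧
      dTime V π (2 * l + 1) y (projField L X y) = 1 ∧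
      IsSemisprayVector (l + 1) y (projField L X y) := by
  have h1 := eq_graphVec_of_isTangentW1On hL hX hy
  obtain ⟨h2, h3⟩ := hs _ hy
  refine ⟨fun v => ?_, ?_, isSemisprayVector_of_form hL _ _ h2⟩
  · rw [poincareCartan_eq hL, ← h1]
    exact h2 _ (isTangentWo_graphVec hL y v)
  · refine (dTime_eq y _).trans (Eq.trans ?_ ((mfderiv_rhoR _ _).symm.trans h3))
    exact congrArg Prod.fst (mfderiv_rho1 (legendreGraph L y) (X (legendreGraph L y)))

open Classical in
/-- The vector field along `W_1` tangent to `W_1` which lifts a vector field on `J^{2l+1} π`. -/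
def liftField (L : Jet V π (l + 1) → ℝ) (Y : JetField V π (2 * l + 1)) : UnifiedField V π l :=
  -- A point of `W_1` is recovered from its image under `ρ_1` only up to a propositional equality,
  -- hence the transport. The value `0` off `W_1` is a default.
  fun w => if h : legendreGraph L w.rho1 = w then
    (h ▸ graphVec L w.rho1 (Y w.rho1) : TangentSpace (uniModel V l) w) else
      (0 : TangentSpace (uniModel V l) w)

theorem liftField_legendreGraph (L : Jet V π (l + 1) → ℝ) (Y : JetField V π (2 * l + 1))
    (y : Jet V π (2 * l + 1)) : liftField L Y (legendreGraph L y) = graphVec L y (Y y) :=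
  dif_pos rfl

theorem isFieldAlong_liftField (hL : ContMDiff (jetModel V (l + 1)) 𝓘(ℝ, ℝ) ∞ L)
    {Y : JetField V π (2 * l + 1)} (hY : Y.IsSmooth) : (liftField L Y).IsFieldAlong L := by
  refine ⟨?_, ?_⟩
  · have h1 := (contMDiff_legendreGraph hL).contMDiff_tangentMap (m := ∞) (by simp)
    -- On `W_1` the lift agrees with the tangent map of the graph composed with `Y ∘ ρ_1`, which is
    -- smooth on all of `W`.
    refine ((h1.comp hY).comp contMDiff_rho1).contMDiffOn.congr ?_
    rintro _ ⟨y, rfl⟩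
    exact congrArg (Bundle.TotalSpace.mk (legendreGraph L y)) (liftField_legendreGraph L Y y)
  · rintro _ ⟨y, rfl⟩
    rw [liftField_legendreGraph]
    exact isTangentWo_graphVec hL y _

theorem isTangentW1On_liftField (L : Jet V π (l + 1) → ℝ) (Y : JetField V π (2 * l + 1))
    (A : Set (Unified V π l)) : (liftField L Y).IsTangentW1On L A :=
  fun y _ => ⟨Y y, (liftField_legendreGraph L Y y).symm⟩

theorem relatedOn_liftField (hL : ContMDiff (jetModel V (l + 1)) 𝓘(ℝ, ℝ) ∞ L)
    (Y : JetField V π (2 * l + 1)) : (liftField L Y).RelatedOn Y (W1 L) := by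
  rintro _ ⟨y, rfl⟩
  rw [liftField_legendreGraph]
  exact mfderiv_rho1_graphVec hL y _

theorem solvesOn_liftField (hL : ContMDiff (jetModel V (l + 1)) 𝓘(ℝ, ℝ) ∞ L)
    {Y : JetField V π (2 * l + 1)} {S : Set (Jet V π (2 * l + 1))} (hs : Y.SolvesOn L S)
    (hY : Y.IsSemisprayOn (l + 1) S) : (liftField L Y).SolvesOn L {w ∈ W1 L | w.rho1 ∈ S} := by
  rintro _ ⟨⟨y, rfl⟩, hy⟩
  obtain ⟨h1, h2⟩ := hs y hy
  rw [liftField_legendreGraph]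
  refine ⟨form_graphVec_eq_zero hL y (hY y hy) h1, ?_⟩
  refine (mfderiv_rhoR _ _).trans (Eq.trans ?_ ((dTime_eq y _).symm.trans h2))
  exact congrArg Prod.fst (graphVec_fst hL y (Y y))

theorem eq_liftField (hL : ContMDiff (jetModel V (l + 1)) 𝓘(ℝ, ℝ) ∞ L)
    {Y : JetField V π (2 * l + 1)} {S : Set (Jet V π (2 * l + 1))} (hs : Y.SolvesOn L S)
    (hY : Y.IsSemisprayOn (l + 1) S) {X : UnifiedField V π l}
    (hX : X.RelatedOn Y {w ∈ W1 L | w.rho1 ∈ S}) (hXs : X.SolvesOn L {w ∈ W1 L | w.rho1 ∈ S})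
    {w : Unified V π l} (hw : w ∈ W1 L) (hwS : w.rho1 ∈ S) : X w = liftField L Y w := by
  obtain ⟨y, rfl⟩ := hw
  rw [liftField_legendreGraph]
  exact eq_graphVec_of_form hL y (hY y hwS) (hs y hwS).1 _ (hXs _ ⟨⟨y, rfl⟩, hwS⟩).1
    (hX _ ⟨⟨y, rfl⟩, hwS⟩)

/-- `ρ_1` sends integral sections of `X` inside `W_1` to integral sections of `Y`, which are
holonomic. -/
theorem UnifiedField.RelatedOn.isSemispray {X : UnifiedField V π l}
    {Y : JetField V π (2 * l + 1)} (h : X.RelatedOn Y (W1 L)) {hr : 1 ≤ r ∧ r ≤ 2 * l + 1}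
    (hY : Y.IsSemispray r hr) : X.IsSemispray L r hr := by
  intro ψ a b hsm ht hψ
  refine hY _ a b (contMDiff_rho1.comp_contMDiffOn hsm) (fun s hs => (ht s hs).2) fun s hs => ?_
  have h1 := ((contMDiff_rho1 (ψ s)).mdifferentiableAt (by simp)).hasMFDerivAt.comp_hasMFDerivWithinAt
    s (hψ s hs)
  refine h1.congr_mfderiv (ContinuousLinearMap.ext fun (a : ℝ) => ?_)
  have h2 := h _ (ht s hs).1
  change mfderiv (uniModel V l) (jetModel V (2 * l + 1)) rho1 (ψ s) (a • X (ψ s)) = a • Y _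
  rw [map_smul, h2]

end Correspondence

end
end JetMech

/-! ### The global and pointwise correspondences -/

theorem mainTheorem2
    {V : Type*} [NormedAddCommGroup V] [NormedSpace ℝ V] [FiniteDimensional ℝ V]
    {E : Type*} [TopologicalSpace E] [T2Space E] [SecondCountableTopology E]
    [ChartedSpace (ℝ × V) E] [IsManifold 𝓘(ℝ, ℝ × V) ∞ E]
    (π : E → ℝ) [IsFibred V π]
    -- the order of the Lagrangian is `k = l + 1`, so that `2 k - 1 = 2 l + 1`
    (l : ℕ) (L : Jet V π (l + 1) → ℝ) (hL : ContMDiff (jetModel V (l + 1)) 𝓘(ℝ, ℝ) ∞ L) :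
    -- from `X_o` to `X_L`, on the whole of `W_1`
    (∀ X : UnifiedField V π l, X.IsFieldAlong L →
      X.SolvesOn L (W1 L) → X.IsTangentW1On L (W1 L) →
      ∃ Y : JetField V π (2 * l + 1),
        Y.IsSmooth ∧ X.RelatedOn Y (W1 L) ∧
        Y.SolvesOn L Set.univ ∧
        Y.IsSemispray (l + 1) ⟨by omega, by omega⟩ ∧
        (IsRegularLagrangian L → Y.IsSemispray 1 ⟨by omega, by omega⟩) ∧
        ∀ Y' : JetField V π (2 * l + 1), Y'.IsSmooth → X.RelatedOn Y' (W1 L) → Y' = Y) ∧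
    -- from `X_o` to `X_L`, when the hypotheses hold at the points of `W_f` only
    (∀ (X : UnifiedField V π l) (Wf : Set (Unified V π l)), Wf ⊆ W1 L → X.IsFieldAlong L →
      X.SolvesOn L Wf → X.IsTangentW1On L Wf →
      ∃ Y : JetField V π (2 * l + 1),
        Y.IsSmooth ∧ X.RelatedOn Y (W1 L) ∧
        Y.SolvesOn L (Unified.rho1 '' Wf) ∧
        Y.IsSemisprayOn (l + 1) (Unified.rho1 '' Wf) ∧
        (IsRegularLagrangian L → Y.IsSemisprayOn 1 (Unified.rho1 '' Wf)) ∧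
        ∀ Y' : JetField V π (2 * l + 1), Y'.IsSmooth → X.RelatedOn Y' (W1 L) → Y' = Y) ∧
    -- from `X_L` to `X_o`, globally
    (∀ (r : ℕ) (hr : 1 ≤ r ∧ r ≤ l + 1) (Y : JetField V π (2 * l + 1)), Y.IsSmooth →
      Y.IsSemispray r ⟨hr.1, by omega⟩ → Y.SolvesOn L Set.univ →
      ∃ X : UnifiedField V π l,
        X.IsFieldAlong L ∧ X.IsTangentW1On L (W1 L) ∧ X.RelatedOn Y (W1 L) ∧
        X.SolvesOn L (W1 L) ∧
        X.IsSemispray L r ⟨hr.1, by omega⟩ ∧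
        ∀ X' : UnifiedField V π l, X'.IsFieldAlong L → X'.RelatedOn Y (W1 L) →
          X'.SolvesOn L (W1 L) → ∀ w ∈ W1 L, X' w = X w) ∧
    -- from `X_L` to `X_o`, when the hypotheses hold at the points of `S_f` only
    (∀ (r : ℕ) (_ : 1 ≤ r ∧ r ≤ l + 1) (Y : JetField V π (2 * l + 1))
      (Sf : Set (Jet V π (2 * l + 1))), Y.IsSmooth →
      Y.IsSemisprayOn r Sf → Y.SolvesOn L Sf →
      ∃ X : UnifiedField V π l,
        X.IsFieldAlong L ∧ X.IsTangentW1On L (W1 L) ∧ X.RelatedOn Y (W1 L) ∧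
        X.SolvesOn L {w ∈ W1 L | w.rho1 ∈ Sf} ∧
        X.IsSemisprayOn r {w ∈ W1 L | w.rho1 ∈ Sf} ∧
        ∀ X' : UnifiedField V π l, X'.IsFieldAlong L →
          X'.RelatedOn Y {w ∈ W1 L | w.rho1 ∈ Sf} →
          X'.SolvesOn L {w ∈ W1 L | w.rho1 ∈ Sf} →
          ∀ w ∈ W1 L, w.rho1 ∈ Sf → X' w = X w) := by
  have : CompleteSpace V := FiniteDimensional.complete ℝ V
  refine ⟨fun X hX hs ht => ?_, fun X Wf hWf hX hs ht => ?_, fun r hr Y hY hsemi hs => ?_,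
    fun r hr Y Sf hY hsemi hs => ?_⟩
  · have key := fun y => solves_projField hL ht hs (y := y) ⟨y, rfl⟩
    refine ⟨projField L X, isSmooth_projField hL hX, relatedOn_projField X,
      fun y _ => ⟨(key y).1, (key y).2.1⟩, .of_isSemisprayOn _ fun y _ => (key y).2.2,
      fun hreg => .of_isSemisprayOn _ fun y _ =>
        hreg.isSemisprayVector hL y _ (key y).2.2 (key y).2.1 (key y).1,
      fun Y' _ h => eq_projField h⟩
  · have key : ∀ y ∈ Unified.rho1 '' Wf,
        (∀ v, poincareCartan L y (projField L X y) v = 0) ∧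
          dTime V π (2 * l + 1) y (projField L X y) = 1 ∧
          IsSemisprayVector (l + 1) y (projField L X y) := by
      rintro _ ⟨w, hw, rfl⟩
      obtain ⟨y, rfl⟩ := hWf hw
      exact solves_projField hL ht hs hw
    exact ⟨projField L X, isSmooth_projField hL hX, relatedOn_projField X,
      fun y hy => ⟨(key y hy).1, (key y hy).2.1⟩, fun y hy => (key y hy).2.2,
      fun hreg y hy =>
        hreg.isSemisprayVector hL y _ (key y hy).2.2 (key y hy).2.1 (key y hy).1,
      fun Y' _ h => eq_projField h⟩
  -- The hypothesis is about integral sections, while the algebra on `W` needs the coordinate form.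
  -- Existence of integral curves supplies it for type `r`, and `r ≤ l + 1` weakens it to the type
  -- that `Ω` detects. The conclusion about type `r` itself is transported through integral
  -- sections.
  · have hon : Y.IsSemisprayOn (l + 1) Set.univ := fun y hy =>
      (hsemi.isSemisprayOn hY (fun y => (hs y trivial).2) y hy).mono hr.1 hr.2 (by omega)
    have hW : {w ∈ W1 L | w.rho1 ∈ (Set.univ : Set (Jet V π (2 * l + 1)))} = W1 L := by simp
    have hsol := solvesOn_liftField hL hs hon
    rw [hW] at hsol
    refine ⟨liftField L Y, isFieldAlong_liftField hL hY, isTangentW1On_liftField L Y _,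
      relatedOn_liftField hL Y, hsol, (relatedOn_liftField hL Y).isSemispray hsemi,
      fun X' _ hrel hX's w hw => eq_liftField hL hs hon ?_ ?_ hw trivial⟩
    · rwa [hW]
    · rwa [hW]
  · have hon : Y.IsSemisprayOn (l + 1) Sf := fun y hy =>
      (hsemi y hy).mono hr.1 hr.2 (by omega)
    refine ⟨liftField L Y, isFieldAlong_liftField hL hY, isTangentW1On_liftField L Y _,
      relatedOn_liftField hL Y, solvesOn_liftField hL hs hon, ?_,
      fun X' _ hrel hX's w hw hwS => eq_liftField hL hs hon hrel hX's hw hwS⟩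
    rintro w ⟨hw, hwS⟩
    rw [relatedOn_liftField hL Y w hw]
    exact hsemi _ hwS
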